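/- Let $M,N\ge 0$ be integers with $N$ even, let $\theta_0\in\{+1,-1\}$, and let $2\kappa=(M-N-2)\theta_0$. For $1\le i\le M+N$ define the parity $[i]\in\mathbb Z/2$ by $(-1)^{[i]}=\theta_0$ if $i\le M$ and $(-1)^{[i]}=-\theta_0$ if $i>M$; the sign $\theta_i=+1$ if $i\le M+N/2$ and $\theta_i=-1$ otherwise; and the conjugate index $\bar\imath=M+1-i$ if $i\le M$ and $\bar\imath=2M+N+1-i$ if $i>M$. For a matrix $A=\sum A^{ij}E_{ij}$ put $A^t=\sum_{i,j}(-1)^{[i][j]+[j]}\theta_i\theta_j A^{ij}E_{\bar\jmath\bar\imath}$. In the graded tensor square of the algebra of $(M+N)\times(M+N)$ complex matrices ($E_{ij}$ having degree $[i]+[j]$) let $$P=\sum_{i,j}(-1)^{[j]}E_{ij}\otimes E_{ji},\qquad K=\sum_{i,j}(-1)^{[i][j]}\theta_i\theta_jE_{\bar\jmath\bar\imath}\otimes E_{ji},\qquad R(u)=\mathbb I+\frac{P}{u}-\frac{K}{u+\kappa}.$$ Let $\mathcal U(R)$ be the associative unital $\mathbb C$-algebra with generators $T^{ij}_{(n)}$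 ($1\le i,j\le M+N$, $n\ge 0$) and relations $T^{ij}_{(0)}=\delta_{ij}$ and $$R(u-v)\,T_1(u)\,T_2(v)=T_2(v)\,T_1(u)\,R(u-v),$$ where $T(u)=\sum_{i,j}T^{ij}(u)E_{ij}$, $T^{ij}(u)=\sum_{n\ge0}T^{ij}_{(n)}u^{-n}$, $T_1(u)=\sum T^{ij}(u)\,E_{ij}\otimes 1$, $T_2(v)=\sum T^{ij}(v)\,1\otimes E_{ij}$; the entries $T^{ij}_{(n)}$ are taken to commute with the matrices $E_{kl}$, and the relation is understood as the identity of formal power series in $u^{-1},v^{-1}$ obtained by multiplying it with $(u-v)(u-v+\kappa)u^{-2}v^{-2}$. Set $C(u)=T^t(u-\kappa)\,T(u)$, i.e. $C(u)^{il}=\sum_j T^t(u-\kappa)^{ij}\,T(u)^{jl}$. Theorem. There is a series $c(u)\in\mathcal U(R)[[u^{-1}]]$ with $C(u)=c(u)\,\mathbb I$, and all coefficients of $c(u)$ lie in the centre of $\mathcal U(R)$. The algebra $\mathcal U(R)$ is a Hopf superalgebra, with $T^{ij}_{(n)}$ of degree $[i]+[j]$ and $$\Delta(T^{ij}(u))=\sum_k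 T^{ik}(u)\otimes T^{kj}(u),\qquad \varepsilon(T(u))=\mathbb I,\qquad S(T(u))=T(u)^{-1},$$ where the product on the tensor square is $(a\otimes b)(a'\otimes b')=(-1)^{[b][a']}aa'\otimes bb'$. For this structure $\Delta(c(u))=c(u)\otimes c(u)$, and the two-sided ideal $\mathcal I$ generated by the coefficients of the entries of $C(u)-\mathbb I$ is also a coideal. The quotient $\mathcal U(R)/\mathcal I$ carries a Hopf superalgebra structure for which the projection $\mathcal U(R)\to\mathcal U(R)/\mathcal I$ is a morphism of Hopf superalgebras. -/

import Mathlib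

open scoped TensorProduct

noncomputable section

/-! ### Hopf superalgebras -/

/-- A Hopf superalgebra over `R`: a `ZMod 2`-graded algebra `A` with a coalgebra structure
(Mathlib's `Coalgebra`, i.e. coassociative and counital) and an antipode, all structure maps being
even; the coproduct is multiplicative for the graded product
`(a ⊗ b) (c ⊗ d) = (-1)^([b][c]) ac ⊗ bd` on `A ⊗ A`, which is Mathlib's `GradedTensorProduct`
(`GradedTensorProduct.of` is the identity map from `A ⊗ A` to that algebra). -/
structure HopfSuperalgebra (R A : Type*) [CommRing R] [Ring A] [Algebra R A]
    extends Coalgebra R A where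
  grading : ZMod 2 → Submodule R A
  [graded : GradedAlgebra grading]
  comul_one : comul 1 = 1 ⊗ₜ[R] 1
  comul_mul : ∀ a b : A,
    GradedTensorProduct.of R grading grading (comul (a * b)) =
      GradedTensorProduct.of R grading grading (comul a) *
        GradedTensorProduct.of R grading grading (comul b)
  comul_even : ∀ d : ZMod 2, ∀ a ∈ grading d,
    comul a ∈ ⨆ i : ZMod 2,
      LinearMap.range (TensorProduct.map (grading i).subtype (grading (d - i)).subtype)
  counit_one : counit 1 = 1
  counit_mul : ∀ a b : A, counit (a * b) = counit a * counit b
  counit_odd : ∀ a ∈ grading 1, counit a = 0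
  antipode : A →ₗ[R] A
  antipode_even : ∀ d : ZMod 2, ∀ a ∈ grading d, antipode a ∈ grading d
  mul_antipode_rTensor_comul :
    LinearMap.mul' R A ∘ₗ antipode.rTensor A ∘ₗ comul = Algebra.linearMap R A ∘ₗ counit
  mul_antipode_lTensor_comul :
    LinearMap.mul' R A ∘ₗ antipode.lTensor A ∘ₗ comul = Algebra.linearMap R A ∘ₗ counit

namespace HopfSuperalgebra

variable {R A B : Type*} [CommRing R] [Ring A] [Algebra R A] [Ring B] [Algebra R B]

/-- `I` is a coideal: `ε(I) = 0` and `Δ(I) ⊆ I ⊗ A + A ⊗ I`. -/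
def IsCoideal (H : HopfSuperalgebra R A) (I : Ideal A) : Prop :=
  (∀ x ∈ I, H.counit x = 0) ∧
    ∀ x ∈ I, H.comul x ∈
      LinearMap.range ((I.restrictScalars R).subtype.rTensor A) ⊔
        LinearMap.range ((I.restrictScalars R).subtype.lTensor A)

/-- An algebra homomorphism that is a morphism of Hopf superalgebras: it is even and commutes with
coproducts, counits and antipodes. -/
structure IsHom (H : HopfSuperalgebra R A) (H' : HopfSuperalgebra R B) (f : A →ₐ[R] B) :
    Prop where
  even : ∀ d : ZMod 2, ∀ a ∈ H.grading d, f a ∈ H'.grading d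
  comul : ∀ a, H'.comul (f a) = TensorProduct.map f.toLinearMap f.toLinearMap (H.comul a)
  counit : ∀ a, H'.counit (f a) = H.counit a
  antipode : ∀ a, H'.antipode (f a) = f (H.antipode a)

end HopfSuperalgebra

namespace RTT

/-! ### Indices, gradings and the transposition -/

/-- The `M + N` indices: `Sum.inl` holds the first `M` of them, `Sum.inr` the last `N`. -/
abbrev Idx (M N : ℕ) : Type := Fin M ⊕ Fin N

/-- The parity `[i]`: `(-1)^[i]` is `θ₀` on the first `M` indices and `-θ₀` on the last `N`. -/
def par {M N : ℕ} (θ₀ : ℤˣ) : Idx M N → ZMod 2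
  | Sum.inl _ => if θ₀ = 1 then 0 else 1
  | Sum.inr _ => if θ₀ = 1 then 1 else 0

/-- The sign `(-1)^x`. -/
def sgn (x : ZMod 2) : ℂ := if x = 0 then 1 else -1

/-- The sign `θ_i`: `+1` on the first `M + N / 2` indices and `-1` on the others. -/
def theta {M N : ℕ} : Idx M N → ℂ
  | Sum.inl _ => 1
  | Sum.inr a => if a.val < N / 2 then 1 else -1

/-- The conjugate index, reversing each of the two blocks of indices. -/
def bar {M N : ℕ} : Idx M N → Idx M N
  | Sum.inl a => Sum.inl a.rev
  | Sum.inr a => Sum.inr a.rev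

/-- `κ`, given by `2κ = (M - N - 2) θ₀`. -/
def kappa (M N : ℕ) (θ₀ : ℤˣ) : ℂ := ((M : ℂ) - (N : ℂ) - 2) * ((θ₀ : ℤ) : ℂ) / 2

/-- The transposition
`A^t = ∑_{i,j} (-1)^([i][j] + [j]) θ_i θ_j A^{ij} E_{bar j, bar i}`; the entry at `(k, l)` comes
from `i = bar l`, `j = bar k`. -/
def transp {M N : ℕ} (θ₀ : ℤˣ) {B : Type*} [Ring B] [Algebra ℂ B]
    (X : Matrix (Idx M N) (Idx M N) B) : Matrix (Idx M N) (Idx M N) B :=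
  Matrix.of fun k l =>
    (sgn (par θ₀ (bar l) * par θ₀ (bar k) + par θ₀ (bar k)) * theta (bar l) * theta (bar k)) •
      X (bar l) (bar k)

/-! ### The R-matrix -/

/-- Realisation of the graded tensor product of two matrix algebras on `V ⊗ V`, extended linearly
in the matrix entries: `E_{ij} ⊗ E_{kl}` maps `e_a ⊗ e_b` to
`(-1)^(([k] + [l]) [a]) (E_{ij} e_a) ⊗ (E_{kl} e_b)`. With ordinary matrix multiplication this
yields `(a ⊗ b) (c ⊗ d) = (-1)^([b][c]) ac ⊗ bd` for matrices of scalars. -/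
def gkron {M N : ℕ} (θ₀ : ℤˣ) {B : Type*} [Ring B] [Algebra ℂ B]
    (X Y : Matrix (Idx M N) (Idx M N) B) :
    Matrix (Idx M N × Idx M N) (Idx M N × Idx M N) B :=
  Matrix.of fun p q =>
    sgn ((par θ₀ p.2 + par θ₀ q.2) * par θ₀ q.1) • (X p.1 q.1 * Y p.2 q.2)

/-- The super-permutation `P = ∑_{i,j} (-1)^[j] E_{ij} ⊗ E_{ji}`. -/
def P (M N : ℕ) (θ₀ : ℤˣ) : Matrix (Idx M N × Idx M N) (Idx M N × Idx M N) ℂ :=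
  ∑ i : Idx M N, ∑ j : Idx M N,
    sgn (par θ₀ j) • gkron θ₀ (Matrix.single i j (1 : ℂ)) (Matrix.single j i (1 : ℂ))

/-- The partial transpose of `P`,
`K = ∑_{i,j} (-1)^([i][j]) θ_i θ_j E_{bar j, bar i} ⊗ E_{ji}`. -/
def K (M N : ℕ) (θ₀ : ℤˣ) : Matrix (Idx M N × Idx M N) (Idx M N × Idx M N) ℂ :=
  ∑ i : Idx M N, ∑ j : Idx M N,
    (sgn (par θ₀ i * par θ₀ j) * theta i * theta j) •
      gkron θ₀ (Matrix.single (bar j) (bar i) (1 : ℂ)) (Matrix.single j i (1 : ℂ))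

/-- The matrix `R(u - v) = 1 + P / (u - v) - K / (u - v + κ)` multiplied by the central factor
`(u - v) (u - v + κ) u⁻² v⁻²` and written in terms of `z = u⁻¹` and `w = v⁻¹`, so that
`u - v = (w - z) / (z w)`. -/
def Rpoly (M N : ℕ) (θ₀ : ℤˣ) {B : Type*} [Ring B] [Algebra ℂ B] (z w : B) :
    Matrix (Idx M N × Idx M N) (Idx M N × Idx M N) B :=
  ((w - z) * (w - z + kappa M N θ₀ • (z * w))) • 1
    + (z * w * (w - z + kappa M N θ₀ • (z * w))) • (P M N θ₀).map (algebraMap ℂ B)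
    - (z * w * (w - z)) • (K M N θ₀).map (algebraMap ℂ B)

/-! ### The algebra `U(R)` -/

/-- The free algebra on the symbols `T_{(n)}^{ij}`, `n ≥ 0`. -/
abbrev Free (M N : ℕ) : Type := FreeAlgebra ℂ (Idx M N × Idx M N × ℕ)

/-- The matrix of series `T(u) = ∑ₙ T_{(n)} u⁻ⁿ` over the free algebra; the power series variable
is `u⁻¹`. -/
def freeT (M N : ℕ) : Matrix (Idx M N) (Idx M N) (PowerSeries (Free M N)) :=
  Matrix.of fun i j => PowerSeries.mk fun n => FreeAlgebra.ι ℂ (i, j, n)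

/-- `T₁(u) = T(u) ⊗ 1`, over power series in `u⁻¹` (inner variable) and `v⁻¹` (outer variable). -/
def freeT₁ (M N : ℕ) (θ₀ : ℤˣ) : Matrix (Idx M N × Idx M N) (Idx M N × Idx M N)
    (PowerSeries (PowerSeries (Free M N))) :=
  gkron θ₀ ((freeT M N).map PowerSeries.C) 1

/-- `T₂(v) = 1 ⊗ T(v)`, over power series in `u⁻¹` (inner variable) and `v⁻¹` (outer variable). -/
def freeT₂ (M N : ℕ) (θ₀ : ℤˣ) : Matrix (Idx M N × Idx M N) (Idx M N × Idx M N)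
    (PowerSeries (PowerSeries (Free M N))) :=
  gkron θ₀ 1 ((freeT M N).map (PowerSeries.map PowerSeries.C))

/-- `R(u - v)` (with denominators cleared) over the same power series ring. -/
def freeR (M N : ℕ) (θ₀ : ℤˣ) : Matrix (Idx M N × Idx M N) (Idx M N × Idx M N)
    (PowerSeries (PowerSeries (Free M N))) :=
  Rpoly M N θ₀ (PowerSeries.C PowerSeries.X) PowerSeries.X

/-- The defining relations of `U(R)`: `T_{(0)}^{ij} = δ_{ij}`, and
`R(u - v) T₁(u) T₂(v) = T₂(v) T₁(u) R(u - v)`, coefficient by coefficient. -/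
inductive Rel (M N : ℕ) (θ₀ : ℤˣ) : Free M N → Free M N → Prop
  | zero (i j : Idx M N) :
      Rel M N θ₀ (FreeAlgebra.ι ℂ (i, j, 0)) (if i = j then 1 else 0)
  | rtt (p q : Idx M N × Idx M N) (r s : ℕ) :
      Rel M N θ₀
        (PowerSeries.coeff r (PowerSeries.coeff s
          ((freeR M N θ₀ * freeT₁ M N θ₀ * freeT₂ M N θ₀) p q)))
        (PowerSeries.coeff r (PowerSeries.coeff s
          ((freeT₂ M N θ₀ * freeT₁ M N θ₀ * freeR M N θ₀) p q)))

/-- The algebra `U(R)`. -/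
abbrev U (M N : ℕ) (θ₀ : ℤˣ) : Type := RingQuot (Rel M N θ₀)

/-- The generator `T_{(n)}^{ij}` of `U(R)`. -/
def gen {M N : ℕ} (θ₀ : ℤˣ) (i j : Idx M N) (n : ℕ) : U M N θ₀ :=
  RingQuot.mkAlgHom ℂ (Rel M N θ₀) (FreeAlgebra.ι ℂ (i, j, n))

/-- The matrix `T(u)` over `U(R)⟦u⁻¹⟧`. -/
def T (M N : ℕ) (θ₀ : ℤˣ) : Matrix (Idx M N) (Idx M N) (PowerSeries (U M N θ₀)) :=
  Matrix.of fun i j => PowerSeries.mk (gen θ₀ i j)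

/-- The substitution `f(u) ↦ f(u - a)` on series in `x = u⁻¹`: as `(u - a)⁻¹ = x (1 - a x)⁻¹`, the
series `∑ₘ fₘ u⁻ᵐ` becomes `∑ₘ fₘ (x (1 - a x)⁻¹)ᵐ`. -/
def shift {A : Type*} [Ring A] [Algebra ℂ A] (a : ℂ) (f : PowerSeries A) : PowerSeries A :=
  PowerSeries.mk fun n => ∑ m ∈ Finset.range (n + 1),
    PowerSeries.coeff n
      ((PowerSeries.X * (1 - PowerSeries.C a * PowerSeries.X)⁻¹ : PowerSeries ℂ) ^ m) •
        PowerSeries.coeff m f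

/-- `C(u) = T^t(u - κ) T(u)`. -/
def C (M N : ℕ) (θ₀ : ℤˣ) : Matrix (Idx M N) (Idx M N) (PowerSeries (U M N θ₀)) :=
  (transp θ₀ (T M N θ₀)).map (shift (kappa M N θ₀)) * T M N θ₀

/-- The two-sided ideal generated by (the coefficients of the entries of) `C(u) - 1`. -/
def idealC (M N : ℕ) (θ₀ : ℤˣ) : Ideal (U M N θ₀) :=
  (TwoSidedIdeal.span
    {x | ∃ (i j : Idx M N) (n : ℕ), x = PowerSeries.coeff n ((C M N θ₀ - 1) i j)}).asIdeal

instance (M N : ℕ) (θ₀ : ℤˣ) : (idealC M N θ₀).IsTwoSided := by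
  unfold idealC; infer_instance

/-! ### The Hopf structure of `U(R)` -/

/-- Applying a linear map to the coefficients of a series. -/
def mapCoeff {A B : Type*} [Ring A] [Algebra ℂ A] [Ring B] [Algebra ℂ B] (f : A →ₗ[ℂ] B)
    (s : PowerSeries A) : PowerSeries B :=
  PowerSeries.mk fun n => f (PowerSeries.coeff n s)

/-- `H` is the standard Hopf superalgebra structure of `U(R)`: the generators `T_{(n)}^{ij}` have
degree `[i] + [j]`, `Δ(T^{ij}(u)) = ∑ₖ T^{ik}(u) ⊗ T^{kj}(u)`, `ε(T(u)) = 1` and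
`S(T(u)) = T(u)⁻¹`. As `U(R)` is generated by the `T_{(n)}^{ij}`, this determines `H`. -/
structure IsStandard {M N : ℕ} {θ₀ : ℤˣ} (H : HopfSuperalgebra ℂ (U M N θ₀)) : Prop where
  gen_mem : ∀ (i j : Idx M N) (n : ℕ), gen θ₀ i j n ∈ H.grading (par θ₀ i + par θ₀ j)
  comul_gen : ∀ (i j : Idx M N) (n : ℕ),
    H.comul (gen θ₀ i j n) =
      ∑ k : Idx M N, ∑ m ∈ Finset.HasAntidiagonal.antidiagonal n, gen θ₀ i k m.1 ⊗ₜ[ℂ] gen θ₀ k j m.2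
  counit_T : (T M N θ₀).map (mapCoeff H.counit) = 1
  antipode_T_mul : (T M N θ₀).map (mapCoeff H.antipode) * T M N θ₀ = 1
  mul_antipode_T : T M N θ₀ * (T M N θ₀).map (mapCoeff H.antipode) = 1

end RTT

end

set_option linter.unusedSectionVars false

noncomputable section

namespace RTT

/-! ### Signs -/

/-! The argument rests on four facts about P and K on V ⊗ V: P² = 1, PK = KP = θ₀K, K² = (2κ +
2θ₀)K, and K has rank one with K X₁ = K X₂ᵗ and X₁ K = X₂ᵗ K for every matrix X. Transposing the
second tensor factor exchanges P and K. Hence R has two symmetries. Unitarity: R(v - u) R(u - v) is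
a scalar, and a regular one once denominators are cleared (`Rpoly_mul_Rpoly_swap`,
`eq_zero_of_unitarity_mul`). Crossing: the partial transpose of R(v - κ - u) is R(u - v)
(`ptransp_Rpoly`).

The scalar c. For κ ≠ 0 only the K term of R survives at u = v - κ after clearing denominators, so
RTT becomes K T₁(v - κ) T₂(v) = T₂(v) T₁(v - κ) K. For κ = 0 the surviving term is P - K, and its P
part holds trivially (`IsRTT.contraction`). Moving T₁ across K as a transpose in the second factor
gives K (TᵗT)₂ = (TTᵗ)₂ K, with Tᵗ taken at v - κ. Rank one forces TᵗT and TTᵗ to be the same scalar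
matrix c(v) (`scalar_of_contrMat_mul_leg₂`).

Centrality. Partial transposition of the RTT relation between T(v - κ) and T(u), combined with
crossing, gives T₁(u) R(u - v) T₂ᵗ(v - κ) = T₂ᵗ(v - κ) R(u - v) T₁(u). Left multiplication by T₂(v)
and RTT turn this into R(u - v) (T₁(u) c(v) - c(v) T₁(u)) = 0, and unitarity cancels R
(`IsRTT.commute_scalar`).

The Hopf structure. Since c has constant term 1, T(u) is invertible with inverse Tᵗ(u - κ) c(u)⁻¹.
By the universal property `lift`, every solution of RTT with constant term 1 defines a homomorphism
out of U(R). Conjugation by diag((-1)^[i]) gives the parity, the product of T ⊗ 1 and 1 ⊗ T gives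
the coproduct, and the identity matrix gives the counit. The antipode is only a graded
antihomomorphism. It is obtained from a genuine homomorphism U(R) → End U(R), the action by right
multiplication with S(x) up to a power of the parity, evaluated at 1. The axioms are then checked by
induction on words (`gen_induction`).

The quotient. The graded transposition reverses supercommuting products, so the contraction of XY is
YᵗXᵗXY. For X = T ⊗ 1 and Y = 1 ⊗ T the inner pair is c ⊗ 1, which is even and commutes with Y, so c
is grouplike (`comulU_coeff`). Consequently the parity, Δ, ε and S all respect the ideal generated
by c - 1, and the structure descends along the projection (`Parity.HopfData.exists_quotient`). -/

lemma sgn_add (x y : ZMod 2) : sgn (x + y) = sgn x * sgn y := by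
  have h : ∀ z : ZMod 2, z = 0 ∨ z = 1 := by decide
  rcases h x with rfl | rfl <;> rcases h y with rfl | rfl <;>
    simp [sgn, CharTwo.add_self_eq_zero]

@[simp] lemma sgn_zero : sgn 0 = 1 := by simp [sgn]

lemma sgn_mul_self (x : ZMod 2) : sgn x * sgn x = 1 := by
  rw [← sgn_add, CharTwo.add_self_eq_zero, sgn_zero]

lemma sgn_smul_sgn_smul {B : Type*} [AddCommGroup B] [Module ℂ B] (x y : ZMod 2) (b : B) :
    sgn x • sgn y • b = sgn (x + y) • b := by
  rw [smul_smul, sgn_add]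

/-! ### Conjugation of indices and its effect on parities and signs. -/

section Index

variable {M N : ℕ}

@[simp] lemma bar_bar (i : Idx M N) : bar (bar i) = i := by
  cases i <;> simp [bar]

lemma bar_injective : Function.Injective (bar : Idx M N → Idx M N) :=
  (show Function.Involutive bar from bar_bar).injective

lemma eq_bar_comm {i j : Idx M N} : i = bar j ↔ j = bar i :=
  ⟨fun h => by simp [h], fun h => by simp [h]⟩

/-- The conjugation of indices as a permutation. -/
def barEquiv (M N : ℕ) : Idx M N ≃ Idx M N := (show Function.Involutive bar from bar_bar).toPerm

@[simp] lemma barEquiv_apply (i : Idx M N) : barEquiv M N i = bar i := rfl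

@[simp] lemma par_bar (θ₀ : ℤˣ) (i : Idx M N) : par θ₀ (bar i) = par θ₀ i := by
  cases i <;> simp [bar, par]

lemma theta_mul_self (i : Idx M N) : theta i * theta i = 1 := by
  cases i
  · simp [theta]
  · simp only [theta]; split_ifs <;> simp

/-- The factor θ₀ (-1)^[i] is +1 on the first block and -1 on the second, whatever θ₀ is. Because N
is even, reversal of the second block exchanges its two halves, so θ changes sign exactly there.
Evenness of N enters the theory through this identity. -/
lemma theta_bar (hN : Even N) (θ₀ : ℤˣ) (i : Idx M N) :
    theta (bar i) = ((θ₀ : ℤ) : ℂ) * sgn (par θ₀ i) * theta i := by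
  rcases i with a | a
  · rcases Int.units_eq_one_or θ₀ with rfl | rfl <;> simp [theta, bar, par, sgn]
  · have ha := a.isLt
    obtain ⟨k, hk⟩ := hN
    have h : (a.rev.val < N / 2) ↔ ¬ (a.val < N / 2) := by
      rw [Fin.val_rev]; omega
    rcases Int.units_eq_one_or θ₀ with rfl | rfl <;>
    · simp only [theta, bar, par, sgn, h]
      by_cases h2 : a.val < N / 2 <;> simp [h2]

lemma unit_mul_self (θ₀ : ℤˣ) : ((θ₀ : ℤ) : ℂ) * ((θ₀ : ℤ) : ℂ) = 1 := by
  rcases Int.units_eq_one_or θ₀ with rfl | rfl <;> simp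

/-- The superdimension of V; it is the number by which K² differs from K. -/
lemma sum_sgn (θ₀ : ℤˣ) :
    ∑ i : Idx M N, sgn (par θ₀ i) = ((θ₀ : ℤ) : ℂ) * ((M : ℂ) - N) := by
  rcases Int.units_eq_one_or θ₀ with rfl | rfl <;> simp [par, sgn] <;> ring

end Index

/-! ### Matrices acting on the two tensor factors -/

section Legs

variable {M N : ℕ} (θ₀ : ℤˣ) {B : Type*} [Ring B] [Algebra ℂ B]

/-- `X ⊗ 1`. -/
def leg₁ (X : Matrix (Idx M N) (Idx M N) B) :
    Matrix (Idx M N × Idx M N) (Idx M N × Idx M N) B := gkron θ₀ X 1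

/-- `1 ⊗ X`. -/
def leg₂ (X : Matrix (Idx M N) (Idx M N) B) :
    Matrix (Idx M N × Idx M N) (Idx M N × Idx M N) B := gkron θ₀ 1 X

/-- `P` over a `ℂ`-algebra. -/
def permMat (M N : ℕ) (B : Type*) [Ring B] [Algebra ℂ B] :
    Matrix (Idx M N × Idx M N) (Idx M N × Idx M N) B := (P M N θ₀).map (algebraMap ℂ B)

/-- `K` over a `ℂ`-algebra. -/
def contrMat (M N : ℕ) (B : Type*) [Ring B] [Algebra ℂ B] :
    Matrix (Idx M N × Idx M N) (Idx M N × Idx M N) B := (K M N θ₀).map (algebraMap ℂ B)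

variable {θ₀}

lemma leg₁_apply (X : Matrix (Idx M N) (Idx M N) B) (a b c d : Idx M N) :
    leg₁ θ₀ X (a, b) (c, d) = if b = d then X a c else 0 := by
  by_cases h : b = d
  · subst h; simp [leg₁, gkron, CharTwo.add_self_eq_zero]
  · simp [leg₁, gkron, Matrix.one_apply_ne h, h]

lemma leg₂_apply (X : Matrix (Idx M N) (Idx M N) B) (a b c d : Idx M N) :
    leg₂ θ₀ X (a, b) (c, d) =
      if a = c then sgn ((par θ₀ b + par θ₀ d) * par θ₀ a) • X b d else 0 := by
  by_cases h : a = c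
  · subst h; simp [leg₂, gkron]
  · simp [leg₂, gkron, Matrix.one_apply_ne h, h]

lemma leg₁_mul_apply (X : Matrix (Idx M N) (Idx M N) B)
    (Z : Matrix (Idx M N × Idx M N) (Idx M N × Idx M N) B) (a b : Idx M N)
    (q : Idx M N × Idx M N) :
    (leg₁ θ₀ X * Z) (a, b) q = ∑ e, X a e * Z (e, b) q := by
  simp [Matrix.mul_apply, Fintype.sum_prod_type, leg₁_apply]

lemma mul_leg₁_apply (X : Matrix (Idx M N) (Idx M N) B)
    (Z : Matrix (Idx M N × Idx M N) (Idx M N × Idx M N) B) (p : Idx M N × Idx M N)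
    (c d : Idx M N) :
    (Z * leg₁ θ₀ X) p (c, d) = ∑ e, Z p (e, d) * X e c := by
  simp [Matrix.mul_apply, Fintype.sum_prod_type, leg₁_apply]

lemma leg₂_mul_apply (X : Matrix (Idx M N) (Idx M N) B)
    (Z : Matrix (Idx M N × Idx M N) (Idx M N × Idx M N) B) (a b : Idx M N)
    (q : Idx M N × Idx M N) :
    (leg₂ θ₀ X * Z) (a, b) q =
      ∑ f, sgn ((par θ₀ b + par θ₀ f) * par θ₀ a) • (X b f * Z (a, f) q) := by
  simp [Matrix.mul_apply, Fintype.sum_prod_type_right, leg₂_apply]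

lemma mul_leg₂_apply (X : Matrix (Idx M N) (Idx M N) B)
    (Z : Matrix (Idx M N × Idx M N) (Idx M N × Idx M N) B) (p : Idx M N × Idx M N)
    (c d : Idx M N) :
    (Z * leg₂ θ₀ X) p (c, d) =
      ∑ f, sgn ((par θ₀ f + par θ₀ d) * par θ₀ c) • (Z p (c, f) * X f d) := by
  simp [Matrix.mul_apply, Fintype.sum_prod_type_right, leg₂_apply]

@[simp] lemma leg₁_one : leg₁ θ₀ (1 : Matrix (Idx M N) (Idx M N) B) = 1 := by
  ext ⟨a, b⟩ ⟨c, d⟩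
  rw [leg₁_apply, Matrix.one_apply, Matrix.one_apply]
  by_cases h : b = d <;> simp [h]

@[simp] lemma leg₂_one : leg₂ θ₀ (1 : Matrix (Idx M N) (Idx M N) B) = 1 := leg₁_one

lemma leg₁_mul (X Y : Matrix (Idx M N) (Idx M N) B) :
    leg₁ θ₀ (X * Y) = leg₁ θ₀ X * leg₁ θ₀ Y := by
  ext ⟨a, b⟩ ⟨c, d⟩
  rw [leg₁_mul_apply, leg₁_apply, Matrix.mul_apply]
  by_cases h : b = d <;> simp [leg₁_apply, h]

lemma leg₂_mul (X Y : Matrix (Idx M N) (Idx M N) B) :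
    leg₂ θ₀ (X * Y) = leg₂ θ₀ X * leg₂ θ₀ Y := by
  ext ⟨a, b⟩ ⟨c, d⟩
  rw [leg₂_mul_apply, leg₂_apply, Matrix.mul_apply]
  by_cases h : a = c
  · simp only [leg₂_apply, h, if_true, mul_smul_comm, sgn_smul_sgn_smul, Finset.smul_sum]
    refine Finset.sum_congr rfl fun f _ => ?_
    congr 2
    -- After `sgn_add` a Koszul sign identity is a polynomial identity over `ZMod 2` in the
    -- parities, and finitely many cases decide it. The same device is used for all later sign
    -- checks.
    generalize par θ₀ b = b, par θ₀ c = c, par θ₀ d = d, par θ₀ f = f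
    revert b c d f; decide
  · simp [leg₂_apply, h]

lemma permMat_apply (a b c d : Idx M N) :
    permMat θ₀ M N B (a, b) (c, d) =
      if a = d ∧ b = c then algebraMap ℂ B (sgn (par θ₀ a * par θ₀ b)) else 0 := by
  have : P M N θ₀ (a, b) (c, d) = if a = d ∧ b = c then sgn (par θ₀ a * par θ₀ b) else 0 := by
    simp only [P, Matrix.sum_apply, Matrix.smul_apply, gkron, Matrix.of_apply, Matrix.single_apply]
    rw [Finset.sum_eq_single a, Finset.sum_eq_single b]
    · by_cases h1 : a = d <;> by_cases h2 : b = c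
      · subst h1 h2
        simp only [and_self, if_true, mul_one, smul_eq_mul, ← sgn_add]
        congr 1
        generalize par θ₀ b = b, par θ₀ a = a
        revert a b; decide
      all_goals simp [h1, h2]
    · intro j _ hj; simp [hj]
    · simp
    · intro j _ hj; simp [hj]
    · simp
  rw [permMat, Matrix.map_apply, this]
  split_ifs <;> simp

lemma contrMat_apply (a b c d : Idx M N) :
    contrMat θ₀ M N B (a, b) (c, d) =
      if a = bar b ∧ c = bar d then
        algebraMap ℂ B (theta b * theta d * sgn (par θ₀ d)) else 0 := by
  have : K M N θ₀ (a, b) (c, d) =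
      if a = bar b ∧ c = bar d then theta b * theta d * sgn (par θ₀ d) else 0 := by
    simp only [K, Matrix.sum_apply, Matrix.smul_apply, gkron, Matrix.of_apply, Matrix.single_apply]
    rw [Finset.sum_eq_single d, Finset.sum_eq_single b]
    · by_cases h1 : a = bar b <;> by_cases h2 : c = bar d
      · subst h1 h2
        simp only [and_self, if_true, mul_one, smul_eq_mul, par_bar, sgn_add, add_mul]
        rw [mul_comm (par θ₀ d) (par θ₀ b)]
        have := sgn_mul_self (par θ₀ b * par θ₀ d)
        have h3 : par θ₀ d * par θ₀ d = par θ₀ d := by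
          generalize par θ₀ d = d; revert d; decide
        rw [h3]
        linear_combination theta b * theta d * sgn (par θ₀ d) * this
      all_goals simp [h1, h2, eq_comm]
    · intro j _ hj; simp [hj]
    · simp
    · intro j _ hj; simp [hj]
    · simp
  rw [contrMat, Matrix.map_apply, this]
  split_ifs <;> simp

variable (Z : Matrix (Idx M N × Idx M N) (Idx M N × Idx M N) B)

lemma permMat_mul_apply (a b : Idx M N) (q : Idx M N × Idx M N) :
    (permMat θ₀ M N B * Z) (a, b) q = sgn (par θ₀ a * par θ₀ b) • Z (b, a) q := by
  rw [Matrix.mul_apply, Finset.sum_eq_single (b, a)]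
  · simp [permMat_apply, Algebra.smul_def]
  · rintro ⟨c, d⟩ - h
    rw [permMat_apply, if_neg, zero_mul]
    rintro ⟨rfl, rfl⟩; exact h rfl
  · simp

lemma mul_permMat_apply (p : Idx M N × Idx M N) (c d : Idx M N) :
    (Z * permMat θ₀ M N B) p (c, d) = sgn (par θ₀ c * par θ₀ d) • Z p (d, c) := by
  rw [Matrix.mul_apply, Finset.sum_eq_single (d, c)]
  · rw [permMat_apply, if_pos ⟨rfl, rfl⟩, ← Algebra.commutes, ← Algebra.smul_def, mul_comm]
  · rintro ⟨a, b⟩ - h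
    rw [permMat_apply, if_neg, mul_zero]
    rintro ⟨rfl, rfl⟩; exact h rfl
  · simp

lemma contrMat_mul_apply (a b : Idx M N) (q : Idx M N × Idx M N) :
    (contrMat θ₀ M N B * Z) (a, b) q =
      if a = bar b then ∑ f, (theta b * theta f * sgn (par θ₀ f)) • Z (bar f, f) q else 0 := by
  by_cases h : a = bar b
  · simp only [Matrix.mul_apply, Fintype.sum_prod_type_right, contrMat_apply, h, true_and, if_true,
      ite_mul, zero_mul, Finset.sum_ite_eq', Finset.mem_univ, Algebra.smul_def]
  · rw [if_neg h, Matrix.mul_apply]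
    exact Finset.sum_eq_zero fun j _ => by
      rw [← j.eta, contrMat_apply, if_neg (fun h2 => h h2.1), zero_mul]

lemma mul_contrMat_apply (p : Idx M N × Idx M N) (c d : Idx M N) :
    (Z * contrMat θ₀ M N B) p (c, d) =
      if c = bar d then ∑ f, (theta f * theta d * sgn (par θ₀ d)) • Z p (bar f, f) else 0 := by
  by_cases h : c = bar d
  · simp only [Matrix.mul_apply, Fintype.sum_prod_type_right, contrMat_apply, h, and_true, if_true,
      mul_ite, mul_zero, Finset.sum_ite_eq', Finset.mem_univ, Algebra.smul_def, Algebra.commutes]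
  · rw [if_neg h, Matrix.mul_apply]
    exact Finset.sum_eq_zero fun j _ => by
      rw [← j.eta, contrMat_apply, if_neg (fun h2 => h h2.2), mul_zero]

lemma permMat_mul_permMat : permMat θ₀ M N B * permMat θ₀ M N B = 1 := by
  ext ⟨a, b⟩ ⟨c, d⟩
  rw [permMat_mul_apply, permMat_apply, Matrix.one_apply]
  by_cases h : a = c ∧ b = d
  · obtain ⟨rfl, rfl⟩ := h
    simp [Algebra.smul_def, ← map_mul, mul_comm (par θ₀ b), sgn_mul_self]
  · rw [if_neg (fun h2 => h ⟨h2.2, h2.1⟩), if_neg (fun h2 => h (by simpa using h2)), smul_zero]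

/-- P is the super-permutation, so conjugation by it exchanges the two tensor factors; the sign
inside P matches the Koszul sign of `leg₂`. -/
lemma permMat_mul_leg₁ (X : Matrix (Idx M N) (Idx M N) B) :
    permMat θ₀ M N B * leg₁ θ₀ X = leg₂ θ₀ X * permMat θ₀ M N B := by
  ext ⟨a, b⟩ ⟨c, d⟩
  rw [permMat_mul_apply, mul_permMat_apply, leg₁_apply, leg₂_apply]
  by_cases h : a = d
  · subst h
    simp only [if_true, sgn_smul_sgn_smul]
    congr 2
    generalize par θ₀ b = b, par θ₀ c = c, par θ₀ a = a
    revert a b c; decide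
  · simp [h]

lemma permMat_mul_leg₂ (X : Matrix (Idx M N) (Idx M N) B) :
    permMat θ₀ M N B * leg₂ θ₀ X = leg₁ θ₀ X * permMat θ₀ M N B := by
  have h := permMat_mul_leg₁ (θ₀ := θ₀) X
  calc _ = permMat θ₀ M N B * leg₂ θ₀ X * (permMat θ₀ M N B * permMat θ₀ M N B) := by
        rw [permMat_mul_permMat, mul_one]
    _ = permMat θ₀ M N B * (leg₂ θ₀ X * permMat θ₀ M N B) * permMat θ₀ M N B := by
        simp only [mul_assoc]
    _ = _ := by rw [← h, ← mul_assoc, permMat_mul_permMat, one_mul]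

/-- K factors through a covector on V ⊗ V, that is, a bilinear form on V, and the transposition is
the adjoint for this form. The θ's produced by `theta_bar` cancel in pairs. -/
lemma contrMat_mul_leg₁ (hN : Even N) (X : Matrix (Idx M N) (Idx M N) B) :
    contrMat θ₀ M N B * leg₁ θ₀ X = contrMat θ₀ M N B * leg₂ θ₀ (transp θ₀ X) := by
  ext ⟨a, b⟩ ⟨c, d⟩
  rw [contrMat_mul_apply, contrMat_mul_apply]
  by_cases h : a = bar b
  · rw [if_pos h, if_pos h, Finset.sum_eq_single d, Finset.sum_eq_single (bar c)]
    · rw [leg₁_apply, if_pos rfl, leg₂_apply, bar_bar, if_pos rfl]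
      simp only [transp, Matrix.of_apply, smul_smul, bar_bar, par_bar]
      congr 1
      rw [theta_bar hN θ₀ c, theta_bar hN θ₀ d]
      have h1 := theta_mul_self c
      have h2 := unit_mul_self θ₀
      generalize theta c = x at *
      generalize theta d = y at *
      generalize theta b = t at *
      generalize ((θ₀ : ℤ) : ℂ) = s at *
      -- The extra sign factors multiply to 1; they are inserted in the grouping in which they occur
      -- in the goal.
      have h3 : sgn (par θ₀ d) = sgn (par θ₀ c) * sgn (par θ₀ c) * sgn ((par θ₀ c + par θ₀ d) * par θ₀ c) *
          sgn (par θ₀ d * par θ₀ c + par θ₀ c) * sgn (par θ₀ d) := by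
        simp only [← sgn_add]; congr 1
        generalize par θ₀ c = c, par θ₀ d = d
        revert c d; decide
      generalize sgn ((par θ₀ c + par θ₀ d) * par θ₀ c) = r1 at *
      generalize sgn (par θ₀ d * par θ₀ c + par θ₀ c) = r2 at *
      generalize sgn (par θ₀ c) = r3 at *
      generalize sgn (par θ₀ d) = r4 at *
      calc t * y * r4 = t * y * (s * s) * (x * x) * r4 := by rw [h1, h2]; ring
        _ = t * y * (s * s) * (x * x) * (r3 * r3 * r1 * r2 * r4) := by rw [← h3]
        _ = _ := by ring
    · intro f _ hf
      rw [leg₂_apply, if_neg (fun h => hf (by simp [← h])), smul_zero]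
    · simp
    · intro f _ hf; rw [leg₁_apply, if_neg hf, smul_zero]
    · simp
  · rw [if_neg h, if_neg h]

lemma leg₁_mul_contrMat (hN : Even N) (X : Matrix (Idx M N) (Idx M N) B) :
    leg₁ θ₀ X * contrMat θ₀ M N B = leg₂ θ₀ (transp θ₀ X) * contrMat θ₀ M N B := by
  ext ⟨a, b⟩ ⟨c, d⟩
  rw [mul_contrMat_apply, mul_contrMat_apply]
  by_cases h : c = bar d
  · rw [if_pos h, if_pos h, Finset.sum_eq_single b, Finset.sum_eq_single (bar a)]
    · rw [leg₁_apply, if_pos rfl, leg₂_apply, bar_bar, if_pos rfl]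
      simp only [transp, Matrix.of_apply, smul_smul, bar_bar, par_bar]
      congr 1
      rw [theta_bar hN θ₀ a, theta_bar hN θ₀ b]
      have h1 := theta_mul_self a
      have h2 := unit_mul_self θ₀
      have h3 : sgn (par θ₀ d) = sgn (par θ₀ a) * sgn (par θ₀ b) *
          sgn ((par θ₀ b + par θ₀ a) * par θ₀ a) *
          sgn (par θ₀ a * par θ₀ b + par θ₀ b) * sgn (par θ₀ d) := by
        simp only [← sgn_add]; congr 1
        generalize par θ₀ a = a, par θ₀ b = b, par θ₀ d = d
        revert a b d; decide
      generalize sgn ((par θ₀ b + par θ₀ a) * par θ₀ a) = r1 at *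
      generalize sgn (par θ₀ a * par θ₀ b + par θ₀ b) = r2 at *
      generalize sgn (par θ₀ a) = r3 at *
      generalize sgn (par θ₀ b) = r5 at *
      generalize sgn (par θ₀ d) = r4 at *
      generalize theta a = x at *
      generalize theta d = y at *
      generalize theta b = t at *
      generalize ((θ₀ : ℤ) : ℂ) = s at *
      calc t * y * r4 = t * y * (s * s) * (x * x) * r4 := by rw [h1, h2]; ring
        _ = t * y * (s * s) * (x * x) * (r3 * r5 * r1 * r2 * r4) := by rw [← h3]
        _ = _ := by ring
    · intro f _ hf
      rw [leg₂_apply, if_neg (fun h => hf (by simp [h])), smul_zero]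
    · simp
    · intro f _ hf; rw [leg₁_apply, if_neg (Ne.symm hf), smul_zero]
    · simp
  · rw [if_neg h, if_neg h]

/-- The image of K is spanned by ∑ θ_b e_{bar b} ⊗ e_b, an eigenvector of P for θ₀ by `theta_bar`.
-/
lemma permMat_mul_contrMat (hN : Even N) :
    permMat θ₀ M N B * contrMat θ₀ M N B = ((θ₀ : ℤ) : ℂ) • contrMat θ₀ M N B := by
  ext ⟨a, b⟩ ⟨c, d⟩
  rw [permMat_mul_apply, Matrix.smul_apply, contrMat_apply, contrMat_apply]
  by_cases h : a = bar b ∧ c = bar d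
  · rw [if_pos ⟨eq_bar_comm.mp h.1, h.2⟩, if_pos h, Algebra.smul_def, Algebra.smul_def, ← map_mul,
      ← map_mul]
    congr 1
    rw [h.1, par_bar, theta_bar hN θ₀ b]
    have h3 : par θ₀ b * par θ₀ b = par θ₀ b := by
      generalize par θ₀ b = d; revert d; decide
    rw [h3]
    linear_combination ((θ₀ : ℤ) : ℂ) * theta b * theta d * sgn (par θ₀ d) * sgn_mul_self (par θ₀ b)
  · rw [if_neg (fun h2 => h ⟨eq_bar_comm.mp h2.1, h2.2⟩), if_neg h, smul_zero, smul_zero]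

lemma contrMat_mul_permMat (hN : Even N) :
    contrMat θ₀ M N B * permMat θ₀ M N B = ((θ₀ : ℤ) : ℂ) • contrMat θ₀ M N B := by
  ext ⟨a, b⟩ ⟨c, d⟩
  rw [mul_permMat_apply, Matrix.smul_apply, contrMat_apply, contrMat_apply]
  by_cases h : a = bar b ∧ c = bar d
  · rw [if_pos ⟨h.1, eq_bar_comm.mp h.2⟩, if_pos h, Algebra.smul_def, Algebra.smul_def, ← map_mul,
      ← map_mul]
    congr 1
    rw [h.2, par_bar, theta_bar hN θ₀ d]
    have h3 : par θ₀ d * par θ₀ d = par θ₀ d := by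
      generalize par θ₀ d = d; revert d; decide
    rw [h3]
    linear_combination ((θ₀ : ℤ) : ℂ) * theta b * theta d * sgn (par θ₀ d) * sgn_mul_self (par θ₀ d)
  · rw [if_neg (fun h2 => h ⟨h2.1, eq_bar_comm.mp h2.2⟩), if_neg h, smul_zero, smul_zero]

/-- Pairing the covector of K with its vector gives ∑ (-1)^[f] = θ₀ (M - N), which is 2κ + 2θ₀. The
value of κ is chosen for this. -/
lemma contrMat_mul_contrMat :
    contrMat θ₀ M N B * contrMat θ₀ M N B =
      (2 * kappa M N θ₀ + 2 * ((θ₀ : ℤ) : ℂ)) • contrMat θ₀ M N B := by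
  ext ⟨a, b⟩ ⟨c, d⟩
  rw [contrMat_mul_apply, Matrix.smul_apply, contrMat_apply]
  by_cases h : a = bar b ∧ c = bar d
  · rw [if_pos h.1, if_pos h]
    simp only [contrMat_apply, h.2, and_self, if_true, Algebra.smul_def, ← map_mul, ← map_sum]
    congr 1
    have : 2 * kappa M N θ₀ + 2 * ((θ₀ : ℤ) : ℂ) = ∑ f : Idx M N, sgn (par θ₀ f) := by
      rw [sum_sgn, kappa]; ring
    rw [this, Finset.sum_mul]
    refine Finset.sum_congr rfl fun f _ => ?_
    linear_combination sgn (par θ₀ f) * sgn (par θ₀ d) * theta b * theta d * theta_mul_self f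
  · rw [if_neg h, smul_zero]
    split_ifs with h1
    · exact Finset.sum_eq_zero fun f _ => by
        rw [contrMat_apply, if_neg (fun h2 => h ⟨h1, h2.2⟩), smul_zero]
    · rfl

end Legs

/-! ### The partial transposition -/

section PartialTranspose

variable {M N : ℕ} (θ₀ : ℤˣ) {B : Type*} [Ring B] [Algebra ℂ B]

/-- The transposition of the second tensor factor. -/
def ptransp (Z : Matrix (Idx M N × Idx M N) (Idx M N × Idx M N) B) :
    Matrix (Idx M N × Idx M N) (Idx M N × Idx M N) B :=
  Matrix.of fun p q =>
    (sgn (par θ₀ q.2 * par θ₀ p.2 + par θ₀ p.2) * theta (bar q.2) * theta (bar p.2)) •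
      Z (p.1, bar q.2) (q.1, bar p.2)

/-- Entries between vectors of different parity vanish. -/
def IsEven (Z : Matrix (Idx M N × Idx M N) (Idx M N × Idx M N) B) : Prop :=
  ∀ a b c d, par θ₀ a + par θ₀ b ≠ par θ₀ c + par θ₀ d → Z (a, b) (c, d) = 0

/-- All entries are central. -/
def IsCentral (Z : Matrix (Idx M N × Idx M N) (Idx M N × Idx M N) B) : Prop :=
  ∀ p q x, Commute (Z p q) x

variable {θ₀}

lemma ptransp_apply (Z : Matrix (Idx M N × Idx M N) (Idx M N × Idx M N) B) (a b c d : Idx M N) :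
    ptransp θ₀ Z (a, b) (c, d) =
      (sgn (par θ₀ d * par θ₀ b + par θ₀ b) * theta (bar d) * theta (bar b)) •
        Z (a, bar d) (c, bar b) := rfl

lemma ptransp_add (Z W : Matrix (Idx M N × Idx M N) (Idx M N × Idx M N) B) :
    ptransp θ₀ (Z + W) = ptransp θ₀ Z + ptransp θ₀ W := by
  ext p q; simp [ptransp]

lemma ptransp_sub (Z W : Matrix (Idx M N × Idx M N) (Idx M N × Idx M N) B) :
    ptransp θ₀ (Z - W) = ptransp θ₀ Z - ptransp θ₀ W := by
  ext p q; simp [ptransp, smul_sub]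

lemma ptransp_smul (r : B) (Z : Matrix (Idx M N × Idx M N) (Idx M N × Idx M N) B) :
    ptransp θ₀ (r • Z) = r • ptransp θ₀ Z := by
  ext p q; simp [ptransp]

lemma ptransp_one : ptransp θ₀ (1 : Matrix (Idx M N × Idx M N) (Idx M N × Idx M N) B) = 1 := by
  ext ⟨a, b⟩ ⟨c, d⟩
  rw [ptransp_apply, Matrix.one_apply, Matrix.one_apply]
  by_cases h : a = c ∧ b = d
  · obtain ⟨rfl, rfl⟩ := h
    rw [if_pos rfl, if_pos rfl, mul_assoc, theta_mul_self]
    have : par θ₀ b * par θ₀ b + par θ₀ b = 0 := by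
      generalize par θ₀ b = b; revert b; decide
    simp [this]
  · rw [if_neg, if_neg, smul_zero]
    · simpa using h
    · simp only [Prod.mk.injEq, bar_injective.eq_iff, not_and]
      exact fun h1 h2 => h ⟨h1, h2.symm⟩

/-- Together with `ptransp_contrMat` this is the source of crossing symmetry: the partial
transposition exchanges the two nontrivial terms of R. -/
lemma ptransp_permMat (hN : Even N) : ptransp θ₀ (permMat θ₀ M N B) = contrMat θ₀ M N B := by
  ext ⟨a, b⟩ ⟨c, d⟩
  rw [ptransp_apply, permMat_apply, contrMat_apply]
  by_cases h : a = bar b ∧ c = bar d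
  · rw [if_pos h, if_pos ⟨h.1, h.2.symm⟩, Algebra.smul_def, ← map_mul, h.1, par_bar, par_bar,
      theta_bar hN θ₀ b, theta_bar hN θ₀ d, sgn_add, mul_comm (par θ₀ b)]
    congr 1
    have h1 := sgn_mul_self (par θ₀ d * par θ₀ b)
    have h2 := sgn_mul_self (par θ₀ b)
    have h3 := unit_mul_self θ₀
    generalize ((θ₀ : ℤ) : ℂ) = s at *
    generalize sgn (par θ₀ d * par θ₀ b) = x at *
    generalize sgn (par θ₀ b) = y at *
    generalize sgn (par θ₀ d) = z at *
    calc _ = (x * x) * (y * y) * (s * s) * (theta b * theta d * z) := by ring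
      _ = _ := by rw [h1, h2, h3]; ring
  · rw [if_neg h, if_neg (fun h2 => h ⟨h2.1, h2.2.symm⟩), smul_zero]

lemma ptransp_contrMat : ptransp θ₀ (contrMat θ₀ M N B) = permMat θ₀ M N B := by
  ext ⟨a, b⟩ ⟨c, d⟩
  rw [ptransp_apply, permMat_apply, contrMat_apply]
  by_cases h : a = d ∧ b = c
  · obtain ⟨rfl, rfl⟩ := h
    rw [if_pos ⟨(bar_bar a).symm, (bar_bar b).symm⟩, if_pos ⟨rfl, rfl⟩, Algebra.smul_def, ← map_mul, par_bar,
      sgn_add]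
    congr 1
    have h1 := theta_mul_self (bar a)
    have h2 := sgn_mul_self (par θ₀ b)
    have h3 := theta_mul_self (bar b)
    generalize theta (bar a) = s at *
    generalize theta (bar b) = x at *
    generalize sgn (par θ₀ b) = y at *
    calc _ = (x * x) * (y * y) * (s * s) * sgn (par θ₀ a * par θ₀ b) := by ring
      _ = _ := by rw [h1, h2, h3]; ring
  · rw [if_neg h, bar_bar, bar_bar, if_neg (fun h2 => h ⟨h2.1, h2.2.symm⟩), smul_zero]

lemma isEven_permMat : IsEven θ₀ (permMat θ₀ M N B) := by
  intro a b c d h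
  rw [permMat_apply, if_neg]
  rintro ⟨rfl, rfl⟩
  exact h (add_comm _ _)

lemma isEven_contrMat : IsEven θ₀ (contrMat θ₀ M N B) := by
  intro a b c d h
  rw [contrMat_apply, if_neg]
  rintro ⟨rfl, rfl⟩
  exact h (by simp [CharTwo.add_self_eq_zero])

lemma isEven_one :
    IsEven θ₀ (1 : Matrix (Idx M N × Idx M N) (Idx M N × Idx M N) B) := by
  intro a b c d h
  rw [Matrix.one_apply, if_neg]
  rintro h2
  simp only [Prod.mk.injEq] at h2
  exact h (by rw [h2.1, h2.2])

lemma IsEven.add {Z W : Matrix (Idx M N × Idx M N) (Idx M N × Idx M N) B} (hZ : IsEven θ₀ Z)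
    (hW : IsEven θ₀ W) : IsEven θ₀ (Z + W) := fun a b c d h => by
  simp [hZ a b c d h, hW a b c d h]

lemma IsEven.sub {Z W : Matrix (Idx M N × Idx M N) (Idx M N × Idx M N) B} (hZ : IsEven θ₀ Z)
    (hW : IsEven θ₀ W) : IsEven θ₀ (Z - W) := fun a b c d h => by
  simp [hZ a b c d h, hW a b c d h]

lemma IsEven.smul {Z : Matrix (Idx M N × Idx M N) (Idx M N × Idx M N) B} (hZ : IsEven θ₀ Z)
    (r : B) : IsEven θ₀ (r • Z) := fun a b c d h => by
  simp [hZ a b c d h]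

/-- Partial transposition reverses products in the second factor only. Entries of X and Y keep their
order, so noncommutativity does no harm, and centrality of Z lets its entries pass those of Y.
Evenness of Z is what makes the Koszul signs agree. -/
lemma ptransp_leg₁_mul_leg₂_mul (X Y : Matrix (Idx M N) (Idx M N) B)
    {Z : Matrix (Idx M N × Idx M N) (Idx M N × Idx M N) B} (hZ : IsEven θ₀ Z)
    (hZc : IsCentral Z) :
    ptransp θ₀ (leg₁ θ₀ X * leg₂ θ₀ Y * Z) =
      leg₁ θ₀ X * ptransp θ₀ Z * leg₂ θ₀ (transp θ₀ Y) := by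
  ext ⟨a, b⟩ ⟨c, d⟩
  rw [ptransp_apply, mul_assoc (leg₁ θ₀ X), mul_assoc (leg₁ θ₀ X), leg₁_mul_apply, leg₁_mul_apply, Finset.smul_sum]
  refine Finset.sum_congr rfl fun e _ => ?_
  rw [leg₂_mul_apply, mul_leg₂_apply, ← (barEquiv M N).sum_comp, Finset.mul_sum, Finset.mul_sum,
    Finset.smul_sum]
  refine Finset.sum_congr rfl fun f _ => ?_
  simp only [ptransp_apply, transp, Matrix.of_apply, barEquiv_apply, par_bar, smul_mul_assoc,
    mul_smul_comm, smul_smul, (hZc _ _ (Y _ _)).eq]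
  by_cases h : par θ₀ e + par θ₀ f = par θ₀ c + par θ₀ b
  · congr 1
    have h0 := theta_mul_self (bar f)
    have h1 : sgn (par θ₀ d * par θ₀ b + par θ₀ b) * sgn ((par θ₀ d + par θ₀ f) * par θ₀ e) =
        sgn ((par θ₀ f + par θ₀ d) * par θ₀ c) * (sgn (par θ₀ f * par θ₀ b + par θ₀ b) *
          sgn (par θ₀ d * par θ₀ f + par θ₀ f)) := by
      simp only [← sgn_add]; congr 1
      -- A nonzero entry of Z preserves the total parity, so [e] is determined by the other three
      -- parities.
      have h2 : par θ₀ e = par θ₀ c + par θ₀ b + par θ₀ f := by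
        rw [← h, add_assoc, CharTwo.add_self_eq_zero, add_zero]
      rw [h2]
      generalize par θ₀ f = f, par θ₀ b = b, par θ₀ c = c, par θ₀ d = d
      revert f b c d; decide
    generalize theta (bar f) = t at *
    linear_combination (theta (bar d) * theta (bar b)) * h1 -
      sgn ((par θ₀ f + par θ₀ d) * par θ₀ c) * (sgn (par θ₀ f * par θ₀ b + par θ₀ b) *
          sgn (par θ₀ d * par θ₀ f + par θ₀ f)) * (theta (bar d) * theta (bar b)) * h0
  · rw [hZ e (bar f) c (bar b) (by simpa using h)]; simp

lemma ptransp_mul_leg₂_mul_leg₁ (X Y : Matrix (Idx M N) (Idx M N) B)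
    {Z : Matrix (Idx M N × Idx M N) (Idx M N × Idx M N) B} (hZ : IsEven θ₀ Z)
    (hZc : IsCentral Z) :
    ptransp θ₀ (Z * (leg₂ θ₀ Y * leg₁ θ₀ X)) =
      leg₂ θ₀ (transp θ₀ Y) * ptransp θ₀ Z * leg₁ θ₀ X := by
  ext ⟨a, b⟩ ⟨c, d⟩
  rw [ptransp_apply, ← mul_assoc, mul_leg₁_apply, mul_leg₁_apply, Finset.smul_sum]
  refine Finset.sum_congr rfl fun e _ => ?_
  rw [leg₂_mul_apply, mul_leg₂_apply, ← (barEquiv M N).sum_comp, Finset.sum_mul, Finset.sum_mul,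
    Finset.smul_sum]
  refine Finset.sum_congr rfl fun f _ => ?_
  simp only [ptransp_apply, transp, Matrix.of_apply, barEquiv_apply, par_bar, smul_mul_assoc,
    mul_smul_comm, smul_smul, (hZc _ _ (Y _ _)).eq]
  by_cases h : par θ₀ a + par θ₀ d = par θ₀ e + par θ₀ f
  · congr 1
    have h0 := theta_mul_self (bar f)
    have h1 : sgn (par θ₀ d * par θ₀ b + par θ₀ b) * sgn ((par θ₀ f + par θ₀ b) * par θ₀ e) =
        sgn ((par θ₀ b + par θ₀ f) * par θ₀ a) * (sgn (par θ₀ f * par θ₀ b + par θ₀ b) *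
          sgn (par θ₀ d * par θ₀ f + par θ₀ f)) := by
      simp only [← sgn_add]; congr 1
      have h2 : par θ₀ e = par θ₀ a + par θ₀ d + par θ₀ f := by
        rw [h, add_assoc, CharTwo.add_self_eq_zero, add_zero]
      rw [h2]
      generalize par θ₀ f = f, par θ₀ b = b, par θ₀ a = a, par θ₀ d = d
      revert f b a d; decide
    generalize theta (bar f) = t at *
    linear_combination (theta (bar d) * theta (bar b)) * h1 -
      sgn ((par θ₀ b + par θ₀ f) * par θ₀ a) * (sgn (par θ₀ f * par θ₀ b + par θ₀ b) *
          sgn (par θ₀ d * par θ₀ f + par θ₀ f)) * (theta (bar d) * theta (bar b)) * h0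
  · rw [hZ a (bar d) e (bar f) (by simpa using h)]; simp

end PartialTranspose

/-! ### The R-matrix -/

section RMatrix

variable {M N : ℕ} {θ₀ : ℤˣ} {B : Type*} [Ring B] [Algebra ℂ B]

lemma Rpoly_eq (z w : B) :
    Rpoly M N θ₀ z w =
      ((w - z) * (w - z + kappa M N θ₀ • (z * w))) • 1
        + (z * w * (w - z + kappa M N θ₀ • (z * w))) • permMat θ₀ M N B
        - (z * w * (w - z)) • contrMat θ₀ M N B := rfl

lemma isEven_Rpoly (z w : B) : IsEven θ₀ (Rpoly M N θ₀ z w) :=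
  ((isEven_one.smul _).add (isEven_permMat.smul _)).sub (isEven_contrMat.smul _)

lemma permMat_map {B' : Type*} [Ring B'] [Algebra ℂ B'] (φ : B →ₐ[ℂ] B') :
    (permMat θ₀ M N B).map φ = permMat θ₀ M N B' := by
  ext; simp [permMat]

lemma contrMat_map {B' : Type*} [Ring B'] [Algebra ℂ B'] (φ : B →ₐ[ℂ] B') :
    (contrMat θ₀ M N B).map φ = contrMat θ₀ M N B' := by
  ext; simp [contrMat]

lemma gkron_map {B' : Type*} [Ring B'] [Algebra ℂ B'] (φ : B →ₐ[ℂ] B')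
    (X Y : Matrix (Idx M N) (Idx M N) B) :
    (gkron θ₀ X Y).map φ = gkron θ₀ (X.map φ) (Y.map φ) := by
  ext; simp [gkron]

lemma leg₁_map {B' : Type*} [Ring B'] [Algebra ℂ B'] (φ : B →ₐ[ℂ] B')
    (X : Matrix (Idx M N) (Idx M N) B) : (leg₁ θ₀ X).map φ = leg₁ θ₀ (X.map φ) := by
  rw [leg₁, leg₁, gkron_map, Matrix.map_one _ (map_zero _) (map_one _)]

lemma leg₂_map {B' : Type*} [Ring B'] [Algebra ℂ B'] (φ : B →ₐ[ℂ] B')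
    (X : Matrix (Idx M N) (Idx M N) B) : (leg₂ θ₀ X).map φ = leg₂ θ₀ (X.map φ) := by
  rw [leg₂, leg₂, gkron_map, Matrix.map_one _ (map_zero _) (map_one _)]

lemma transp_map {B' : Type*} [Ring B'] [Algebra ℂ B'] (φ : B →ₗ[ℂ] B')
    (X : Matrix (Idx M N) (Idx M N) B) : (transp θ₀ X).map φ = transp θ₀ (X.map φ) := by
  ext; simp [transp]

lemma Rpoly_map {B' : Type*} [Ring B'] [Algebra ℂ B'] (φ : B →ₐ[ℂ] B') (z w : B) :
    (Rpoly M N θ₀ z w).map φ = Rpoly M N θ₀ (φ z) (φ w) := by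
  rw [Rpoly_eq, Rpoly_eq, ← permMat_map φ, ← contrMat_map φ]
  ext p q
  simp only [Matrix.map_apply, Matrix.sub_apply, Matrix.add_apply, Matrix.smul_apply, map_sub,
    map_add, map_mul, map_smul, smul_eq_mul, Matrix.one_apply]
  split_ifs <;> simp

lemma isCentral_Rpoly {z w : B} (hz : ∀ x, Commute z x) (hw : ∀ x, Commute w x) :
    IsCentral (Rpoly M N θ₀ z w) := by
  intro p q x
  have hd : Commute (w - z) x := (hw x).sub_left (hz x)
  have hm : Commute (z * w) x := (hz x).mul_left (hw x)
  have hk : Commute (w - z + kappa M N θ₀ • (z * w)) x := hd.add_left (hm.smul_left _)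
  rw [Rpoly_eq]
  simp only [Matrix.sub_apply, Matrix.add_apply, Matrix.smul_apply, smul_eq_mul]
  refine (Commute.add_left ?_ ?_).sub_left ?_
  · refine (hd.mul_left hk).mul_left ?_
    rw [Matrix.one_apply]; split_ifs
    exacts [Commute.one_left x, Commute.zero_left x]
  · exact (hm.mul_left hk).mul_left (Algebra.commute_algebraMap_left _ _)
  · exact (hm.mul_left hd).mul_left (Algebra.commute_algebraMap_left _ _)

lemma smul_mul_of_central {n : Type*} [Fintype n] {r : B} (hr : ∀ x, Commute r x)
    (Z W : Matrix n n B) : Z * r • W = r • (Z * W) := by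
  ext i j
  simp only [Matrix.mul_apply, Matrix.smul_apply, smul_eq_mul, Finset.mul_sum]
  exact Finset.sum_congr rfl fun k _ => by rw [← mul_assoc, ← mul_assoc, (hr _).eq]

lemma permMat_mul_Rpoly (hN : Even N) {z w : B} (hz : ∀ x, Commute z x)
    (hw : ∀ x, Commute w x) :
    permMat θ₀ M N B * Rpoly M N θ₀ z w = Rpoly M N θ₀ z w * permMat θ₀ M N B := by
  have hd : ∀ x, Commute (w - z) x := fun x => (hw x).sub_left (hz x)
  have hm : ∀ x, Commute (z * w) x := fun x => (hz x).mul_left (hw x)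
  have hk : ∀ x, Commute (w - z + kappa M N θ₀ • (z * w)) x := fun x =>
    (hd x).add_left ((hm x).smul_left _)
  rw [Rpoly_eq, mul_sub, mul_add, smul_mul_of_central (fun x => (hd x).mul_left (hk x)),
    smul_mul_of_central (fun x => (hm x).mul_left (hk x)),
    smul_mul_of_central (fun x => (hm x).mul_left (hd x)), Matrix.sub_mul, Matrix.add_mul,
    Matrix.smul_mul, Matrix.smul_mul, Matrix.smul_mul, permMat_mul_contrMat hN, contrMat_mul_permMat hN, mul_one,
    one_mul]

/-- The product of the four linear factors of the unitarity relation. -/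
def unitarity (M N : ℕ) (θ₀ : ℤˣ) (z w : B) : B :=
  (w - z - z * w) * (w - z + z * w) * (w - z - kappa M N θ₀ • (z * w)) *
    (w - z + kappa M N θ₀ • (z * w))

/-- Unitarity. The terms linear in P cancel by antisymmetry in u - v, and P² = 1 gives the first two
factors. The total coefficient of K vanishes precisely because K² = (2κ + 2θ₀) K and PK = KP = θ₀K.
-/
lemma Rpoly_mul_Rpoly_swap {S : Type*} [CommRing S] [Algebra ℂ S] (hN : Even N) (z w : S) :
    Rpoly M N θ₀ w z * Rpoly M N θ₀ z w = unitarity M N θ₀ z w • 1 := by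
  have h1 := permMat_mul_permMat (θ₀ := θ₀) (M := M) (N := N) (B := S)
  have h2 := permMat_mul_contrMat (θ₀ := θ₀) (M := M) (N := N) (B := S) hN
  have h3 := contrMat_mul_permMat (θ₀ := θ₀) (M := M) (N := N) (B := S) hN
  have h4 := contrMat_mul_contrMat (θ₀ := θ₀) (M := M) (N := N) (B := S)
  rw [algebra_compatible_smul S] at h2 h3 h4
  rw [Rpoly_eq, Rpoly_eq, unitarity]
  simp only [Algebra.smul_def (kappa M N θ₀)]
  rw [map_add, map_mul, map_mul, map_ofNat] at h4
  generalize algebraMap ℂ S (kappa M N θ₀) = k at *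
  generalize algebraMap ℂ S ((θ₀ : ℤ) : ℂ) = t at *
  simp only [mul_add, add_mul, mul_sub, sub_mul, Matrix.smul_mul, Matrix.mul_smul, h1, h2, h3, h4,
    one_mul, mul_one]
  module

end RMatrix

/-! ### The RTT relation -/

section Relation

variable {M N : ℕ} (θ₀ : ℤˣ) {B : Type*} [Ring B] [Algebra ℂ B]

/-- The relation `R(u - v) T₁(u) T₂(v) = T₂(v) T₁(u) R(u - v)` for matrices `X = T(u)` and
`Y = T(v)`, where `z = u⁻¹` and `w = v⁻¹`. -/
def RTTRel (z w : B) (X Y : Matrix (Idx M N) (Idx M N) B) : Prop :=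
  Rpoly M N θ₀ z w * leg₁ θ₀ X * leg₂ θ₀ Y = leg₂ θ₀ Y * leg₁ θ₀ X * Rpoly M N θ₀ z w

variable {θ₀}

lemma RTTRel.map {B' : Type*} [Ring B'] [Algebra ℂ B'] {z w : B}
    {X Y : Matrix (Idx M N) (Idx M N) B} (h : RTTRel θ₀ z w X Y) (φ : B →ₐ[ℂ] B') :
    RTTRel θ₀ (φ z) (φ w) (X.map φ) (Y.map φ) := by
  have h2 := congrArg (fun Z => Z.map φ) h
  simp only [Matrix.map_mul, leg₁_map, leg₂_map, Rpoly_map] at h2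
  exact h2

/-- Conjugation of the RTT relation by P, which commutes with R and exchanges the legs. The new
order of the legs is the one needed for the partial transposition. -/
lemma RTTRel.leg_swap (hN : Even N) {z w : B} (hz : ∀ x, Commute z x) (hw : ∀ x, Commute w x)
    {X Y : Matrix (Idx M N) (Idx M N) B} (h : RTTRel θ₀ z w X Y) :
    Rpoly M N θ₀ z w * (leg₂ θ₀ X * leg₁ θ₀ Y) = leg₁ θ₀ Y * leg₂ θ₀ X * Rpoly M N θ₀ z w := by
  have hR := permMat_mul_Rpoly (M := M) (θ₀ := θ₀) hN hz hw
  have h1 := permMat_mul_leg₁ (θ₀ := θ₀) X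
  have h2 := permMat_mul_leg₁ (θ₀ := θ₀) Y
  have h3 := permMat_mul_leg₂ (θ₀ := θ₀) X
  have h4 := permMat_mul_leg₂ (θ₀ := θ₀) Y
  have hP := permMat_mul_permMat (θ₀ := θ₀) (M := M) (N := N) (B := B)
  unfold RTTRel at h
  generalize permMat θ₀ M N B = p at *
  generalize Rpoly M N θ₀ z w = R at *
  calc R * (leg₂ θ₀ X * leg₁ θ₀ Y) = p * (p * R) * (leg₂ θ₀ X * leg₁ θ₀ Y) := by
        rw [← mul_assoc p p, hP, one_mul]
    _ = p * R * (p * leg₂ θ₀ X) * leg₁ θ₀ Y := by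
        rw [show p * R * (p * leg₂ θ₀ X) = p * (R * p) * leg₂ θ₀ X by simp only [mul_assoc], ← hR]
        simp only [mul_assoc]
    _ = p * R * leg₁ θ₀ X * (p * leg₁ θ₀ Y) := by rw [h3]; simp only [mul_assoc]
    _ = p * (R * leg₁ θ₀ X * leg₂ θ₀ Y) * p := by rw [h2]; simp only [mul_assoc]
    _ = p * leg₂ θ₀ Y * leg₁ θ₀ X * R * p := by rw [h]; simp only [mul_assoc]
    _ = leg₁ θ₀ Y * (p * leg₁ θ₀ X) * R * p := by rw [h4]; simp only [mul_assoc]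
    _ = leg₁ θ₀ Y * leg₂ θ₀ X * (p * R) * p := by rw [h1]; simp only [mul_assoc]
    _ = leg₁ θ₀ Y * leg₂ θ₀ X * R * (p * p) := by rw [hR]; simp only [mul_assoc]
    _ = _ := by rw [hP, mul_one]

/-- The relation between `X = T(u)` and the transpose of `Y = T(v - κ)`. -/
lemma RTTRel.ptransp (hN : Even N) {z w : B} (hz : ∀ x, Commute z x) (hw : ∀ x, Commute w x)
    {X Y : Matrix (Idx M N) (Idx M N) B} (h : RTTRel θ₀ w z Y X) :
    leg₁ θ₀ X * RTT.ptransp θ₀ (Rpoly M N θ₀ w z) * leg₂ θ₀ (transp θ₀ Y) =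
      leg₂ θ₀ (transp θ₀ Y) * RTT.ptransp θ₀ (Rpoly M N θ₀ w z) * leg₁ θ₀ X := by
  rw [← ptransp_leg₁_mul_leg₂_mul X Y (isEven_Rpoly w z) (isCentral_Rpoly hw hz),
    ← ptransp_mul_leg₂_mul_leg₁ X Y (isEven_Rpoly w z) (isCentral_Rpoly hw hz),
    h.leg_swap hN hw hz]

/-- Crossing symmetry. With w = v⁻¹ the hypothesis says w' = (v - κ)⁻¹. Transposing exchanges P and
K, and the pole at v - κ - u = 0 becomes the one at u - v + κ = 0. The square of 1 - κw clears the
denominator of w' from a polynomial of degree two in w'. -/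
lemma ptransp_Rpoly {S : Type*} [CommRing S] [Algebra ℂ S] (hN : Even N) {z w w' : S}
    (h : w' * (1 - kappa M N θ₀ • w) = w) :
    ((1 - kappa M N θ₀ • w) ^ 2) • ptransp θ₀ (Rpoly M N θ₀ w' z) = Rpoly M N θ₀ z w := by
  rw [Rpoly_eq, Rpoly_eq, ptransp_sub, ptransp_add, ptransp_smul, ptransp_smul, ptransp_smul,
    ptransp_one, ptransp_permMat hN, ptransp_contrMat]
  simp only [Algebra.smul_def (kappa M N θ₀)] at *
  generalize algebraMap ℂ S (kappa M N θ₀) = k at *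
  have e1 : (1 - k * w) * (z - w' + k * (w' * z)) = z - w := by linear_combination (k * z - 1) * h
  have e2 : (1 - k * w) * (z - w') = - (w - z + k * (z * w)) := by linear_combination -h
  simp only [smul_sub, smul_add, smul_smul]
  have f1 : (1 - k * w) ^ 2 * ((z - w') * (z - w' + k * (w' * z))) =
      (w - z) * (w - z + k * (z * w)) := by
    linear_combination (1 - k * w) * (z - w' + k * (w' * z)) * e2 - (w - z + k * (z * w)) * e1
  have f2 : (1 - k * w) ^ 2 * (w' * z * (z - w' + k * (w' * z))) = - (z * w * (w - z)) := by
    linear_combination (1 - k * w) * z * (z - w' + k * (w' * z)) * h + w * z * e1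
  have f3 : (1 - k * w) ^ 2 * (w' * z * (z - w')) = - (z * w * (w - z + k * (z * w))) := by
    linear_combination (1 - k * w) * z * (z - w') * h + w * z * e2
  rw [f1, f2, f3]
  module

end Relation

/-! ### Power series over noncommutative algebras -/

section Series

variable {A : Type*} [Ring A] [Algebra ℂ A]

/-- The series `(u - a)⁻¹` in terms of `u⁻¹`. -/
def shiftX (a : ℂ) : PowerSeries ℂ := PowerSeries.X * (1 - PowerSeries.C a * PowerSeries.X)⁻¹

lemma shiftX_mul (a : ℂ) : shiftX a * (1 - PowerSeries.C a * PowerSeries.X) = PowerSeries.X := by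
  rw [shiftX, mul_assoc, PowerSeries.inv_mul_cancel, mul_one]
  simp

lemma coeff_shiftX_pow (a : ℂ) {m n : ℕ} (h : n < m) :
    PowerSeries.coeff n (shiftX a ^ m) = 0 := by
  rw [shiftX, mul_pow]
  exact PowerSeries.X_pow_dvd_iff.mp (dvd_mul_right _ _) n h

/-- The m-th power of (u - a)⁻¹ begins in degree m, so the summation bound may be enlarged. A
uniform bound is needed when coefficients of different orders are multiplied. -/
lemma coeff_shift (a : ℂ) (f : PowerSeries A) {n K : ℕ} (h : n ≤ K) :
    PowerSeries.coeff n (shift a f) = ∑ m ∈ Finset.range (K + 1),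
      PowerSeries.coeff n (shiftX a ^ m) • PowerSeries.coeff m f := by
  rw [shift, PowerSeries.coeff_mk]
  refine Finset.sum_subset (Finset.range_mono (by omega)) fun m _ hm => ?_
  have : n < m := by simpa using hm
  exact by rw [← shiftX, coeff_shiftX_pow a this, zero_smul]

/-- A triangle of indices may be completed to a square when the added terms vanish. -/
lemma sum_range_antidiagonal {G : Type*} [AddCommMonoid G] (F : ℕ → ℕ → G) (n : ℕ)
    (hF : ∀ i j, n < i + j → F i j = 0) :
    ∑ m ∈ Finset.range (n + 1), ∑ p ∈ Finset.HasAntidiagonal.antidiagonal m, F p.1 p.2 =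
      ∑ i ∈ Finset.range (n + 1), ∑ j ∈ Finset.range (n + 1), F i j := by
  rw [← Finset.sum_product',
    ← Finset.sum_filter_add_sum_filter_not _ (fun p : ℕ × ℕ => p.1 + p.2 < n + 1),
    Finset.sum_eq_zero (s := Finset.filter (fun p : ℕ × ℕ => ¬ p.1 + p.2 < n + 1) _), add_zero,
    ← Finset.sum_fiberwise_of_maps_to (t := Finset.range (n + 1)) (g := fun p : ℕ × ℕ => p.1 + p.2)]
  · refine Finset.sum_congr rfl fun m hm => Finset.sum_congr ?_ fun _ _ => rfl
    ext ⟨i, j⟩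
    simp only [Finset.HasAntidiagonal.mem_antidiagonal, Finset.mem_filter, Finset.mem_product, Finset.mem_range]
      at hm ⊢
    omega
  · intro p hp
    simpa using (Finset.mem_filter.mp hp).2
  · intro p hp
    exact hF _ _ (by have := (Finset.mem_filter.mp hp).2; omega)

/-- The substituted series has complex coefficients, which are central, so the substitution stays
multiplicative over a noncommutative algebra. The additivity of exponents in `pow_add` carries the
computation. -/
lemma shift_mul (a : ℂ) (f g : PowerSeries A) : shift a (f * g) = shift a f * shift a g := by
  ext n
  rw [PowerSeries.coeff_mul, coeff_shift a _ le_rfl]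
  simp only [PowerSeries.coeff_mul, Finset.smul_sum]
  have h1 : ∀ m, ∑ p ∈ Finset.HasAntidiagonal.antidiagonal m, PowerSeries.coeff n (shiftX a ^ m) •
        (PowerSeries.coeff p.1 f * PowerSeries.coeff p.2 g) =
      ∑ p ∈ Finset.HasAntidiagonal.antidiagonal m, PowerSeries.coeff n (shiftX a ^ (p.1 + p.2)) •
        (PowerSeries.coeff p.1 f * PowerSeries.coeff p.2 g) := fun m =>
    Finset.sum_congr rfl fun p hp => by rw [Finset.HasAntidiagonal.mem_antidiagonal.mp hp]
  simp only [h1]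
  rw [sum_range_antidiagonal (fun i j => PowerSeries.coeff n (shiftX a ^ (i + j)) •
        (PowerSeries.coeff i f * PowerSeries.coeff j g)) n
      fun i j h => by rw [coeff_shiftX_pow a h, zero_smul]]
  have h2 : ∀ p ∈ Finset.HasAntidiagonal.antidiagonal n,
      PowerSeries.coeff p.1 (shift a f) * PowerSeries.coeff p.2 (shift a g) =
      ∑ i ∈ Finset.range (n + 1), ∑ j ∈ Finset.range (n + 1),
        (PowerSeries.coeff p.1 (shiftX a ^ i) * PowerSeries.coeff p.2 (shiftX a ^ j)) •
          (PowerSeries.coeff i f * PowerSeries.coeff j g) := by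
    intro p hp
    have := Finset.HasAntidiagonal.mem_antidiagonal.mp hp
    rw [coeff_shift a f (show p.1 ≤ n by omega), coeff_shift a g (show p.2 ≤ n by omega),
      Finset.sum_mul_sum]
    simp only [smul_mul_smul_comm]
  rw [Finset.sum_congr rfl h2, Finset.sum_comm (s := Finset.HasAntidiagonal.antidiagonal n)]
  refine Finset.sum_congr rfl fun i _ => ?_
  rw [Finset.sum_comm]
  refine Finset.sum_congr rfl fun j _ => ?_
  rw [← Finset.sum_smul, pow_add, PowerSeries.coeff_mul]

/-- The substitution `u ↦ u - a` as a homomorphism. -/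
def shiftHom (A : Type*) [Ring A] [Algebra ℂ A] (a : ℂ) : PowerSeries A →ₐ[ℂ] PowerSeries A :=
  AlgHom.ofLinearMap
    { toFun := shift a
      map_add' := fun f g => by
        ext n; simp [shift, Finset.sum_add_distrib]
      map_smul' := fun r f => by
        ext n; simp [shift, Finset.smul_sum, smul_comm r] }
    (by
      ext n
      change PowerSeries.coeff n (shift a 1) = _
      rw [coeff_shift a _ le_rfl, Finset.sum_eq_single 0]
      · simp [PowerSeries.coeff_one]
      · intro m _ hm; simp [PowerSeries.coeff_one, hm]
      · simp)
    (shift_mul a)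

@[simp] lemma shiftHom_apply (a : ℂ) (f : PowerSeries A) : shiftHom A a f = shift a f := rfl

lemma shift_X_eq_map (a : ℂ) :
    shift a (PowerSeries.X : PowerSeries A) = PowerSeries.map (algebraMap ℂ A) (shiftX a) := by
  ext n
  rw [coeff_shift a _ (Nat.le_add_right n 1), Finset.sum_eq_single 1]
  · simp [Algebra.smul_def]
  · intro m _ hm; simp [PowerSeries.coeff_X, hm]
  · simp

lemma constantCoeff_shift (a : ℂ) (f : PowerSeries A) :
    PowerSeries.coeff 0 (shift a f) = PowerSeries.coeff 0 f := by
  simp [shift]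

lemma shift_X_mul (a : ℂ) :
    shift a (PowerSeries.X : PowerSeries A) * (1 - a • PowerSeries.X) = PowerSeries.X := by
  have h := congrArg (PowerSeries.map (algebraMap ℂ A)) (shiftX_mul a)
  rw [map_mul, ← shift_X_eq_map, map_sub, map_one, map_mul, PowerSeries.map_X,
    PowerSeries.map_C] at h
  convert h using 3
  rw [Algebra.smul_def, PowerSeries.algebraMap_apply]

/-- Constant series. -/
def constHom (A : Type*) [Ring A] [Algebra ℂ A] : A →ₐ[ℂ] PowerSeries A :=
  { PowerSeries.C with commutes' := fun _ => (PowerSeries.algebraMap_apply ..).symm }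

@[simp] lemma constHom_apply (x : A) : constHom A x = PowerSeries.C x := rfl

/-- Exchange of the two variables. -/
def swapHom (A : Type*) [Ring A] [Algebra ℂ A] :
    PowerSeries (PowerSeries A) →ₐ[ℂ] PowerSeries (PowerSeries A) :=
  AlgHom.ofLinearMap
    { toFun := fun f => PowerSeries.mk fun r => PowerSeries.mk fun s =>
        PowerSeries.coeff r (PowerSeries.coeff s f)
      map_add' := fun f g => by ext r s; simp
      map_smul' := fun c f => by ext r s; simp }
    (by
      ext r s
      by_cases hr : r = 0 <;> by_cases hs : s = 0 <;> simp [PowerSeries.coeff_one, hr, hs])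
    (fun f g => by
      ext r s
      simp only [LinearMap.coe_mk, AddHom.coe_mk, PowerSeries.coeff_mk, PowerSeries.coeff_mul,
        map_sum]
      exact Finset.sum_comm)

@[simp] lemma coeff_coeff_swapHom (f : PowerSeries (PowerSeries A)) (r s : ℕ) :
    PowerSeries.coeff s (PowerSeries.coeff r (swapHom A f)) =
      PowerSeries.coeff r (PowerSeries.coeff s f) := by
  simp [swapHom]

/-- Both sides run over quadruples with total n, and the exchange of the two middle entries is an
involution. This makes `diagHom` multiplicative. -/
lemma sum_antidiagonal_four {G : Type*} [AddCommMonoid G] (F : ℕ → ℕ → ℕ → ℕ → G) (n : ℕ) :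
    ∑ p ∈ Finset.HasAntidiagonal.antidiagonal n,
      ∑ x ∈ Finset.HasAntidiagonal.antidiagonal p.1,
        ∑ y ∈ Finset.HasAntidiagonal.antidiagonal p.2, F x.1 x.2 y.1 y.2 =
    ∑ p ∈ Finset.HasAntidiagonal.antidiagonal n,
      ∑ x ∈ Finset.HasAntidiagonal.antidiagonal p.1,
        ∑ y ∈ Finset.HasAntidiagonal.antidiagonal p.2, F x.1 y.1 x.2 y.2 := by
  simp only [← Finset.sum_product', Finset.sum_sigma']
  refine Finset.sum_nbij'
    (fun t => ⟨(t.2.1.1 + t.2.2.1, t.2.1.2 + t.2.2.2), ((t.2.1.1, t.2.2.1), (t.2.1.2, t.2.2.2))⟩)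
    (fun t => ⟨(t.2.1.1 + t.2.2.1, t.2.1.2 + t.2.2.2), ((t.2.1.1, t.2.2.1), (t.2.1.2, t.2.2.2))⟩)
    ?_ ?_ ?_ ?_ ?_
  · rintro ⟨⟨a, b⟩, ⟨⟨c, d⟩, ⟨e, f⟩⟩⟩ h
    simp only [Finset.mem_sigma, Finset.mem_product, Finset.HasAntidiagonal.mem_antidiagonal] at h ⊢
    obtain ⟨rfl, rfl, rfl⟩ := h
    exact ⟨by ac_rfl, trivial, trivial⟩
  · rintro ⟨⟨a, b⟩, ⟨⟨c, d⟩, ⟨e, f⟩⟩⟩ h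
    simp only [Finset.mem_sigma, Finset.mem_product, Finset.HasAntidiagonal.mem_antidiagonal] at h ⊢
    obtain ⟨rfl, rfl, rfl⟩ := h
    exact ⟨by ac_rfl, trivial, trivial⟩
  · rintro ⟨⟨a, b⟩, ⟨⟨c, d⟩, ⟨e, f⟩⟩⟩ h
    simp only [Finset.mem_sigma, Finset.mem_product, Finset.HasAntidiagonal.mem_antidiagonal] at h ⊢
    obtain ⟨-, rfl, rfl⟩ := h
    rfl
  · rintro ⟨⟨a, b⟩, ⟨⟨c, d⟩, ⟨e, f⟩⟩⟩ h
    simp only [Finset.mem_sigma, Finset.mem_product, Finset.HasAntidiagonal.mem_antidiagonal] at h ⊢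
    obtain ⟨-, rfl, rfl⟩ := h
    rfl
  · rintro ⟨⟨a, b⟩, ⟨⟨c, d⟩, ⟨e, f⟩⟩⟩ h
    rfl

/-- Identification of the two variables. -/
def diagHom (A : Type*) [Ring A] [Algebra ℂ A] :
    PowerSeries (PowerSeries A) →ₐ[ℂ] PowerSeries A :=
  AlgHom.ofLinearMap
    { toFun := fun f => PowerSeries.mk fun n => ∑ p ∈ Finset.HasAntidiagonal.antidiagonal n,
        PowerSeries.coeff p.1 (PowerSeries.coeff p.2 f)
      map_add' := fun f g => by ext n; simp [Finset.sum_add_distrib]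
      map_smul' := fun c f => by ext n; simp [Finset.smul_sum] }
    (by
      ext n
      simp only [LinearMap.coe_mk, AddHom.coe_mk, PowerSeries.coeff_mk]
      rw [Finset.sum_eq_single (n, 0)]
      · simp
      · rintro ⟨a, b⟩ h h2
        have hb : b ≠ 0 := by
          rintro rfl
          exact h2 (by simpa using h)
        simp [PowerSeries.coeff_one, hb]
      · simp)
    (fun f g => by
      ext n
      simp only [LinearMap.coe_mk, AddHom.coe_mk, PowerSeries.coeff_mk, PowerSeries.coeff_mul,
        map_sum, Finset.sum_mul_sum]
      simp only [Finset.sum_comm (s := Finset.HasAntidiagonal.antidiagonal (Prod.snd _))]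
      exact sum_antidiagonal_four (fun r₁ r₂ s₁ s₂ =>
        PowerSeries.coeff r₁ (PowerSeries.coeff s₁ f) *
          PowerSeries.coeff r₂ (PowerSeries.coeff s₂ g)) n)

lemma coeff_diagHom (f : PowerSeries (PowerSeries A)) (n : ℕ) :
    PowerSeries.coeff n (diagHom A f) = ∑ p ∈ Finset.HasAntidiagonal.antidiagonal n,
        PowerSeries.coeff p.1 (PowerSeries.coeff p.2 f) := by
  simp [diagHom]

/-- Series in the inner variable. -/
def inner (A : Type*) [Ring A] [Algebra ℂ A] : PowerSeries A →ₐ[ℂ] PowerSeries (PowerSeries A) :=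
  constHom (PowerSeries A)

/-- Series in the outer variable. -/
def outer (A : Type*) [Ring A] [Algebra ℂ A] : PowerSeries A →ₐ[ℂ] PowerSeries (PowerSeries A) :=
  PowerSeries.mapAlgHom (constHom A)

lemma coeff_coeff_inner (f : PowerSeries A) (r s : ℕ) :
    PowerSeries.coeff r (PowerSeries.coeff s (inner A f)) =
      if s = 0 then PowerSeries.coeff r f else 0 := by
  rw [inner, constHom_apply, PowerSeries.coeff_C]
  split_ifs <;> simp

lemma coeff_coeff_outer (f : PowerSeries A) (r s : ℕ) :
    PowerSeries.coeff r (PowerSeries.coeff s (outer A f)) =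
      if r = 0 then PowerSeries.coeff s f else 0 := by
  simp [outer, PowerSeries.mapAlgHom_apply, PowerSeries.coeff_C]

lemma outer_X : outer A PowerSeries.X = PowerSeries.X := by
  rw [outer, PowerSeries.mapAlgHom_apply, PowerSeries.map_X]

lemma swapHom_inner (f : PowerSeries A) : swapHom A (inner A f) = outer A f := by
  ext r s; rw [coeff_coeff_swapHom, coeff_coeff_inner, coeff_coeff_outer]

lemma swapHom_outer (f : PowerSeries A) : swapHom A (outer A f) = inner A f := by
  ext r s; rw [coeff_coeff_swapHom, coeff_coeff_inner, coeff_coeff_outer]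

lemma diagHom_inner (f : PowerSeries A) : diagHom A (inner A f) = f := by
  ext n
  rw [coeff_diagHom, Finset.sum_eq_single (n, 0)]
  · rw [coeff_coeff_inner, if_pos rfl]
  · rintro ⟨a, b⟩ h h2
    rw [coeff_coeff_inner, if_neg]
    rintro rfl
    exact h2 (by simpa using h)
  · simp

lemma diagHom_outer (f : PowerSeries A) : diagHom A (outer A f) = f := by
  ext n
  rw [coeff_diagHom, Finset.sum_eq_single (0, n)]
  · simp [coeff_coeff_outer]
  · rintro ⟨a, b⟩ h h2
    rw [coeff_coeff_outer, if_neg]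
    rintro rfl
    exact h2 (by simpa using h)
  · simp

lemma mapShift_inner (a : ℂ) (f : PowerSeries A) :
    PowerSeries.mapAlgHom (shiftHom A a) (inner A f) = inner A (shift a f) := by
  simp [inner, PowerSeries.mapAlgHom_apply]

lemma mapShift_outer (a : ℂ) (f : PowerSeries A) :
    PowerSeries.mapAlgHom (shiftHom A a) (outer A f) = outer A f := by
  ext r s
  simp only [PowerSeries.mapAlgHom_apply, PowerSeries.coeff_map, outer, constHom_apply,
    RingHom.coe_coe]
  rw [shiftHom_apply, coeff_shift a _ le_rfl, Finset.sum_eq_single 0]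
  · simp [PowerSeries.coeff_C, PowerSeries.coeff_one, Algebra.smul_def]
  · intro m _ hm; simp [PowerSeries.coeff_C, hm]
  · simp

/-- Scalar series commute with all series. -/
lemma commute_map_of_commute {S : Type*} [Ring S] (φ : S →+* A) (h : ∀ s x, Commute (φ s) x)
    (s : PowerSeries S) (x : PowerSeries A) : Commute (PowerSeries.map φ s) x := by
  ext n
  rw [PowerSeries.coeff_mul, PowerSeries.coeff_mul, ← Finset.Nat.sum_antidiagonal_swap]
  exact Finset.sum_congr rfl fun p _ => by simpa using (h _ _).eq

/-- Scalar series in two variables. -/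
def scalars (A : Type*) [Ring A] [Algebra ℂ A] :
    PowerSeries (PowerSeries ℂ) →ₐ[ℂ] PowerSeries (PowerSeries A) :=
  PowerSeries.mapAlgHom (PowerSeries.mapAlgHom (Algebra.ofId ℂ A))

lemma commute_scalars (s : PowerSeries (PowerSeries ℂ)) (x : PowerSeries (PowerSeries A)) :
    Commute (scalars A s) x := by
  rw [scalars, PowerSeries.mapAlgHom_apply]
  refine commute_map_of_commute _ (fun s x => ?_) s x
  rw [RingHom.coe_coe, PowerSeries.mapAlgHom_apply]
  exact commute_map_of_commute _ (fun s x => Algebra.commute_algebraMap_left s x) s x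

lemma scalars_inner (s : PowerSeries ℂ) :
    scalars A (inner ℂ s) = inner A (PowerSeries.map (algebraMap ℂ A) s) := by
  simp only [scalars, inner, PowerSeries.mapAlgHom_apply, constHom_apply, PowerSeries.map_C]
  rfl

lemma scalars_outer (s : PowerSeries ℂ) :
    scalars A (outer ℂ s) = outer A (PowerSeries.map (algebraMap ℂ A) s) := by
  ext m n
  simp only [scalars, outer, PowerSeries.mapAlgHom_apply, PowerSeries.coeff_map, constHom_apply,
    RingHom.coe_coe, PowerSeries.coeff_C, Algebra.ofId_apply]
  split_ifs <;> simp

lemma eq_zero_of_X_mul {f : PowerSeries A} (h : PowerSeries.X * f = 0) : f = 0 := by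
  ext n
  rw [← PowerSeries.coeff_succ_X_mul, h, map_zero, map_zero]

/-- Coefficient n + 1 in the outer variable reads p fₙ = X fₙ₊₁ and coefficient 0 reads X f₀ = 0. As
X is regular, all fₙ vanish successively, with no condition on p. -/
lemma eq_zero_of_linear_mul (p : PowerSeries A) {f : PowerSeries (PowerSeries A)}
    (h : (PowerSeries.X * PowerSeries.C p - PowerSeries.C PowerSeries.X) * f = 0) : f = 0 := by
  rw [sub_mul, mul_assoc] at h
  refine PowerSeries.ext fun n => ?_
  induction n with
  | zero =>
    have h0 := congrArg (PowerSeries.coeff 0) h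
    rw [map_sub, PowerSeries.coeff_zero_X_mul, PowerSeries.coeff_C_mul, map_zero, zero_sub,
      neg_eq_zero] at h0
    exact eq_zero_of_X_mul h0
  | succ n ih =>
    have h0 := congrArg (PowerSeries.coeff (n + 1)) h
    rw [map_sub, PowerSeries.coeff_succ_X_mul, PowerSeries.coeff_C_mul, PowerSeries.coeff_C_mul,
      ih, map_zero, map_zero, mul_zero, zero_sub, neg_eq_zero] at h0
    exact eq_zero_of_X_mul h0

/-- `v⁻¹ - u⁻¹ + a u⁻¹ v⁻¹` is regular. -/
lemma eq_zero_of_factor_mul (a : ℂ) {f : PowerSeries (PowerSeries A)}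
    (h : (PowerSeries.X - PowerSeries.C PowerSeries.X +
      a • (PowerSeries.C PowerSeries.X * PowerSeries.X)) * f = 0) : f = 0 := by
  refine eq_zero_of_linear_mul (1 + a • PowerSeries.X) (f := f) ?_
  rw [← h]
  congr 1
  rw [map_add, map_one, mul_add, mul_one, PowerSeries.X_mul (φ := PowerSeries.C (a • _))]
  have : PowerSeries.C (a • PowerSeries.X : PowerSeries A) = a • PowerSeries.C PowerSeries.X :=
    map_smul (constHom (PowerSeries A)) a PowerSeries.X
  rw [this, smul_mul_assoc]
  abel

lemma eq_zero_of_unitarity_mul (M N : ℕ) (θ₀ : ℤˣ) {f : PowerSeries (PowerSeries A)}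
    (h : unitarity M N θ₀ (PowerSeries.C PowerSeries.X) PowerSeries.X * f = 0) : f = 0 := by
  rw [unitarity, mul_assoc, mul_assoc, mul_assoc] at h
  have e : ∀ (b : ℂ) (x y : PowerSeries (PowerSeries A)), x - b • y = x + (-b) • y := by
    intro b x y; rw [neg_smul, sub_eq_add_neg]
  -- The four factors of unitarity are v⁻¹ - u⁻¹ + a u⁻¹v⁻¹ with a = -1, 1, -κ, κ; they are
  -- cancelled one after another from the outside.
  refine eq_zero_of_factor_mul (kappa M N θ₀) (eq_zero_of_factor_mul (-kappa M N θ₀)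
    (eq_zero_of_factor_mul 1 (eq_zero_of_factor_mul (-1) ?_)))
  rw [← e, ← e, one_smul]
  exact h

end Series

/-! ### Solutions of the RTT relation -/

section Solutions

variable {M N : ℕ} (θ₀ : ℤˣ) {A : Type*} [Ring A] [Algebra ℂ A]

/-- A matrix of series satisfying the RTT relation. -/
def IsRTT (X : Matrix (Idx M N) (Idx M N) (PowerSeries A)) : Prop :=
  RTTRel θ₀ (PowerSeries.C PowerSeries.X) PowerSeries.X (X.map (inner A)) (X.map (outer A))

variable {θ₀}

lemma matrix_eq_of_smul_eq {B n : Type*} [Ring B] {r : B} (hr : ∀ f, r * f = 0 → f = 0)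
    {Z W : Matrix n n B} (h : r • Z = r • W) : Z = W := by
  ext i j
  have h2 := congrFun (congrFun h i) j
  rw [Matrix.smul_apply, Matrix.smul_apply, smul_eq_mul, smul_eq_mul, ← sub_eq_zero,
    ← mul_sub] at h2
  exact sub_eq_zero.mp (hr _ h2)

lemma theta_ne_zero (i : Idx M N) : theta i ≠ 0 := fun h => by
  simpa [h] using theta_mul_self i

lemma sgn_ne_zero (x : ZMod 2) : sgn x ≠ 0 := fun h => by
  simpa [h] using sgn_mul_self x

lemma contrMat_mul_leg₂_apply (Z : Matrix (Idx M N) (Idx M N) A) (a b c d : Idx M N) :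
    (contrMat θ₀ M N A * leg₂ θ₀ Z) (a, b) (c, d) =
      if a = bar b then (theta b * theta (bar c) * sgn (par θ₀ c) *
        sgn ((par θ₀ c + par θ₀ d) * par θ₀ c)) • Z (bar c) d else 0 := by
  rw [contrMat_mul_apply]
  refine if_congr Iff.rfl ?_ rfl
  rw [Finset.sum_eq_single (bar c)]
  · rw [leg₂_apply, bar_bar, if_pos rfl, smul_smul, par_bar]
  · intro f _ hf
    rw [leg₂_apply, if_neg (fun h => hf (by rw [← h, bar_bar])), smul_zero]
  · simp

lemma leg₂_mul_contrMat_apply (W : Matrix (Idx M N) (Idx M N) A) (a b c d : Idx M N) :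
    (leg₂ θ₀ W * contrMat θ₀ M N A) (a, b) (c, d) =
      if c = bar d then (theta (bar a) * theta d * sgn (par θ₀ d) *
        sgn ((par θ₀ b + par θ₀ a) * par θ₀ a)) • W b (bar a) else 0 := by
  rw [mul_contrMat_apply]
  refine if_congr Iff.rfl ?_ rfl
  rw [Finset.sum_eq_single (bar a)]
  · rw [leg₂_apply, bar_bar, if_pos rfl, smul_smul, par_bar]
  · intro f _ hf
    rw [leg₂_apply, if_neg (fun h => hf (by rw [h, bar_bar])), smul_zero]
  · simp

/-- As `K` has rank one, a relation `K Z₂ = W₂ K` forces both matrices to be the same scalar. -/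
lemma scalar_of_contrMat_mul_leg₂ {Z W : Matrix (Idx M N) (Idx M N) A}
    (h : contrMat θ₀ M N A * leg₂ θ₀ Z = leg₂ θ₀ W * contrMat θ₀ M N A) :
    ∃ γ : A, Z = Matrix.diagonal (fun _ => γ) ∧ W = Matrix.diagonal (fun _ => γ) := by
  have h1 : ∀ b d, Z d d = W b b := by
    intro b d
    have h2 := congrFun (congrFun h (bar b, b)) (bar d, d)
    -- Row (bar b, b) and column (bar d, d) both meet K, which compares a diagonal entry of Z with
    -- one of W for arbitrary b and d.
    rw [contrMat_mul_leg₂_apply, leg₂_mul_contrMat_apply, if_pos rfl, if_pos rfl] at h2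
    simp only [bar_bar, par_bar, CharTwo.add_self_eq_zero, zero_mul, sgn_zero, mul_one] at h2
    exact smul_right_injective A
      (mul_ne_zero (mul_ne_zero (theta_ne_zero b) (theta_ne_zero d)) (sgn_ne_zero _)) h2
  have h2 : ∀ e d, e ≠ d → Z e d = 0 := by
    intro e d hne
    -- For d ≠ e this column is annihilated by K on the right-hand side, so the entry of Z on the
    -- left must vanish.
    have h2 := congrFun (congrFun h (bar e, e)) (bar e, d)
    rw [contrMat_mul_leg₂_apply, leg₂_mul_contrMat_apply, if_pos rfl,
      if_neg (fun h => hne (bar_injective h)), bar_bar] at h2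
    exact (smul_eq_zero_iff_right (mul_ne_zero (mul_ne_zero (mul_ne_zero (theta_ne_zero _)
      (theta_ne_zero _)) (sgn_ne_zero _)) (sgn_ne_zero _))).mp h2
  have h3 : ∀ e d, e ≠ d → W e d = 0 := by
    intro e d hne
    have h2 := congrFun (congrFun h (bar d, e)) (bar d, d)
    rw [contrMat_mul_leg₂_apply, leg₂_mul_contrMat_apply, if_pos rfl,
      if_neg (fun h => hne (bar_injective h).symm), bar_bar] at h2
    exact (smul_eq_zero_iff_right (mul_ne_zero (mul_ne_zero (mul_ne_zero (theta_ne_zero _)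
      (theta_ne_zero _)) (sgn_ne_zero _)) (sgn_ne_zero _))).mp h2.symm
  rcases isEmpty_or_nonempty (Idx M N) with hE | ⟨⟨i₀⟩⟩
  · exact ⟨0, Matrix.ext fun i => hE.elim i, Matrix.ext fun i => hE.elim i⟩
  · refine ⟨Z i₀ i₀, ?_, ?_⟩
    · ext i j
      by_cases hij : i = j
      · subst hij; rw [Matrix.diagonal_apply_eq, h1 i i, h1 i i₀]
      · rw [Matrix.diagonal_apply_ne _ hij, h2 _ _ hij]
    · ext i j
      by_cases hij : i = j
      · subst hij; rw [Matrix.diagonal_apply_eq, h1 i i₀]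
      · rw [Matrix.diagonal_apply_ne _ hij, h3 _ _ hij]

lemma shift_zero (f : PowerSeries A) : shift 0 f = f := by
  ext n
  rw [coeff_shift 0 f le_rfl, Finset.sum_eq_single n]
  · simp [shiftX, PowerSeries.coeff_X_pow]
  · intro m _ hm; simp [shiftX, PowerSeries.coeff_X_pow, hm.symm]
  · simp

lemma inner_X : (PowerSeries.C PowerSeries.X : PowerSeries (PowerSeries A)) =
    inner A PowerSeries.X := rfl

lemma commute_X (x : PowerSeries A) : Commute PowerSeries.X x :=
  (PowerSeries.commute_X x).symm

lemma commute_shift_X (a : ℂ) (x : PowerSeries A) : Commute (shift a PowerSeries.X) x := by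
  rw [shift_X_eq_map]
  exact commute_map_of_commute _ (fun s x => Algebra.commute_algebraMap_left s x) _ x

lemma eq_zero_of_shift_X_mul (a : ℂ) {f : PowerSeries A} (h : shift a PowerSeries.X * f = 0) :
    f = 0 := by
  refine eq_zero_of_X_mul ?_
  rw [← shift_X_mul a, (commute_shift_X a _).eq, mul_assoc, h, mul_zero]

/-- The R-matrix for `κ = 0`, divided by a common factor. -/
def Rlin (θ₀ : ℤˣ) {B : Type*} [Ring B] [Algebra ℂ B] (z w : B) :
    Matrix (Idx M N × Idx M N) (Idx M N × Idx M N) B :=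
  (w - z) • 1 + (z * w) • (permMat θ₀ M N B - contrMat θ₀ M N B)

lemma Rpoly_eq_smul_Rlin (hκ : kappa M N θ₀ = 0) {z w : A} (hz : ∀ x, Commute z x)
    (hw : ∀ x, Commute w x) : Rpoly M N θ₀ z w = (w - z) • Rlin θ₀ z w := by
  have hc : Commute (z * w) (w - z) := (hz _).mul_left (hw _)
  rw [Rpoly_eq, hκ, Rlin]
  simp only [zero_smul, add_zero, smul_add, smul_sub, smul_smul, hc.eq]
  abel

lemma Rlin_map {A' : Type*} [Ring A'] [Algebra ℂ A'] (φ : A →ₐ[ℂ] A') (z w : A) :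
    (Rlin θ₀ z w : Matrix (Idx M N × Idx M N) _ A).map φ = Rlin θ₀ (φ z) (φ w) := by
  rw [Rlin, Rlin, ← permMat_map φ, ← contrMat_map φ]
  ext p q
  simp only [Matrix.map_apply, Matrix.sub_apply, Matrix.add_apply, Matrix.smul_apply, map_sub,
    map_add, map_mul, smul_eq_mul, Matrix.one_apply]
  split_ifs <;> simp

/-- The residue of the RTT relation at `u - v = -κ`. -/
lemma IsRTT.contraction {X : Matrix (Idx M N) (Idx M N) (PowerSeries A)}
    (h : IsRTT θ₀ X) :
    contrMat θ₀ M N (PowerSeries A) * leg₁ θ₀ (X.map (shift (kappa M N θ₀))) * leg₂ θ₀ X =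
      leg₂ θ₀ X * leg₁ θ₀ (X.map (shift (kappa M N θ₀))) * contrMat θ₀ M N (PowerSeries A) := by
  by_cases hκ : kappa M N θ₀ = 0
  -- For κ = 0 the cleared R-matrix vanishes identically at u = v. The common factor v⁻¹ - u⁻¹ is
  -- regular and is cancelled first; then u = v is substituted.
  · have hX : X.map (shift (kappa M N θ₀)) = X := by
      ext1 i j; rw [hκ, Matrix.map_apply, shift_zero]
    rw [hX]
    have hd : ∀ f : PowerSeries (PowerSeries A),
        (PowerSeries.X - PowerSeries.C PowerSeries.X) * f = 0 → f = 0 := fun f hf =>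
      eq_zero_of_factor_mul 0 (by rwa [zero_smul, add_zero])
    have hz : ∀ x : PowerSeries (PowerSeries A), Commute (PowerSeries.C PowerSeries.X) x := by
      intro x
      have := commute_scalars (A := A) (inner ℂ PowerSeries.X) x
      rwa [scalars_inner, PowerSeries.map_X] at this
    have h1 := h
    unfold IsRTT RTTRel at h1
    rw [Rpoly_eq_smul_Rlin hκ hz commute_X,
      smul_mul_of_central (fun x => (commute_X x).sub_left (hz x)), Matrix.smul_mul,
      Matrix.smul_mul] at h1
    have h2 := congrArg (fun Z => Z.map (diagHom A)) (matrix_eq_of_smul_eq hd h1)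
    have e1 : (X.map (inner A)).map (diagHom A) = X := by
      ext1 i j; simp [diagHom_inner]
    have e2 : (X.map (outer A)).map (diagHom A) = X := by
      ext1 i j; simp [diagHom_outer]
    have e3 : (Rlin θ₀ (PowerSeries.C PowerSeries.X) PowerSeries.X).map (diagHom A) =
        (PowerSeries.X * PowerSeries.X : PowerSeries A) •
          (permMat θ₀ M N (PowerSeries A) - contrMat θ₀ M N _) := by
      have hXd : diagHom A PowerSeries.X = PowerSeries.X := by
        conv_lhs => rw [← outer_X, diagHom_outer]
      rw [Rlin_map, inner_X, hXd, diagHom_inner, Rlin, sub_self, zero_smul, zero_add]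
    simp only [Matrix.map_mul, leg₁_map, leg₂_map, e1, e2, e3] at h2
    rw [smul_mul_of_central (fun x => (commute_X x).mul_left (commute_X x)), Matrix.smul_mul,
      Matrix.smul_mul] at h2
    have h3 := matrix_eq_of_smul_eq (fun f hf => eq_zero_of_X_mul (eq_zero_of_X_mul
      (by rwa [mul_assoc] at hf))) h2
    -- At equal spectral parameters the P part of the relation holds for any X, so only the K part
    -- carries information.
    have h4 : permMat θ₀ M N (PowerSeries A) * leg₁ θ₀ X * leg₂ θ₀ X =
        leg₂ θ₀ X * leg₁ θ₀ X * permMat θ₀ M N (PowerSeries A) := by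
      rw [permMat_mul_leg₁, mul_assoc, permMat_mul_leg₂, mul_assoc]
    rw [sub_mul, sub_mul, mul_sub, h4] at h3
    exact sub_right_injective h3
  -- The inner variable is shifted by κ and then identified with the outer one, which evaluates the
  -- relation at u = v - κ.
  · have h1 := h.map ((diagHom A).comp (PowerSeries.mapAlgHom (shiftHom A (kappa M N θ₀))))
    have e1 : (X.map (inner A)).map
        ((diagHom A).comp (PowerSeries.mapAlgHom (shiftHom A (kappa M N θ₀)))) =
          X.map (shift (kappa M N θ₀)) := by
      ext1 i j; simp [mapShift_inner, diagHom_inner]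
    have e2 : (X.map (outer A)).map
        ((diagHom A).comp (PowerSeries.mapAlgHom (shiftHom A (kappa M N θ₀)))) = X := by
      ext1 i j; simp [mapShift_outer, diagHom_outer]
    have e3 : ((diagHom A).comp (PowerSeries.mapAlgHom (shiftHom A (kappa M N θ₀))))
        (PowerSeries.C PowerSeries.X) = shift (kappa M N θ₀) PowerSeries.X := by
      rw [inner_X]; simp [mapShift_inner, diagHom_inner]
    have e4 : ((diagHom A).comp (PowerSeries.mapAlgHom (shiftHom A (kappa M N θ₀))))
        PowerSeries.X = PowerSeries.X := by
      conv_lhs => rw [← outer_X]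
      simp only [AlgHom.comp_apply, mapShift_outer, diagHom_outer]
    rw [e1, e2, e3, e4] at h1
    have hs := shift_X_mul (A := A) (kappa M N θ₀)
    have hc := commute_shift_X (A := A) (kappa M N θ₀)
    set x' : PowerSeries A := shift (kappa M N θ₀) PowerSeries.X with hx'
    have e5 : (PowerSeries.X : PowerSeries A) - x' = -(kappa M N θ₀ • (x' * PowerSeries.X)) := by
      rw [mul_sub, mul_one, mul_smul_comm] at hs
      nth_rewrite 1 [← hs]
      abel
    -- The terms 1 and P contain the factor for u - v + κ, which is now zero. What multiplies K is κ
    -- times a product of regular central series, and it can be cancelled as κ ≠ 0.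
    have e6 : Rpoly M N θ₀ x' PowerSeries.X =
        (kappa M N θ₀ • (x' * PowerSeries.X * (x' * PowerSeries.X))) •
          contrMat θ₀ M N (PowerSeries A) := by
      rw [Rpoly_eq, e5, neg_add_cancel, mul_zero, mul_zero, zero_smul, zero_smul, zero_add,
        mul_neg, neg_smul, zero_sub, neg_neg, mul_smul_comm]
    have hcc : ∀ y, Commute (kappa M N θ₀ • (x' * PowerSeries.X * (x' * PowerSeries.X))) y :=
      fun y => (((hc y).mul_left (commute_X y)).mul_left
        ((hc y).mul_left (commute_X y))).smul_left _
    unfold RTTRel at h1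
    rw [e6, smul_mul_of_central hcc, Matrix.smul_mul, Matrix.smul_mul] at h1
    refine matrix_eq_of_smul_eq (fun f hf => ?_) h1
    rw [smul_mul_assoc, smul_eq_zero_iff_right hκ, mul_assoc, mul_assoc, mul_assoc] at hf
    exact eq_zero_of_X_mul (eq_zero_of_shift_X_mul _ (eq_zero_of_X_mul
      (eq_zero_of_shift_X_mul _ hf)))

lemma transp_map_shift (a : ℂ) (X : Matrix (Idx M N) (Idx M N) (PowerSeries A)) :
    (transp θ₀ X).map (shift a) = transp θ₀ (X.map (shift a)) :=
  transp_map (shiftHom A a).toLinearMap X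

/-- `T^t(u - κ) T(u)` and `T(u) T^t(u - κ)` are the same scalar matrix. -/
lemma IsRTT.exists_scalar (hN : Even N) {X : Matrix (Idx M N) (Idx M N) (PowerSeries A)}
    (h : IsRTT θ₀ X) :
    ∃ γ : PowerSeries A,
      (transp θ₀ X).map (shift (kappa M N θ₀)) * X = Matrix.diagonal (fun _ => γ) ∧
      X * (transp θ₀ X).map (shift (kappa M N θ₀)) = Matrix.diagonal (fun _ => γ) := by
  refine scalar_of_contrMat_mul_leg₂ (θ₀ := θ₀) ?_
  have h1 := h.contraction
  rw [contrMat_mul_leg₁ hN, mul_assoc, ← leg₂_mul, mul_assoc, leg₁_mul_contrMat hN, ← mul_assoc,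
    ← leg₂_mul] at h1
  rw [transp_map_shift, h1]

lemma leg₂_diagonal (γ : A) :
    leg₂ θ₀ (Matrix.diagonal fun _ : Idx M N => γ) = Matrix.diagonal fun _ => γ := by
  ext ⟨a, b⟩ ⟨c, d⟩
  rw [leg₂_apply, Matrix.diagonal_apply, Matrix.diagonal_apply]
  by_cases h1 : a = c <;> by_cases h2 : b = d
  · simp [h1, h2, CharTwo.add_self_eq_zero]
  all_goals simp [h1, h2]

lemma ptransp_map {A' : Type*} [Ring A'] [Algebra ℂ A'] (φ : A →ₐ[ℂ] A')
    (Z : Matrix (Idx M N × Idx M N) (Idx M N × Idx M N) A) :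
    (ptransp θ₀ Z).map φ = ptransp θ₀ (Z.map φ) := by
  ext; simp [ptransp]

/-- The scalar `T(v) T^t(v - κ)` commutes with `T(u)`. -/
lemma IsRTT.commute_scalar (hN : Even N) {X : Matrix (Idx M N) (Idx M N) (PowerSeries A)}
    (h : IsRTT θ₀ X) {γ : PowerSeries A}
    (hγ : X * (transp θ₀ X).map (shift (kappa M N θ₀)) = Matrix.diagonal (fun _ => γ))
    (i j : Idx M N) : Commute (inner A (X i j)) (outer A γ) := by
  set z : PowerSeries (PowerSeries A) := PowerSeries.C PowerSeries.X with hz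
  set w : PowerSeries (PowerSeries A) := PowerSeries.X with hw
  set w' : PowerSeries (PowerSeries A) := outer A (shift (kappa M N θ₀) PowerSeries.X) with hw'
  have ez : z = scalars A (inner ℂ PowerSeries.X) := by
    rw [scalars_inner, PowerSeries.map_X]; rfl
  have ew : w = scalars A (outer ℂ PowerSeries.X) := by
    rw [scalars_outer, PowerSeries.map_X, outer_X]
  have ew' : w' = scalars A (outer ℂ (shiftX (kappa M N θ₀))) := by
    rw [scalars_outer, ← shift_X_eq_map]
  have cz : ∀ x, Commute z x := fun x => ez ▸ commute_scalars _ x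
  have cw : ∀ x, Commute w x := fun x => ew ▸ commute_scalars _ x
  have cw' : ∀ x, Commute w' x := fun x => ew' ▸ commute_scalars _ x
  -- Crossing is proved over commutative coefficients and transported along `scalars`.
  have hR : ((1 - kappa M N θ₀ • w) ^ 2) • ptransp θ₀ (Rpoly M N θ₀ w' z) =
      Rpoly M N θ₀ z w := by
    have h0 : outer ℂ (shiftX (kappa M N θ₀)) *
        (1 - kappa M N θ₀ • outer ℂ PowerSeries.X) = outer ℂ PowerSeries.X := by
      have h1 := congrArg (outer ℂ) (shiftX_mul (kappa M N θ₀))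
      rwa [map_mul, map_sub, map_one, ← PowerSeries.smul_eq_C_mul, map_smul] at h1
    have h1 := congrArg (fun Z => Z.map (scalars A))
      (ptransp_Rpoly hN (z := inner ℂ PowerSeries.X) h0)
    simp only [Rpoly_map, ← ez, ← ew] at h1
    rw [← h1, ew', ez, ← Rpoly_map, ← ptransp_map]
    ext1 p q
    simp [← ew]
  set Xs := X.map (shift (kappa M N θ₀)) with hXs
  -- Shifting the inner variable by κ and exchanging the variables turns the RTT relation into the
  -- one for T(v - κ) and T(u).
  have h2 : RTTRel θ₀ w' z (Xs.map (outer A)) (X.map (inner A)) := by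
    have h1 := h.map ((swapHom A).comp (PowerSeries.mapAlgHom (shiftHom A (kappa M N θ₀))))
    have e1 : (X.map (inner A)).map
        ((swapHom A).comp (PowerSeries.mapAlgHom (shiftHom A (kappa M N θ₀)))) =
          Xs.map (outer A) := by
      ext1 i j; simp [mapShift_inner, swapHom_inner, hXs]
    have e2 : (X.map (outer A)).map
        ((swapHom A).comp (PowerSeries.mapAlgHom (shiftHom A (kappa M N θ₀)))) =
          X.map (inner A) := by
      ext1 i j; simp [mapShift_outer, swapHom_outer]
    have e3 : ((swapHom A).comp (PowerSeries.mapAlgHom (shiftHom A (kappa M N θ₀))))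
        (PowerSeries.C PowerSeries.X) = w' := by
      rw [inner_X]; simp [mapShift_inner, swapHom_inner, hw']
    have e4 : ((swapHom A).comp (PowerSeries.mapAlgHom (shiftHom A (kappa M N θ₀))))
        PowerSeries.X = z := by
      conv_lhs => rw [← outer_X]
      simp only [AlgHom.comp_apply, mapShift_outer, swapHom_outer]
      rfl
    rwa [e1, e2, e3, e4] at h1
  have cr : ∀ x, Commute ((1 - kappa M N θ₀ • w) ^ 2) x := fun x =>
    ((Commute.one_left x).sub_left ((cw x).smul_left _)).pow_left 2
  have h3 : leg₁ θ₀ (X.map (inner A)) * Rpoly M N θ₀ z w * leg₂ θ₀ (transp θ₀ (Xs.map (outer A))) =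
      leg₂ θ₀ (transp θ₀ (Xs.map (outer A))) * Rpoly M N θ₀ z w * leg₁ θ₀ (X.map (inner A)) := by
    rw [← hR, smul_mul_of_central cr, Matrix.smul_mul, h2.ptransp hN cz cw',
      smul_mul_of_central cr, Matrix.smul_mul]
  have h4 : X.map (outer A) * transp θ₀ (Xs.map (outer A)) =
      Matrix.diagonal (fun _ => outer A γ) := by
    rw [show transp θ₀ (Xs.map (outer A)) = (transp θ₀ Xs).map (outer A) from
      (transp_map (outer A).toLinearMap Xs).symm, hXs, ← transp_map_shift, ← Matrix.map_mul, hγ,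
      Matrix.diagonal_map (map_zero _)]
  have h5 : leg₂ θ₀ (X.map (outer A)) * leg₂ θ₀ (transp θ₀ (Xs.map (outer A))) =
      Matrix.diagonal (fun _ => outer A γ) := by
    rw [← leg₂_mul, h4, leg₂_diagonal]
  have h1 : Rpoly M N θ₀ z w * leg₁ θ₀ (X.map (inner A)) * leg₂ θ₀ (X.map (outer A)) =
    leg₂ θ₀ (X.map (outer A)) * leg₁ θ₀ (X.map (inner A)) * Rpoly M N θ₀ z w := h
  have h6 : Rpoly M N θ₀ z w * (Matrix.diagonal (fun _ => outer A γ)) =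
      Matrix.diagonal (fun _ => outer A γ) * Rpoly M N θ₀ z w := by
    ext1 p q
    rw [Matrix.mul_diagonal, Matrix.diagonal_mul]
    exact isCentral_Rpoly cz cw p q _
  -- T₂(v) T₁(u) R T₂ᵗ(v - κ) is evaluated in two ways: RTT moves R to the left, giving R T₁(u)
  -- c(v), while `h3` brings T₂(v) next to its transpose, giving c(v) R T₁(u).
  have h7 : Rpoly M N θ₀ z w * (leg₁ θ₀ (X.map (inner A)) *
      Matrix.diagonal (fun _ => outer A γ) -
        Matrix.diagonal (fun _ => outer A γ) * leg₁ θ₀ (X.map (inner A))) = 0 := by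
    rw [mul_sub, sub_eq_zero, ← mul_assoc, ← mul_assoc, h6, ← h5, ← mul_assoc, h1]
    simp only [mul_assoc] at h3 ⊢
    rw [h3]
  have hU : Rpoly M N θ₀ w z * Rpoly M N θ₀ z w = unitarity M N θ₀ z w • 1 := by
    have h0 := congrArg (fun Z => Z.map (scalars A)) (Rpoly_mul_Rpoly_swap (M := M) (θ₀ := θ₀) hN
      (inner ℂ PowerSeries.X) (outer ℂ PowerSeries.X))
    simp only [Matrix.map_mul, Rpoly_map, ← ez, ← ew] at h0
    rw [h0]
    ext1 p q
    simp only [Matrix.map_apply, Matrix.smul_apply, Matrix.one_apply, smul_eq_mul, unitarity,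
      map_mul, map_sub, map_add, map_smul, ← ez, ← ew]
    split_ifs <;> simp
  have h8 := congrArg (fun Z => Rpoly M N θ₀ w z * Z) h7
  simp only [← mul_assoc, hU, mul_zero, Matrix.smul_mul, one_mul] at h8
  rw [← smul_zero (unitarity M N θ₀ z w)] at h8
  have h9 := matrix_eq_of_smul_eq (fun f hf => eq_zero_of_unitarity_mul M N θ₀ hf) h8
  have h10 := congrFun (congrFun h9 (i, i)) (j, i)
  rw [Matrix.sub_apply, Matrix.mul_diagonal, Matrix.diagonal_mul, leg₁_apply, if_pos rfl,
    Matrix.zero_apply, sub_eq_zero] at h10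
  exact h10

lemma IsRTT.coeff_commute_scalar (hN : Even N)
    {X : Matrix (Idx M N) (Idx M N) (PowerSeries A)} (h : IsRTT θ₀ X) {γ : PowerSeries A}
    (hγ : X * (transp θ₀ X).map (shift (kappa M N θ₀)) = Matrix.diagonal (fun _ => γ))
    (i j : Idx M N) (r s : ℕ) :
    Commute (PowerSeries.coeff r (X i j)) (PowerSeries.coeff s γ) := by
  have h1 := congrArg (fun f => PowerSeries.coeff r (PowerSeries.coeff s f))
    (h.commute_scalar hN hγ i j).eq
  simp only [inner, outer, constHom_apply, PowerSeries.coeff_C_mul, PowerSeries.coeff_mul_C,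
    PowerSeries.mapAlgHom_apply, PowerSeries.coeff_map, RingHom.coe_coe] at h1
  exact h1

end Solutions

/-! ### Constructions of solutions of the RTT relation -/

section Constructions

variable {M N : ℕ} {θ₀ : ℤˣ} {A A' : Type*} [Ring A] [Algebra ℂ A] [Ring A'] [Algebra ℂ A']

lemma map_inner (φ : A →ₐ[ℂ] A') (f : PowerSeries A) :
    PowerSeries.mapAlgHom (PowerSeries.mapAlgHom φ) (inner A f) =
      inner A' (PowerSeries.mapAlgHom φ f) := by
  simp [inner, PowerSeries.mapAlgHom_apply]

lemma map_outer (φ : A →ₐ[ℂ] A') (f : PowerSeries A) :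
    PowerSeries.mapAlgHom (PowerSeries.mapAlgHom φ) (outer A f) =
      outer A' (PowerSeries.mapAlgHom φ f) := by
  ext; simp [outer, PowerSeries.mapAlgHom_apply, PowerSeries.coeff_C]

lemma mapAlgHom_X (φ : A →ₐ[ℂ] A') :
    PowerSeries.mapAlgHom φ PowerSeries.X = PowerSeries.X := by
  rw [PowerSeries.mapAlgHom_apply, PowerSeries.map_X]

lemma IsRTT.map {X : Matrix (Idx M N) (Idx M N) (PowerSeries A)} (h : IsRTT θ₀ X)
    (φ : A →ₐ[ℂ] A') : IsRTT θ₀ (X.map (PowerSeries.mapAlgHom φ)) := by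
  have h1 := RTTRel.map h (PowerSeries.mapAlgHom (PowerSeries.mapAlgHom φ))
  rw [inner_X, map_inner, mapAlgHom_X, mapAlgHom_X] at h1
  have e1 : (X.map (inner A)).map (PowerSeries.mapAlgHom (PowerSeries.mapAlgHom φ)) =
      (X.map (PowerSeries.mapAlgHom φ)).map (inner A') := by
    ext1 i j; simp [map_inner]
  have e2 : (X.map (outer A)).map (PowerSeries.mapAlgHom (PowerSeries.mapAlgHom φ)) =
      (X.map (PowerSeries.mapAlgHom φ)).map (outer A') := by
    ext1 i j; simp [map_outer]
  rw [e1, e2] at h1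
  exact h1

/-- `coeff m (X i j)` and `coeff n (Y k l)` commute in the graded sense. -/
def SuperCommute (θ₀ : ℤˣ) (X Y : Matrix (Idx M N) (Idx M N) (PowerSeries A)) : Prop :=
  ∀ i j k l m n, PowerSeries.coeff m (X i j) * PowerSeries.coeff n (Y k l) =
    sgn ((par θ₀ i + par θ₀ j) * (par θ₀ k + par θ₀ l)) •
      (PowerSeries.coeff n (Y k l) * PowerSeries.coeff m (X i j))

lemma SuperCommute.symm {X Y : Matrix (Idx M N) (Idx M N) (PowerSeries A)}
    (h : SuperCommute θ₀ X Y) : SuperCommute θ₀ Y X := by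
  intro k l i j n m
  rw [h, smul_smul, mul_comm (par θ₀ k + par θ₀ l), sgn_mul_self, one_smul]

lemma coeff_inner_mul_outer (f g : PowerSeries A) (r s : ℕ) :
    PowerSeries.coeff r (PowerSeries.coeff s (inner A f * outer A g)) =
      PowerSeries.coeff r f * PowerSeries.coeff s g := by
  simp [inner, outer, PowerSeries.mapAlgHom_apply]

lemma coeff_outer_mul_inner (f g : PowerSeries A) (r s : ℕ) :
    PowerSeries.coeff r (PowerSeries.coeff s (outer A g * inner A f)) =
      PowerSeries.coeff s g * PowerSeries.coeff r f := by
  simp [inner, outer, PowerSeries.mapAlgHom_apply]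

lemma leg₁_mul_leg₂_apply (X Y : Matrix (Idx M N) (Idx M N) A) (a b c d : Idx M N) :
    (leg₁ θ₀ X * leg₂ θ₀ Y) (a, b) (c, d) =
      sgn ((par θ₀ b + par θ₀ d) * par θ₀ c) • (X a c * Y b d) := by
  rw [leg₁_mul_apply, Finset.sum_eq_single c]
  · rw [leg₂_apply, if_pos rfl, mul_smul_comm]
  · intro e _ he; rw [leg₂_apply, if_neg he, mul_zero]
  · simp

lemma leg₂_mul_leg₁_apply (X Y : Matrix (Idx M N) (Idx M N) A) (a b c d : Idx M N) :
    (leg₂ θ₀ Y * leg₁ θ₀ X) (a, b) (c, d) =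
      sgn ((par θ₀ b + par θ₀ d) * par θ₀ a) • (Y b d * X a c) := by
  rw [mul_leg₁_apply, Finset.sum_eq_single a]
  · rw [leg₂_apply, if_pos rfl, smul_mul_assoc]
  · intro e _ he; rw [leg₂_apply, if_neg (Ne.symm he), zero_mul]
  · simp

/-- The sign from supercommuting the entries cancels the Koszul sign from exchanging the legs, so
the two leg matrices commute outright. -/
lemma SuperCommute.leg₁_mul_leg₂ {X Y : Matrix (Idx M N) (Idx M N) (PowerSeries A)}
    (h : SuperCommute θ₀ X Y) :
    leg₁ θ₀ (Y.map (inner A)) * leg₂ θ₀ (X.map (outer A)) =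
      leg₂ θ₀ (X.map (outer A)) * leg₁ θ₀ (Y.map (inner A)) := by
  ext ⟨a, b⟩ ⟨c, d⟩ s r
  rw [leg₁_mul_leg₂_apply, leg₂_mul_leg₁_apply]
  simp only [PowerSeries.coeff_smul, Matrix.map_apply, coeff_inner_mul_outer,
    coeff_outer_mul_inner, h b d a c, sgn_smul_sgn_smul]
  congr 2
  generalize par θ₀ a = a, par θ₀ b = b, par θ₀ c = c, par θ₀ d = d
  revert a b c d; decide

/-- The train argument: Y₁ and X₂ are interchanged, R passes through the X's and then through the
Y's, and X₁ and Y₂ are interchanged back. -/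
lemma SuperCommute.isRTT_mul {X Y : Matrix (Idx M N) (Idx M N) (PowerSeries A)}
    (h : SuperCommute θ₀ X Y) (hX : IsRTT θ₀ X) (hY : IsRTT θ₀ Y) : IsRTT θ₀ (X * Y) := by
  have h1 := h.leg₁_mul_leg₂
  have h2 := h.symm.leg₁_mul_leg₂
  unfold IsRTT RTTRel at *
  rw [Matrix.map_mul, Matrix.map_mul, leg₁_mul, leg₂_mul]
  generalize leg₁ θ₀ (X.map (inner A)) = x₁ at *
  generalize leg₁ θ₀ (Y.map (inner A)) = y₁ at *
  generalize leg₂ θ₀ (X.map (outer A)) = x₂ at *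
  generalize leg₂ θ₀ (Y.map (outer A)) = y₂ at *
  generalize Rpoly M N θ₀ (PowerSeries.C PowerSeries.X : PowerSeries (PowerSeries A))
      PowerSeries.X = R at *
  calc R * (x₁ * y₁) * (x₂ * y₂) = R * x₁ * (y₁ * x₂) * y₂ := by simp only [mul_assoc]
    _ = R * x₁ * x₂ * (y₁ * y₂) := by rw [h1]; simp only [mul_assoc]
    _ = x₂ * x₁ * (R * y₁ * y₂) := by rw [hX]; simp only [mul_assoc]
    _ = x₂ * (x₁ * y₂) * y₁ * R := by rw [hY]; simp only [mul_assoc]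
    _ = _ := by
      rw [h2]; simp only [mul_assoc]

lemma series_superCommute {f g : PowerSeries A} {ε : ℂ}
    (h : ∀ m n, PowerSeries.coeff m f * PowerSeries.coeff n g =
      ε • (PowerSeries.coeff n g * PowerSeries.coeff m f)) : f * g = ε • (g * f) := by
  ext n
  rw [PowerSeries.coeff_smul, PowerSeries.coeff_mul, PowerSeries.coeff_mul,
    ← Finset.Nat.sum_antidiagonal_swap, Finset.smul_sum]
  exact Finset.sum_congr rfl fun p _ => h _ _

/-- The transposition is an antihomomorphism in the graded sense. -/
lemma transp_mul {X Y : Matrix (Idx M N) (Idx M N) A}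
    (h : ∀ i j k l, X i j * Y k l =
      sgn ((par θ₀ i + par θ₀ j) * (par θ₀ k + par θ₀ l)) • (Y k l * X i j)) :
    transp θ₀ (X * Y) = transp θ₀ Y * transp θ₀ X := by
  ext i j
  simp only [transp, Matrix.of_apply, Matrix.mul_apply, Finset.smul_sum]
  rw [← (barEquiv M N).sum_comp]
  refine Finset.sum_congr rfl fun e _ => ?_
  simp only [barEquiv_apply, h, smul_mul_smul_comm, smul_smul, par_bar]
  congr 1
  have h1 : sgn (par θ₀ j * par θ₀ i + par θ₀ i) *
      sgn ((par θ₀ j + par θ₀ e) * (par θ₀ e + par θ₀ i)) =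
      sgn (par θ₀ e * par θ₀ i + par θ₀ i) * sgn (par θ₀ j * par θ₀ e + par θ₀ e) := by
    simp only [← sgn_add]; congr 1
    generalize par θ₀ i = a, par θ₀ j = b, par θ₀ e = c
    revert a b c; decide
  linear_combination theta (bar j) * theta (bar i) * h1 -
    theta (bar j) * theta (bar i) * sgn (par θ₀ e * par θ₀ i + par θ₀ i) *
      sgn (par θ₀ j * par θ₀ e + par θ₀ e) * theta_mul_self (bar e)

end Constructions

/-! ### The antipode as an action by signed right multiplications. -/

section Antipode

variable {M N : ℕ} {θ₀ : ℤˣ} {A A' : Type*} [Ring A] [Algebra ℂ A] [Ring A'] [Algebra ℂ A']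

/-- The powers of an involution indexed by `ZMod 2`. -/
def parityPow (g : A →ₐ[ℂ] A) (d : ZMod 2) : A →ₐ[ℂ] A := if d = 0 then AlgHom.id ℂ A else g

lemma parityPow_parityPow {g : A →ₐ[ℂ] A} (hg : ∀ x, g (g x) = x) (d e : ZMod 2) (x : A) :
    parityPow g d (parityPow g e x) = parityPow g (d + e) x := by
  have h : ∀ z : ZMod 2, z = 0 ∨ z = 1 := by decide
  rcases h d with rfl | rfl <;> rcases h e with rfl | rfl <;>
    simp [parityPow, CharTwo.add_self_eq_zero, hg]

lemma parityPow_of_smul {g : A →ₐ[ℂ] A} {x : A} {c : ZMod 2} (h : g x = sgn c • x) (d : ZMod 2) :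
    parityPow g d x = sgn (d * c) • x := by
  have h2 : ∀ z : ZMod 2, z = 0 ∨ z = 1 := by decide
  rcases h2 d with rfl | rfl <;> simp [parityPow, h]

/-- The operator `x ↦ g^d(x) y`. -/
def rightMul (g : A →ₐ[ℂ] A) (d : ZMod 2) : A →ₗ[ℂ] Module.End ℂ A :=
  LinearMap.mk₂ ℂ (fun y x => parityPow g d x * y) (fun _ _ _ => mul_add _ _ _)
    (fun _ _ _ => mul_smul_comm _ _ _) (fun _ _ _ => by rw [map_add, add_mul])
    (fun _ _ _ => by rw [map_smul, smul_mul_assoc])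

@[simp] lemma rightMul_apply (g : A →ₐ[ℂ] A) (d : ZMod 2) (y x : A) :
    rightMul g d y x = parityPow g d x * y := rfl

/-- Composition of right multiplications reverses products, and carrying the parity power past y
costs (-1)^(de). These operators thus model the graded opposite algebra. -/
lemma rightMul_mul_rightMul {g : A →ₐ[ℂ] A} (hg : ∀ x, g (g x) = x) {d e : ZMod 2} {x y : A}
    (hy : g y = sgn e • y) :
    rightMul g d x * rightMul g e y = sgn (d * e) • rightMul g (d + e) (y * x) := by
  ext v
  simp only [Module.End.mul_apply, rightMul_apply, map_mul, LinearMap.smul_apply,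
    parityPow_of_smul hy, parityPow_parityPow hg]
  simp [mul_assoc]

/-- A linear map applied to the coefficients of a series in two variables. -/
def mapCoeff₂ (Φ : A →ₗ[ℂ] A') (f : PowerSeries (PowerSeries A)) : PowerSeries (PowerSeries A') :=
  PowerSeries.mk fun s => PowerSeries.mk fun r => Φ (PowerSeries.coeff r (PowerSeries.coeff s f))

lemma coeff_coeff_mapCoeff₂ (Φ : A →ₗ[ℂ] A') (f : PowerSeries (PowerSeries A)) (r s : ℕ) :
    PowerSeries.coeff r (PowerSeries.coeff s (mapCoeff₂ Φ f)) =
      Φ (PowerSeries.coeff r (PowerSeries.coeff s f)) := by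
  simp [mapCoeff₂]

lemma mapCoeff₂_scalars_mul (Φ : A →ₗ[ℂ] A') (s : PowerSeries (PowerSeries ℂ))
    (f : PowerSeries (PowerSeries A)) :
    mapCoeff₂ Φ (scalars A s * f) = scalars A' s * mapCoeff₂ Φ f := by
  ext m n
  rw [coeff_coeff_mapCoeff₂]
  simp only [PowerSeries.coeff_mul, map_sum, coeff_coeff_mapCoeff₂]
  refine Finset.sum_congr rfl fun p _ => Finset.sum_congr rfl fun q _ => ?_
  simp [scalars, PowerSeries.mapAlgHom_apply, ← Algebra.smul_def]

lemma mapCoeff₂_sum (Φ : A →ₗ[ℂ] A') {ι : Type*} (t : Finset ι)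
    (f : ι → PowerSeries (PowerSeries A)) :
    mapCoeff₂ Φ (∑ i ∈ t, f i) = ∑ i ∈ t, mapCoeff₂ Φ (f i) := by
  ext m n
  simp [coeff_coeff_mapCoeff₂]

lemma scalars_Rpoly : (Rpoly M N θ₀ (PowerSeries.C PowerSeries.X) PowerSeries.X).map (scalars A) =
    Rpoly M N θ₀ (PowerSeries.C PowerSeries.X) PowerSeries.X := by
  have ez : scalars A (inner ℂ PowerSeries.X) = PowerSeries.C PowerSeries.X := by
    rw [scalars_inner, PowerSeries.map_X]; rfl
  have ew : scalars A (outer ℂ PowerSeries.X) = PowerSeries.X := by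
    rw [scalars_outer, PowerSeries.map_X, outer_X]
  rw [Rpoly_map, inner_X, ez, ← ew, outer_X]

/-- The solution of the RTT relation that yields the antipode. -/
def antipodeMatrix (θ₀ : ℤˣ) (g : A →ₐ[ℂ] A) (Y : Matrix (Idx M N) (Idx M N) (PowerSeries A)) :
    Matrix (Idx M N) (Idx M N) (PowerSeries (Module.End ℂ A)) :=
  Matrix.of fun i j => mapCoeff (rightMul g (par θ₀ i + par θ₀ j)) (Y i j)

lemma coeff_antipodeMatrix (g : A →ₐ[ℂ] A) (Y : Matrix (Idx M N) (Idx M N) (PowerSeries A))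
    (i j : Idx M N) (n : ℕ) :
    PowerSeries.coeff n (antipodeMatrix θ₀ g Y i j) =
      rightMul g (par θ₀ i + par θ₀ j) (PowerSeries.coeff n (Y i j)) := by
  simp [antipodeMatrix, mapCoeff]

/-- Inverting RTT gives R Y₂Y₁ = Y₁Y₂ R, with the legs in the wrong order. Passing to right
multiplications reverses the products, and the signs of `rightMul_mul_rightMul` fit those of the
legs, so the standard relation reappears. -/
lemma IsRTT.isRTT_antipodeMatrix {X Y : Matrix (Idx M N) (Idx M N) (PowerSeries A)}
    (h : IsRTT θ₀ X) (hXY : X * Y = 1) (hYX : Y * X = 1) {g : A →ₐ[ℂ] A}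
    (hg : ∀ x, g (g x) = x)
    (hY : ∀ i j n, g (PowerSeries.coeff n (Y i j)) =
      sgn (par θ₀ i + par θ₀ j) • PowerSeries.coeff n (Y i j)) :
    IsRTT θ₀ (antipodeMatrix θ₀ g Y) := by
  have h0 : Rpoly M N θ₀ (PowerSeries.C PowerSeries.X) PowerSeries.X *
      (leg₂ θ₀ (Y.map (outer A)) * leg₁ θ₀ (Y.map (inner A))) =
      (leg₁ θ₀ (Y.map (inner A)) * leg₂ θ₀ (Y.map (outer A))) *
        Rpoly M N θ₀ (PowerSeries.C PowerSeries.X) PowerSeries.X := by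
    have e1 : leg₁ θ₀ (X.map (inner A)) * leg₁ θ₀ (Y.map (inner A)) = 1 := by
      rw [← leg₁_mul, ← Matrix.map_mul, hXY, Matrix.map_one _ (map_zero _) (map_one _), leg₁_one]
    have e2 : leg₁ θ₀ (Y.map (inner A)) * leg₁ θ₀ (X.map (inner A)) = 1 := by
      rw [← leg₁_mul, ← Matrix.map_mul, hYX, Matrix.map_one _ (map_zero _) (map_one _), leg₁_one]
    have e3 : leg₂ θ₀ (X.map (outer A)) * leg₂ θ₀ (Y.map (outer A)) = 1 := by
      rw [← leg₂_mul, ← Matrix.map_mul, hXY, Matrix.map_one _ (map_zero _) (map_one _), leg₂_one]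
    have e4 : leg₂ θ₀ (Y.map (outer A)) * leg₂ θ₀ (X.map (outer A)) = 1 := by
      rw [← leg₂_mul, ← Matrix.map_mul, hYX, Matrix.map_one _ (map_zero _) (map_one _), leg₂_one]
    unfold IsRTT RTTRel at h
    generalize leg₁ θ₀ (X.map (inner A)) = x₁ at *
    generalize leg₁ θ₀ (Y.map (inner A)) = y₁ at *
    generalize leg₂ θ₀ (X.map (outer A)) = x₂ at *
    generalize leg₂ θ₀ (Y.map (outer A)) = y₂ at *
    generalize Rpoly M N θ₀ (PowerSeries.C PowerSeries.X : PowerSeries (PowerSeries A))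
      PowerSeries.X = R at *
    calc R * (y₂ * y₁) = y₁ * (y₂ * x₂) * x₁ * R * y₂ * y₁ := by
          rw [e4, mul_one, e2, one_mul, mul_assoc]
      _ = y₁ * y₂ * (x₂ * x₁ * R) * y₂ * y₁ := by simp only [mul_assoc]
      _ = y₁ * y₂ * R * (x₁ * (x₂ * y₂) * y₁) := by rw [← h]; simp only [mul_assoc]
      _ = _ := by rw [e3, mul_one, e1, mul_one]
  have hR : ∀ (a b c d : Idx M N), par θ₀ a + par θ₀ b ≠ par θ₀ c + par θ₀ d →
      Rpoly M N θ₀ (PowerSeries.C PowerSeries.X) PowerSeries.X (a, b) (c, d) =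
        (0 : PowerSeries (PowerSeries ℂ)) := fun a b c d => isEven_Rpoly _ _ a b c d
  have e1 : ∀ a b c d, (leg₁ θ₀ ((antipodeMatrix θ₀ g Y).map (inner _)) *
      leg₂ θ₀ ((antipodeMatrix θ₀ g Y).map (outer _))) (a, b) (c, d) =
      mapCoeff₂ (rightMul g (par θ₀ a + par θ₀ b + (par θ₀ c + par θ₀ d)))
        ((leg₂ θ₀ (Y.map (outer A)) * leg₁ θ₀ (Y.map (inner A))) (a, b) (c, d)) := by
    intro a b c d
    ext s r : 2
    rw [leg₁_mul_leg₂_apply, leg₂_mul_leg₁_apply]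
    simp only [coeff_coeff_mapCoeff₂, PowerSeries.coeff_smul, Matrix.map_apply,
      coeff_inner_mul_outer, coeff_outer_mul_inner, coeff_antipodeMatrix,
      rightMul_mul_rightMul hg (hY _ _ _), map_smul]
    refine (sgn_smul_sgn_smul (B := Module.End ℂ A) _ _ _).trans ?_
    congr 2
    · generalize par θ₀ a = a, par θ₀ b = b, par θ₀ c = c, par θ₀ d = d
      revert a b c d; decide
    · congr 1; ring
  have e2 : ∀ a b c d, (leg₂ θ₀ ((antipodeMatrix θ₀ g Y).map (outer _)) *
      leg₁ θ₀ ((antipodeMatrix θ₀ g Y).map (inner _))) (a, b) (c, d) =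
      mapCoeff₂ (rightMul g (par θ₀ a + par θ₀ b + (par θ₀ c + par θ₀ d)))
        ((leg₁ θ₀ (Y.map (inner A)) * leg₂ θ₀ (Y.map (outer A))) (a, b) (c, d)) := by
    intro a b c d
    ext s r : 2
    rw [leg₁_mul_leg₂_apply, leg₂_mul_leg₁_apply]
    simp only [coeff_coeff_mapCoeff₂, PowerSeries.coeff_smul, Matrix.map_apply,
      coeff_inner_mul_outer, coeff_outer_mul_inner, coeff_antipodeMatrix,
      rightMul_mul_rightMul hg (hY _ _ _), map_smul]
    refine (sgn_smul_sgn_smul (B := Module.End ℂ A) _ _ _).trans ?_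
    congr 2
    · generalize par θ₀ a = a, par θ₀ b = b, par θ₀ c = c, par θ₀ d = d
      revert a b c d; decide
    · congr 1; ring
  unfold IsRTT RTTRel
  rw [mul_assoc, ← scalars_Rpoly]
  rw [← scalars_Rpoly] at h0
  ext1 ⟨a, b⟩ ⟨c, d⟩
  have h1 := congrArg (mapCoeff₂ (rightMul g (par θ₀ a + par θ₀ b + (par θ₀ c + par θ₀ d))))
    (congrFun (congrFun h0 (a, b)) (c, d))
  rw [Matrix.mul_apply, Matrix.mul_apply, mapCoeff₂_sum, mapCoeff₂_sum] at h1
  rw [Matrix.mul_apply, Matrix.mul_apply]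
  convert h1 using 1
  · refine Finset.sum_congr rfl fun e _ => ?_
    obtain ⟨e, f⟩ := e
    rw [Matrix.map_apply, Matrix.map_apply, mapCoeff₂_scalars_mul, e1]
    -- The operator in `e1` depends on the parities of the summation indices, but R is even, so all
    -- nonzero terms involve the same `rightMul` and one linear map is applied to the whole
    -- identity.
    by_cases hp : par θ₀ a + par θ₀ b = par θ₀ e + par θ₀ f
    · rw [hp]
    · rw [hR a b e f hp, map_zero, zero_mul, zero_mul]
  · refine Finset.sum_congr rfl fun e _ => ?_
    obtain ⟨e, f⟩ := e
    rw [Matrix.map_apply, Matrix.map_apply, ← (commute_scalars _ _).eq, ← (commute_scalars _ _).eq,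
      mapCoeff₂_scalars_mul, e2]
    by_cases hp : par θ₀ e + par θ₀ f = par θ₀ c + par θ₀ d
    · rw [hp]
    · rw [hR e f c d hp, map_zero, zero_mul, zero_mul]

end Antipode

/-! ### The algebra `U(R)` -/

section Universal

variable {M N : ℕ} {θ₀ : ℤˣ} {A : Type*} [Ring A] [Algebra ℂ A]

lemma coeff_freeT (i j : Idx M N) (n : ℕ) :
    PowerSeries.coeff n (freeT M N i j) = FreeAlgebra.ι ℂ (i, j, n) := by
  simp [freeT]

/-- The bridge between the coefficientwise relations `Rel.rtt` and the matrix form. One direction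
shows that T solves RTT, the other that a solution yields a homomorphism. -/
lemma isRTT_freeT_map (f : Free M N →ₐ[ℂ] A) :
    IsRTT θ₀ ((freeT M N).map (PowerSeries.mapAlgHom f)) ↔
      ∀ (p q : Idx M N × Idx M N) (r s : ℕ),
        f (PowerSeries.coeff r (PowerSeries.coeff s
          ((freeR M N θ₀ * freeT₁ M N θ₀ * freeT₂ M N θ₀) p q))) =
        f (PowerSeries.coeff r (PowerSeries.coeff s
          ((freeT₂ M N θ₀ * freeT₁ M N θ₀ * freeR M N θ₀) p q))) := by
  set φ := PowerSeries.mapAlgHom (PowerSeries.mapAlgHom f) with hφ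
  have h1 : (freeT₁ M N θ₀).map φ =
      leg₁ θ₀ (((freeT M N).map (PowerSeries.mapAlgHom f)).map (inner A)) := by
    rw [show freeT₁ M N θ₀ = leg₁ θ₀ ((freeT M N).map (inner _)) from rfl, leg₁_map]
    congr 1; ext1 i j; simp [hφ, map_inner]
  have h2 : (freeT₂ M N θ₀).map φ =
      leg₂ θ₀ (((freeT M N).map (PowerSeries.mapAlgHom f)).map (outer A)) := by
    have : freeT₂ M N θ₀ = leg₂ θ₀ ((freeT M N).map (outer _)) := by
      rw [freeT₂, leg₂]; congr 1
    rw [this, leg₂_map]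
    congr 1; ext1 i j; simp [hφ, map_outer]
  have h3 : (freeR M N θ₀).map φ = Rpoly M N θ₀ (PowerSeries.C PowerSeries.X) PowerSeries.X := by
    rw [freeR, Rpoly_map, inner_X, hφ, map_inner, mapAlgHom_X, mapAlgHom_X]; rfl
  have key : ∀ (x : PowerSeries (PowerSeries (Free M N))) (r s : ℕ),
      PowerSeries.coeff r (PowerSeries.coeff s (φ x)) =
        f (PowerSeries.coeff r (PowerSeries.coeff s x)) := by
    intro x r s
    simp [hφ, PowerSeries.mapAlgHom_apply]
  unfold IsRTT RTTRel
  rw [← h1, ← h2, ← h3, ← Matrix.map_mul, ← Matrix.map_mul, ← Matrix.map_mul, ← Matrix.map_mul]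
  constructor
  · intro h p q r s
    rw [← key, ← key]
    exact congrArg (fun x => PowerSeries.coeff r (PowerSeries.coeff s x))
      (congrFun (congrFun h p) q)
  · intro h
    ext p q s r
    rw [Matrix.map_apply, Matrix.map_apply, key, key, h]

lemma coeff_T (i j : Idx M N) (n : ℕ) :
    PowerSeries.coeff n (T M N θ₀ i j) = gen θ₀ i j n := by
  simp [T]

lemma isRTT_T : IsRTT θ₀ (T M N θ₀) := by
  have h : T M N θ₀ =
      (freeT M N).map (PowerSeries.mapAlgHom (RingQuot.mkAlgHom ℂ (Rel M N θ₀))) := by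
    ext i j n
    rw [coeff_T, Matrix.map_apply, PowerSeries.mapAlgHom_apply, PowerSeries.coeff_map,
      coeff_freeT]
    rfl
  rw [h, isRTT_freeT_map]
  exact fun p q r s => RingQuot.mkAlgHom_rel ℂ (Rel.rtt p q r s)

lemma gen_zero (i j : Idx M N) : gen θ₀ i j 0 = if i = j then 1 else 0 := by
  rw [gen, RingQuot.mkAlgHom_rel ℂ (Rel.zero i j)]
  split_ifs <;> simp

/-- The universal property of `U(R)`. -/
def lift (X : Matrix (Idx M N) (Idx M N) (PowerSeries A)) (hX : IsRTT θ₀ X)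
    (h0 : ∀ i j, PowerSeries.coeff 0 (X i j) = if i = j then 1 else 0) : U M N θ₀ →ₐ[ℂ] A :=
  RingQuot.liftAlgHom ℂ
    ⟨FreeAlgebra.lift ℂ fun t => PowerSeries.coeff t.2.2 (X t.1 t.2.1), by
      have h : (freeT M N).map (PowerSeries.mapAlgHom
          (FreeAlgebra.lift ℂ fun t => PowerSeries.coeff t.2.2 (X t.1 t.2.1))) = X := by
        ext i j n
        rw [Matrix.map_apply, PowerSeries.mapAlgHom_apply, PowerSeries.coeff_map, coeff_freeT]
        exact FreeAlgebra.lift_ι_apply _ _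
      intro x y hxy
      cases hxy with
      | zero i j =>
        rw [FreeAlgebra.lift_ι_apply, h0]
        split_ifs <;> simp
      | rtt p q r s =>
        rw [← h, isRTT_freeT_map] at hX
        exact hX p q r s⟩

@[simp] lemma lift_gen (X : Matrix (Idx M N) (Idx M N) (PowerSeries A)) (hX : IsRTT θ₀ X)
    (h0 : ∀ i j, PowerSeries.coeff 0 (X i j) = if i = j then 1 else 0) (i j : Idx M N) (n : ℕ) :
    lift X hX h0 (gen θ₀ i j n) = PowerSeries.coeff n (X i j) := by
  rw [lift, gen, RingQuot.liftAlgHom_mkAlgHom_apply, FreeAlgebra.lift_ι_apply]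

lemma T_map_eq {f : U M N θ₀ →ₐ[ℂ] A} {X : Matrix (Idx M N) (Idx M N) (PowerSeries A)}
    (h : ∀ i j n, f (gen θ₀ i j n) = PowerSeries.coeff n (X i j)) :
    (T M N θ₀).map (PowerSeries.mapAlgHom f) = X := by
  ext i j n
  rw [Matrix.map_apply, PowerSeries.mapAlgHom_apply, PowerSeries.coeff_map, coeff_T]
  exact h i j n

/-- A subspace that contains `1` and is stable under left multiplication by the generators is
everything. -/
lemma gen_induction {p : U M N θ₀ → Prop} (one : p 1)
    (add : ∀ x y, p x → p y → p (x + y)) (smul : ∀ (r : ℂ) x, p x → p (r • x))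
    (mul : ∀ i j n x, p x → p (gen θ₀ i j n * x)) (x : U M N θ₀) : p x := by
  suffices h : ∀ y : Free M N, ∀ x, p x → p (RingQuot.mkAlgHom ℂ (Rel M N θ₀) y * x) by
    obtain ⟨y, rfl⟩ := RingQuot.mkAlgHom_surjective ℂ (Rel M N θ₀) x
    simpa using h y 1 one
  intro y
  induction y using FreeAlgebra.induction with
  | grade0 r =>
    intro x hx
    rw [AlgHom.commutes, ← Algebra.smul_def]
    exact smul r x hx
  | grade1 t => exact fun x hx => mul t.1 t.2.1 t.2.2 x hx
  | mul a b ha hb => exact fun x hx => by rw [map_mul, mul_assoc]; exact ha _ (hb _ hx)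
  | add a b ha hb => exact fun x hx => by rw [map_add, add_mul]; exact add _ _ (ha _ hx) (hb _ hx)

lemma algHom_ext {f g : U M N θ₀ →ₐ[ℂ] A}
    (h : ∀ i j n, f (gen θ₀ i j n) = g (gen θ₀ i j n)) (x : U M N θ₀) : f x = g x := by
  refine gen_induction (p := fun x => f x = g x) (by simp) (fun x y hx hy => by rw [map_add, map_add, hx, hy])
    (fun r x hx => by rw [map_smul, map_smul, hx]) (fun i j n x hx => ?_) x
  rw [map_mul, map_mul, h, hx]

/-! ### The central series -/

/-- The constant term is 1 because T(u) begins with the identity and a shift does not alter constant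
terms. When M = N = 0 the matrix identities are void and do not determine c; the last clause fixes c
= 1 there. -/
lemma exists_central (hN : Even N) : ∃ c : PowerSeries (U M N θ₀),
    C M N θ₀ = Matrix.diagonal (fun _ => c) ∧
    T M N θ₀ * (transp θ₀ (T M N θ₀)).map (shift (kappa M N θ₀)) = Matrix.diagonal (fun _ => c) ∧
    (∀ n x, Commute (PowerSeries.coeff n c) x) ∧ PowerSeries.coeff 0 c = 1 ∧
    (IsEmpty (Idx M N) → c = 1) := by
  rcases isEmpty_or_nonempty (Idx M N) with hE | ⟨⟨i₀⟩⟩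
  · refine ⟨1, Matrix.ext fun i => hE.elim i, Matrix.ext fun i => hE.elim i, fun n x => ?_, ?_,
      fun _ => rfl⟩
    · rw [PowerSeries.coeff_one]; split_ifs
      exacts [Commute.one_left x, Commute.zero_left x]
    · simp
  · obtain ⟨c, h1, h2⟩ := (isRTT_T (M := M) (N := N) (θ₀ := θ₀)).exists_scalar hN
    refine ⟨c, h1, h2, fun n x => ?_, ?_, fun hE => hE.elim i₀⟩
    · refine gen_induction (p := fun x => Commute (PowerSeries.coeff n c) x)
        (Commute.one_right _) (fun x y hx hy => hx.add_right hy) (fun r x hx => hx.smul_right r)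
        (fun i j m x hx => Commute.mul_right ?_ hx) x
      rw [← coeff_T]
      exact (isRTT_T.coeff_commute_scalar hN h2 i j m n).symm
    · have hm : ∀ f g : PowerSeries (U M N θ₀), PowerSeries.coeff 0 (f * g) =
          PowerSeries.coeff 0 f * PowerSeries.coeff 0 g := fun f g => by simp
      have h3 := congrArg (PowerSeries.coeff 0) (congrFun (congrFun h1 i₀) i₀)
      rw [Matrix.diagonal_apply_eq, Matrix.mul_apply, map_sum] at h3
      rw [← h3, Finset.sum_eq_single i₀]
      · rw [hm]
        simp only [Matrix.map_apply, constantCoeff_shift, transp, Matrix.of_apply,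
          PowerSeries.coeff_smul, coeff_T, gen_zero]
        have : par θ₀ i₀ * par θ₀ i₀ + par θ₀ i₀ = 0 := by
          generalize par θ₀ i₀ = b; revert b; decide
        simp [this, theta_mul_self]
      · intro j _ hj
        rw [hm]
        simp [coeff_T, gen_zero, hj]
      · simp

lemma exists_inverse {A : Type*} [Ring A] (c : PowerSeries A) (h : PowerSeries.coeff 0 c = 1) :
    ∃ d, c * d = 1 ∧ d * c = 1 := by
  have h1 : PowerSeries.constantCoeff c = ((1 : Aˣ) : A) := by simpa using h
  exact ⟨PowerSeries.invOfUnit c 1, PowerSeries.mul_invOfUnit c 1 h1,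
    PowerSeries.invOfUnit_mul c 1 h1⟩

end Universal

/-! ### Superalgebras given by a parity automorphism -/

/-- An involutive automorphism; its eigenspaces form a `ZMod 2`-grading. -/
structure Parity (A : Type*) [Ring A] [Algebra ℂ A] where
  /-- The automorphism. -/
  hom : A →ₐ[ℂ] A
  hom_hom : ∀ x, hom (hom x) = x

namespace Parity

variable {A : Type*} [Ring A] [Algebra ℂ A] (p : Parity A)

/-- The eigenspace of the parity automorphism for `(-1)^d`. -/
def grading (d : ZMod 2) : Submodule ℂ A where
  carrier := {a | p.hom a = sgn d • a}
  add_mem' := fun {a b} ha hb => by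
    change p.hom (a + b) = sgn d • (a + b)
    rw [map_add, smul_add]; exact congrArg₂ _ ha hb
  zero_mem' := by simp
  smul_mem' := fun r a ha => by
    change p.hom (r • a) = sgn d • r • a
    rw [map_smul, smul_comm]; exact congrArg _ ha

variable {p} in
lemma mem_grading {d : ZMod 2} {a : A} : a ∈ p.grading d ↔ p.hom a = sgn d • a := Iff.rfl

/-- The projection to the part of degree `d`. -/
def proj (d : ZMod 2) : A →ₗ[ℂ] A := (1 / 2 : ℂ) • (LinearMap.id + sgn d • p.hom.toLinearMap)

lemma proj_apply (d : ZMod 2) (a : A) : p.proj d a = (1 / 2 : ℂ) • (a + sgn d • p.hom a) := rfl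

lemma proj_mem (d : ZMod 2) (a : A) : p.proj d a ∈ p.grading d := by
  rw [mem_grading, proj_apply, map_smul, map_add, map_smul, p.hom_hom,
    smul_comm (sgn d) (1 / 2 : ℂ) (_ + _), smul_add (sgn d), smul_smul (sgn d) (sgn d),
    sgn_mul_self, one_smul, add_comm]

lemma sgn_one : sgn 1 = -1 := by simp [sgn]

lemma proj_zero_add_proj_one (a : A) : p.proj 0 a + p.proj 1 a = a := by
  rw [proj_apply, proj_apply, sgn_one, sgn_zero]
  module

lemma proj_of_mem {d : ZMod 2} {a : A} (h : a ∈ p.grading d) : p.proj d a = a := by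
  rw [proj_apply, mem_grading.mp h, smul_smul, sgn_mul_self]
  module

lemma proj_of_mem_add_one {d : ZMod 2} {a : A} (h : a ∈ p.grading d) : p.proj (d + 1) a = 0 := by
  rw [proj_apply, mem_grading.mp h, smul_smul, sgn_add, mul_right_comm, sgn_mul_self, sgn_one]
  module

instance : GradedAlgebra p.grading where
  one_mem := by simp [mem_grading]
  mul_mem := fun {i j a b} ha hb => by
    rw [mem_grading] at *
    rw [map_mul, ha, hb, smul_mul_smul_comm, sgn_add]
  toDecomposition := DirectSum.Decomposition.ofLinearMap p.grading
    ((DirectSum.lof ℂ (ZMod 2) (fun d => p.grading d) 0).comp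
        ((p.proj 0).codRestrict (p.grading 0) (p.proj_mem 0)) +
      (DirectSum.lof ℂ (ZMod 2) (fun d => p.grading d) 1).comp
        ((p.proj 1).codRestrict (p.grading 1) (p.proj_mem 1)))
    (by
      ext a
      simp [proj_zero_add_proj_one])
    (by
      ext d ⟨a, ha⟩ : 2
      have h : ∀ z : ZMod 2, z = 0 ∨ z = 1 := by decide
      have h0 : ∀ e (h : p.proj e a = 0),
          (p.proj e).codRestrict (p.grading e) (p.proj_mem e) a = 0 := fun e h => Subtype.ext h
      have h1 : ∀ e (h : a ∈ p.grading e),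
          (p.proj e).codRestrict (p.grading e) (p.proj_mem e) a = ⟨a, h⟩ := fun e h =>
        Subtype.ext (p.proj_of_mem h)
      rcases h d with rfl | rfl
      · have e1 := h0 1 (by simpa using p.proj_of_mem_add_one ha)
        simp [h1 0 ha, e1]
      · have e1 := h0 0 (by simpa [CharTwo.add_self_eq_zero] using p.proj_of_mem_add_one ha)
        simp [h1 1 ha, e1])

/-- Left multiplication by `x`, after a power of the parity automorphism. -/
def mulPow (x : A) (e : ZMod 2) : A →ₗ[ℂ] A :=
  LinearMap.mulLeft ℂ x ∘ₗ (parityPow p.hom e).toLinearMap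

@[simp] lemma mulPow_apply (x : A) (e : ZMod 2) (c : A) :
    p.mulPow x e c = x * parityPow p.hom e c := rfl

/-- The graded product by an elementary tensor with homogeneous second factor. -/
lemma of_tmul_mul (a c d : A) {b : A} {e : ZMod 2} (hb : p.hom b = sgn e • b) :
    GradedTensorProduct.of ℂ p.grading p.grading (a ⊗ₜ b) *
      GradedTensorProduct.of ℂ p.grading p.grading (c ⊗ₜ d) =
    GradedTensorProduct.of ℂ p.grading p.grading ((a * parityPow p.hom e c) ⊗ₜ (b * d)) := by
  have key : ∀ (i : ZMod 2) (c : A), c ∈ p.grading i →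
      GradedTensorProduct.of ℂ p.grading p.grading (a ⊗ₜ b) *
        GradedTensorProduct.of ℂ p.grading p.grading (c ⊗ₜ d) =
      GradedTensorProduct.of ℂ p.grading p.grading ((a * parityPow p.hom e c) ⊗ₜ (b * d)) := by
    intro i c hc
    refine (GradedTensorProduct.tmul_coe_mul_coe_tmul p.grading p.grading a ⟨b, hb⟩ ⟨c, hc⟩
      d).trans ?_
    have hs : ∀ (i j : ZMod 2) (x : p.grading ᵍ⊗[ℂ] p.grading),
        ((-1 : ℤˣ) ^ (i * j)) • x = sgn (i * j) • x := by
      intro i j x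
      have h : ∀ z : ZMod 2, z = 0 ∨ z = 1 := by decide
      rcases h (i * j) with h | h <;> rw [h]
      · simp
      · rw [uzpow_one, sgn_one, Units.neg_smul, one_smul, neg_smul, one_smul]
    rw [hs, parityPow_of_smul (mem_grading.mp hc), mul_smul_comm, ← TensorProduct.smul_tmul',
      map_smul]
  -- The product rule is available for homogeneous inner factors; splitting c into even and odd
  -- parts removes that restriction.
  rw [← p.proj_zero_add_proj_one c, map_add, mul_add, TensorProduct.add_tmul,
    TensorProduct.add_tmul, map_add, map_add, mul_add, key 0 _ (p.proj_mem 0 c),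
    key 1 _ (p.proj_mem 1 c)]

lemma of_tmul_mul_of (a : A) {b : A} {e : ZMod 2} (hb : p.hom b = sgn e • b) (t : A ⊗[ℂ] A) :
    GradedTensorProduct.of ℂ p.grading p.grading (a ⊗ₜ b) *
      GradedTensorProduct.of ℂ p.grading p.grading t =
    GradedTensorProduct.of ℂ p.grading p.grading
      (TensorProduct.map (p.mulPow a e) (LinearMap.mulLeft ℂ b) t) := by
  induction t with
  | zero => simp
  | add x y hx hy => rw [map_add, mul_add, hx, hy, map_add, map_add]
  | tmul c d => rw [of_tmul_mul p a c d hb]; rfl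

/-- The average (x + (-1)^d (g ⊗ g) x) / 2, for the parity automorphism g, projects onto total
degree d: on a ⊗ b it yields the sum of the products of components of degrees i and d - i. A vector
with the given eigenvalue is its own average. -/
lemma mem_iSup_of_map_eq {d : ZMod 2} {x : A ⊗[ℂ] A}
    (hx : TensorProduct.map p.hom.toLinearMap p.hom.toLinearMap x = sgn d • x) :
    x ∈ ⨆ i : ZMod 2, LinearMap.range
      (TensorProduct.map (p.grading i).subtype (p.grading (d - i)).subtype) := by
  have key : ∀ x : A ⊗[ℂ] A,
      (1 / 2 : ℂ) • (x + sgn d • TensorProduct.map p.hom.toLinearMap p.hom.toLinearMap x) ∈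
      ⨆ i : ZMod 2, LinearMap.range
        (TensorProduct.map (p.grading i).subtype (p.grading (d - i)).subtype) := by
    intro x
    induction x with
    | zero => simp
    | add x y hx hy =>
      convert Submodule.add_mem _ hx hy using 1
      rw [map_add]; module
    | tmul a b =>
      have h1 : ∀ i : ZMod 2, p.proj i a ⊗ₜ[ℂ] p.proj (d - i) b ∈
          ⨆ i : ZMod 2, LinearMap.range
            (TensorProduct.map (p.grading i).subtype (p.grading (d - i)).subtype) := fun i =>
        Submodule.mem_iSup_of_mem i
          ⟨⟨p.proj i a, p.proj_mem i a⟩ ⊗ₜ ⟨p.proj (d - i) b, p.proj_mem (d - i) b⟩, rfl⟩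
      convert Submodule.add_mem _ (h1 0) (h1 1) using 1
      have h2 : sgn (d - 1) = - sgn d := by
        rw [show d - 1 = d + 1 by generalize d = d; revert d; decide, sgn_add, sgn_one, mul_neg_one]
      rw [sub_zero]
      simp only [proj_apply, h2, sgn_zero, sgn_one, TensorProduct.map_tmul,
        AlgHom.toLinearMap_apply, TensorProduct.add_tmul, TensorProduct.tmul_add,
        ← TensorProduct.smul_tmul', TensorProduct.tmul_smul]
      module
  have h2 := key x
  rw [hx, smul_smul, sgn_mul_self, one_smul, ← two_smul ℂ x, smul_smul] at h2
  simpa using h2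

/-- A Hopf superalgebra structure whose grading is given by a parity automorphism. -/
structure HopfData where
  /-- The coproduct. -/
  comul : A →ₗ[ℂ] A ⊗[ℂ] A
  /-- The counit. -/
  counit : A →ₐ[ℂ] ℂ
  /-- The antipode. -/
  antipode : A →ₗ[ℂ] A
  coassoc : ∀ a, TensorProduct.assoc ℂ A A A (comul.rTensor A (comul a)) = comul.lTensor A (comul a)
  counit_left : ∀ a, counit.toLinearMap.rTensor A (comul a) = 1 ⊗ₜ a
  counit_right : ∀ a, counit.toLinearMap.lTensor A (comul a) = a ⊗ₜ 1
  comul_one : comul 1 = 1 ⊗ₜ 1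
  comul_mul : ∀ a b, GradedTensorProduct.of ℂ p.grading p.grading (comul (a * b)) =
    GradedTensorProduct.of ℂ p.grading p.grading (comul a) *
      GradedTensorProduct.of ℂ p.grading p.grading (comul b)
  comul_hom : ∀ a, comul (p.hom a) =
    TensorProduct.map p.hom.toLinearMap p.hom.toLinearMap (comul a)
  counit_hom : ∀ a, counit (p.hom a) = counit a
  antipode_hom : ∀ a, antipode (p.hom a) = p.hom (antipode a)
  antipode_left : ∀ a,
    LinearMap.mul' ℂ A (antipode.rTensor A (comul a)) = algebraMap ℂ A (counit a)
  antipode_right : ∀ a,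
    LinearMap.mul' ℂ A (antipode.lTensor A (comul a)) = algebraMap ℂ A (counit a)

/-- The Hopf superalgebra given by `HopfData`. -/
def HopfData.hopf {p : Parity A} (h : p.HopfData) : HopfSuperalgebra ℂ A where
  comul := h.comul
  counit := h.counit.toLinearMap
  coassoc := LinearMap.ext h.coassoc
  rTensor_counit_comp_comul := LinearMap.ext h.counit_left
  lTensor_counit_comp_comul := LinearMap.ext h.counit_right
  grading := p.grading
  comul_one := h.comul_one
  comul_mul := h.comul_mul
  comul_even d a ha := p.mem_iSup_of_map_eq (by
    rw [← h.comul_hom, mem_grading.mp ha, map_smul])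
  counit_one := map_one h.counit
  counit_mul := map_mul h.counit
  counit_odd a ha := by
    have h1 := h.counit_hom a
    rw [mem_grading.mp ha, sgn_one, map_smul, smul_eq_mul] at h1
    change h.counit a = 0
    linear_combination (-1 / 2 : ℂ) * h1
  antipode := h.antipode
  antipode_even d a ha := by rw [mem_grading, ← h.antipode_hom, mem_grading.mp ha, map_smul]
  mul_antipode_rTensor_comul := LinearMap.ext h.antipode_left
  mul_antipode_lTensor_comul := LinearMap.ext h.antipode_right

end Parity

/-! ### The parity of `U(R)` -/

section Twist

variable {M N : ℕ} (θ₀ : ℤˣ) {A : Type*} [Ring A] [Algebra ℂ A]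

/-- Conjugation by the diagonal matrix of the signs `(-1)^[i]`. -/
def twist (X : Matrix (Idx M N) (Idx M N) A) : Matrix (Idx M N) (Idx M N) A :=
  Matrix.of fun i j => sgn (par θ₀ i + par θ₀ j) • X i j

/-- Conjugation by the diagonal matrix of the signs `(-1)^([a] + [b])`. -/
def twist₂ (Z : Matrix (Idx M N × Idx M N) (Idx M N × Idx M N) A) :
    Matrix (Idx M N × Idx M N) (Idx M N × Idx M N) A :=
  Matrix.of fun x y => sgn (par θ₀ x.1 + par θ₀ x.2 + (par θ₀ y.1 + par θ₀ y.2)) • Z x y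

variable {θ₀}

lemma twist_apply (X : Matrix (Idx M N) (Idx M N) A) (i j : Idx M N) :
    twist θ₀ X i j = sgn (par θ₀ i + par θ₀ j) • X i j := rfl

lemma twist_mul (X Y : Matrix (Idx M N) (Idx M N) A) :
    twist θ₀ (X * Y) = twist θ₀ X * twist θ₀ Y := by
  ext i j
  simp only [twist_apply, Matrix.mul_apply, Finset.smul_sum, smul_mul_smul_comm, ← sgn_add]
  refine Finset.sum_congr rfl fun k _ => ?_
  congr 2
  generalize par θ₀ i = a, par θ₀ j = b, par θ₀ k = c
  revert a b c; decide

lemma twist_diagonal (γ : A) :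
    twist θ₀ (Matrix.diagonal fun _ : Idx M N => γ) = Matrix.diagonal fun _ => γ := by
  ext i j
  rw [twist_apply]
  by_cases h : i = j
  · subst h; simp [CharTwo.add_self_eq_zero]
  · simp [h]

lemma twist_one : twist θ₀ (1 : Matrix (Idx M N) (Idx M N) A) = 1 := twist_diagonal 1

lemma transp_twist (X : Matrix (Idx M N) (Idx M N) A) :
    transp θ₀ (twist θ₀ X) = twist θ₀ (transp θ₀ X) := by
  ext i j
  simp only [twist_apply, transp, Matrix.of_apply, smul_smul, par_bar]
  rw [add_comm (par θ₀ j), mul_comm]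

lemma twist_map {A' : Type*} [Ring A'] [Algebra ℂ A'] (φ : A →ₗ[ℂ] A')
    (X : Matrix (Idx M N) (Idx M N) A) : (twist θ₀ X).map φ = twist θ₀ (X.map φ) := by
  ext; simp [twist]

lemma twist₂_mul (X Y : Matrix (Idx M N × Idx M N) (Idx M N × Idx M N) A) :
    twist₂ θ₀ (X * Y) = twist₂ θ₀ X * twist₂ θ₀ Y := by
  ext x y
  simp only [twist₂, Matrix.of_apply, Matrix.mul_apply, Finset.smul_sum, smul_mul_smul_comm,
    ← sgn_add]
  refine Finset.sum_congr rfl fun k _ => ?_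
  congr 2
  generalize par θ₀ x.1 + par θ₀ x.2 = a, par θ₀ y.1 + par θ₀ y.2 = b,
    par θ₀ k.1 + par θ₀ k.2 = c
  revert a b c; decide

lemma twist₂_leg₁ (X : Matrix (Idx M N) (Idx M N) A) :
    twist₂ θ₀ (leg₁ θ₀ X) = leg₁ θ₀ (twist θ₀ X) := by
  ext ⟨a, b⟩ ⟨c, d⟩
  simp only [twist₂, Matrix.of_apply, leg₁_apply, twist_apply]
  by_cases h : b = d
  · subst h
    simp only [if_true]
    congr 2
    generalize par θ₀ a = a, par θ₀ b = b, par θ₀ c = c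
    revert a b c; decide
  · simp [h]

lemma twist₂_leg₂ (X : Matrix (Idx M N) (Idx M N) A) :
    twist₂ θ₀ (leg₂ θ₀ X) = leg₂ θ₀ (twist θ₀ X) := by
  ext ⟨a, b⟩ ⟨c, d⟩
  simp only [twist₂, Matrix.of_apply, leg₂_apply, twist_apply]
  by_cases h : a = c
  · subst h
    simp only [if_true, sgn_smul_sgn_smul]
    congr 2
    generalize par θ₀ a = a, par θ₀ b = b, par θ₀ d = d
    revert a b d; decide
  · simp [h]

lemma IsEven.twist₂_eq {Z : Matrix (Idx M N × Idx M N) (Idx M N × Idx M N) A}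
    (h : IsEven θ₀ Z) : twist₂ θ₀ Z = Z := by
  ext ⟨a, b⟩ ⟨c, d⟩
  simp only [twist₂, Matrix.of_apply]
  by_cases hp : par θ₀ a + par θ₀ b = par θ₀ c + par θ₀ d
  · rw [hp, CharTwo.add_self_eq_zero, sgn_zero, one_smul]
  · rw [h a b c d hp, smul_zero]

/-- Conjugating by the diagonal signs on both factors fixes R, which is even. This solution defines
the parity automorphism. -/
lemma IsRTT.twist {X : Matrix (Idx M N) (Idx M N) (PowerSeries A)} (h : IsRTT θ₀ X) :
    IsRTT θ₀ (RTT.twist θ₀ X) := by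
  have h1 := congrArg (twist₂ θ₀) h
  simp only [twist₂_mul, twist₂_leg₁, twist₂_leg₂, (isEven_Rpoly _ _).twist₂_eq] at h1
  have e1 : (RTT.twist θ₀ X).map (inner A) = RTT.twist θ₀ (X.map (inner A)) :=
    twist_map (inner A).toLinearMap X
  have e2 : (RTT.twist θ₀ X).map (outer A) = RTT.twist θ₀ (X.map (outer A)) :=
    twist_map (outer A).toLinearMap X
  unfold IsRTT RTTRel
  rw [e1, e2]
  exact h1

end Twist

section ParityU

variable {M N : ℕ} {θ₀ : ℤˣ}

/-- The parity automorphism of `U(R)`. -/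
def parityHom (M N : ℕ) (θ₀ : ℤˣ) : U M N θ₀ →ₐ[ℂ] U M N θ₀ :=
  lift (twist θ₀ (T M N θ₀)) isRTT_T.twist fun i j => by
    rw [twist_apply, PowerSeries.coeff_smul, coeff_T, gen_zero]
    split_ifs with h
    · subst h; simp [CharTwo.add_self_eq_zero]
    · simp

lemma parityHom_gen (i j : Idx M N) (n : ℕ) :
    parityHom M N θ₀ (gen θ₀ i j n) = sgn (par θ₀ i + par θ₀ j) • gen θ₀ i j n := by
  rw [parityHom, lift_gen, twist_apply, PowerSeries.coeff_smul, coeff_T]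

/-- The parity of `U(R)`. -/
def parityU (M N : ℕ) (θ₀ : ℤˣ) : Parity (U M N θ₀) where
  hom := parityHom M N θ₀
  hom_hom x := algHom_ext (f := (parityHom M N θ₀).comp (parityHom M N θ₀))
    (g := AlgHom.id ℂ _) (fun i j n => by
      simp [parityHom_gen, smul_smul, sgn_mul_self]) x

@[simp] lemma parityU_hom : (parityU M N θ₀).hom = parityHom M N θ₀ := rfl

lemma T_map_parityHom :
    (T M N θ₀).map (PowerSeries.mapAlgHom (parityHom M N θ₀)) = twist θ₀ (T M N θ₀) :=
  T_map_eq fun i j n => by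
    rw [parityHom_gen, twist_apply, PowerSeries.coeff_smul, coeff_T]

lemma mapAlgHom_shift {A A' : Type*} [Ring A] [Algebra ℂ A] [Ring A'] [Algebra ℂ A']
    (φ : A →ₐ[ℂ] A') (a : ℂ) (f : PowerSeries A) :
    PowerSeries.mapAlgHom φ (shift a f) = shift a (PowerSeries.mapAlgHom φ f) := by
  ext n; simp [shift, PowerSeries.mapAlgHom_apply]

/-- `T^t(u - κ) T(u)` for an arbitrary matrix of series. -/
def contraction {A : Type*} [Ring A] [Algebra ℂ A] (θ₀ : ℤˣ)
    (X : Matrix (Idx M N) (Idx M N) (PowerSeries A)) : Matrix (Idx M N) (Idx M N) (PowerSeries A) :=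
  (transp θ₀ X).map (shift (kappa M N θ₀)) * X

lemma contraction_map {A A' : Type*} [Ring A] [Algebra ℂ A] [Ring A'] [Algebra ℂ A']
    (φ : A →ₐ[ℂ] A') (X : Matrix (Idx M N) (Idx M N) (PowerSeries A)) :
    (contraction θ₀ X).map (PowerSeries.mapAlgHom φ) =
      contraction θ₀ (X.map (PowerSeries.mapAlgHom φ)) := by
  rw [contraction, Matrix.map_mul, contraction]
  congr 1
  rw [← show (transp θ₀ X).map (PowerSeries.mapAlgHom φ) =
    transp θ₀ (X.map (PowerSeries.mapAlgHom φ)) from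
      transp_map (PowerSeries.mapAlgHom φ).toLinearMap X]
  ext1 i j
  simp only [Matrix.map_apply, mapAlgHom_shift]

lemma contraction_twist {A : Type*} [Ring A] [Algebra ℂ A]
    (X : Matrix (Idx M N) (Idx M N) (PowerSeries A)) :
    contraction θ₀ (twist θ₀ X) = twist θ₀ (contraction θ₀ X) := by
  rw [contraction, transp_twist, contraction, twist_mul]
  congr 1
  exact twist_map (shiftHom A _).toLinearMap _

lemma contraction_T : contraction θ₀ (T M N θ₀) = C M N θ₀ := rfl

/-- The parity acts on T(u), hence on its contraction, by conjugation with a diagonal sign matrix,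
and conjugation fixes scalar matrices. So c is even. -/
lemma parityHom_coeff {c : PowerSeries (U M N θ₀)}
    (hc : C M N θ₀ = Matrix.diagonal (fun _ => c)) (h1 : IsEmpty (Idx M N) → c = 1) (n : ℕ) :
    parityHom M N θ₀ (PowerSeries.coeff n c) = PowerSeries.coeff n c := by
  rcases isEmpty_or_nonempty (Idx M N) with hE | ⟨⟨i⟩⟩
  · rw [h1 hE, PowerSeries.coeff_one]; split_ifs <;> simp
  · have h2 := congrArg (fun Z => Z.map (PowerSeries.mapAlgHom (parityHom M N θ₀))) hc
    rw [← contraction_T, contraction_map, T_map_parityHom, contraction_twist, contraction_T, hc,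
      twist_diagonal, Matrix.diagonal_map (map_zero _)] at h2
    have h3 := congrArg (PowerSeries.coeff n) (congrFun (congrFun h2 i) i)
    rw [Matrix.diagonal_apply_eq, Matrix.diagonal_apply_eq, PowerSeries.mapAlgHom_apply,
      PowerSeries.coeff_map] at h3
    exact h3.symm

/-! ### The inverse of `T(u)` -/

/-- Both products of T(u) with Tᵗ(u - κ) equal c(u), and c is invertible because its constant term
is 1. The resulting left and right inverses coincide. -/
lemma exists_T_inverse (hN : Even N) (θ₀ : ℤˣ) :
    ∃ Y : Matrix (Idx M N) (Idx M N) (PowerSeries (U M N θ₀)),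
      T M N θ₀ * Y = 1 ∧ Y * T M N θ₀ = 1 := by
  obtain ⟨c, hC, hC', hcomm, h0, -⟩ := exists_central (M := M) (θ₀ := θ₀) hN
  obtain ⟨d, hcd, hdc⟩ := exists_inverse c h0
  set Y := (transp θ₀ (T M N θ₀)).map (shift (kappa M N θ₀))
  have h1 : Y * T M N θ₀ = Matrix.diagonal (fun _ => c) := hC
  have e1 : Matrix.diagonal (fun _ : Idx M N => c) * Matrix.diagonal (fun _ => d) = 1 := by
    rw [Matrix.diagonal_mul_diagonal, hcd, Matrix.diagonal_one]
  have e2 : Matrix.diagonal (fun _ : Idx M N => d) * Matrix.diagonal (fun _ => c) = 1 := by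
    rw [Matrix.diagonal_mul_diagonal, hdc, Matrix.diagonal_one]
  refine ⟨Y * Matrix.diagonal (fun _ => d), by rw [← mul_assoc, hC', e1], ?_⟩
  have h2 : T M N θ₀ * (Y * Matrix.diagonal (fun _ => d)) = 1 := by rw [← mul_assoc, hC', e1]
  have h3 : Matrix.diagonal (fun _ => d) * Y * T M N θ₀ = 1 := by rw [mul_assoc, h1, e2]
  rw [← left_inv_eq_right_inv h3 h2, h3]

/-- The matrix `T(u)⁻¹`. -/
def Tinv (hN : Even N) (θ₀ : ℤˣ) : Matrix (Idx M N) (Idx M N) (PowerSeries (U M N θ₀)) :=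
  (exists_T_inverse hN θ₀).choose

lemma T_mul_Tinv (hN : Even N) : T M N θ₀ * Tinv hN θ₀ = 1 :=
  (exists_T_inverse hN θ₀).choose_spec.1

lemma Tinv_mul_T (hN : Even N) : Tinv hN θ₀ * T M N θ₀ = 1 :=
  (exists_T_inverse hN θ₀).choose_spec.2

/-- Both sides are entries of the inverse of the twisted T(u), and inverses are unique. -/
lemma parityHom_Tinv (hN : Even N) (i j : Idx M N) (n : ℕ) :
    parityHom M N θ₀ (PowerSeries.coeff n (Tinv hN θ₀ i j)) =
      sgn (par θ₀ i + par θ₀ j) • PowerSeries.coeff n (Tinv hN θ₀ i j) := by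
  have h1 : (Tinv hN θ₀).map (PowerSeries.mapAlgHom (parityHom M N θ₀)) * twist θ₀ (T M N θ₀) =
      1 := by
    rw [← T_map_parityHom, ← Matrix.map_mul, Tinv_mul_T, Matrix.map_one _ (map_zero _) (map_one _)]
  have h2 : twist θ₀ (T M N θ₀) * twist θ₀ (Tinv hN θ₀) = 1 := by
    rw [← twist_mul, T_mul_Tinv, twist_one]
  have h0 := left_inv_eq_right_inv h1 h2
  have h3 := congrFun (congrFun h0 i) j
  rw [Matrix.map_apply, PowerSeries.mapAlgHom_apply, twist_apply] at h3
  simpa using congrArg (PowerSeries.coeff n) h3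

lemma sum_gen_mul_Tinv (hN : Even N) (i j : Idx M N) (n : ℕ) :
    ∑ k, ∑ m ∈ Finset.HasAntidiagonal.antidiagonal n,
      gen θ₀ i k m.1 * PowerSeries.coeff m.2 (Tinv hN θ₀ k j) =
        if n = 0 then if i = j then 1 else 0 else 0 := by
  have h := congrArg (PowerSeries.coeff n) (congrFun (congrFun (T_mul_Tinv (M := M) (θ₀ := θ₀) hN) i) j)
  rw [Matrix.mul_apply, map_sum, Matrix.one_apply] at h
  simp only [PowerSeries.coeff_mul, coeff_T] at h
  rw [h]
  by_cases hij : i = j <;> simp [hij, PowerSeries.coeff_one]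

lemma sum_Tinv_mul_gen (hN : Even N) (i j : Idx M N) (n : ℕ) :
    ∑ k, ∑ m ∈ Finset.HasAntidiagonal.antidiagonal n,
      PowerSeries.coeff m.1 (Tinv hN θ₀ i k) * gen θ₀ k j m.2 =
        if n = 0 then if i = j then 1 else 0 else 0 := by
  have h := congrArg (PowerSeries.coeff n) (congrFun (congrFun (Tinv_mul_T (M := M) (θ₀ := θ₀) hN) i) j)
  rw [Matrix.mul_apply, map_sum, Matrix.one_apply] at h
  simp only [PowerSeries.coeff_mul, coeff_T] at h
  rw [h]
  by_cases hij : i = j <;> simp [hij, PowerSeries.coeff_one]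

lemma coeff_zero_Tinv (hN : Even N) (i j : Idx M N) :
    PowerSeries.coeff 0 (Tinv hN θ₀ i j) = if i = j then 1 else 0 := by
  have h := sum_gen_mul_Tinv (θ₀ := θ₀) hN i j 0
  simp only [Finset.HasAntidiagonal.antidiagonal_zero, Finset.sum_singleton, gen_zero, ite_mul,
    one_mul, zero_mul, Finset.sum_ite_eq, Finset.mem_univ, if_true] at h
  exact h

end ParityU

/-! ### The Hopf structure of `U(R)` -/

section Coproduct

variable {M N : ℕ} {θ₀ : ℤˣ}

/-- The graded tensor square of `U(R)`. -/
abbrev Sq (M N : ℕ) (θ₀ : ℤˣ) : Type :=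
  GradedTensorProduct ℂ (parityU M N θ₀).grading (parityU M N θ₀).grading

/-- The identity map from the tensor square of `U(R)` to the graded tensor square. -/
def toSq (M N : ℕ) (θ₀ : ℤˣ) : U M N θ₀ ⊗[ℂ] U M N θ₀ ≃ₗ[ℂ] Sq M N θ₀ :=
  GradedTensorProduct.of ℂ (parityU M N θ₀).grading (parityU M N θ₀).grading

/-- `x ↦ x ⊗ 1`. -/
def inl (M N : ℕ) (θ₀ : ℤˣ) : U M N θ₀ →ₐ[ℂ] Sq M N θ₀ :=
  GradedTensorProduct.includeLeft (parityU M N θ₀).grading (parityU M N θ₀).grading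

/-- `x ↦ 1 ⊗ x`. -/
def inr (M N : ℕ) (θ₀ : ℤˣ) : U M N θ₀ →ₐ[ℂ] Sq M N θ₀ :=
  GradedTensorProduct.includeRight (parityU M N θ₀).grading (parityU M N θ₀).grading

lemma inl_apply (x : U M N θ₀) : inl M N θ₀ x = toSq M N θ₀ (x ⊗ₜ 1) := rfl

lemma inr_apply (x : U M N θ₀) : inr M N θ₀ x = toSq M N θ₀ (1 ⊗ₜ x) := rfl

lemma inl_mul_inr (x y : U M N θ₀) : inl M N θ₀ x * inr M N θ₀ y = toSq M N θ₀ (x ⊗ₜ y) :=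
  GradedTensorProduct.tmul_one_mul_one_tmul _ _ x y

lemma inr_mul_inl {x y : U M N θ₀} {d e : ZMod 2} (hx : parityHom M N θ₀ x = sgn d • x)
    (hy : parityHom M N θ₀ y = sgn e • y) :
    inr M N θ₀ y * inl M N θ₀ x = sgn (d * e) • (inl M N θ₀ x * inr M N θ₀ y) := by
  rw [inl_mul_inr, inl_apply, inr_apply]
  refine ((parityU M N θ₀).of_tmul_mul 1 x 1 hy).trans ?_
  rw [parityU_hom, parityPow_of_smul hx, mul_comm e, one_mul, mul_one, ← TensorProduct.smul_tmul',
    map_smul]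
  rfl

/-- `T(u) ⊗ T(u)`. -/
def comulMatrix (M N : ℕ) (θ₀ : ℤˣ) : Matrix (Idx M N) (Idx M N) (PowerSeries (Sq M N θ₀)) :=
  (T M N θ₀).map (PowerSeries.mapAlgHom (inl M N θ₀)) *
    (T M N θ₀).map (PowerSeries.mapAlgHom (inr M N θ₀))

lemma superCommute_inl_inr : SuperCommute θ₀
    ((T M N θ₀).map (PowerSeries.mapAlgHom (inl M N θ₀)))
    ((T M N θ₀).map (PowerSeries.mapAlgHom (inr M N θ₀))) := by
  refine SuperCommute.symm fun k l i j n m => ?_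
  simp only [Matrix.map_apply, PowerSeries.mapAlgHom_apply, PowerSeries.coeff_map, coeff_T,
    RingHom.coe_coe]
  rw [inr_mul_inl (parityHom_gen i j m) (parityHom_gen k l n), mul_comm (par θ₀ k + par θ₀ l)]

lemma coeff_comulMatrix (i j : Idx M N) (n : ℕ) :
    PowerSeries.coeff n (comulMatrix M N θ₀ i j) =
      toSq M N θ₀ (∑ k : Idx M N, ∑ m ∈ Finset.HasAntidiagonal.antidiagonal n,
        gen θ₀ i k m.1 ⊗ₜ[ℂ] gen θ₀ k j m.2) := by
  simp only [comulMatrix, Matrix.mul_apply, map_sum, PowerSeries.coeff_mul, Matrix.map_apply,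
    PowerSeries.mapAlgHom_apply, PowerSeries.coeff_map, coeff_T, RingHom.coe_coe, inl_mul_inr]

lemma isRTT_comulMatrix : IsRTT θ₀ (comulMatrix M N θ₀) :=
  superCommute_inl_inr.isRTT_mul (isRTT_T.map _) (isRTT_T.map _)

/-- The coproduct as a homomorphism to the graded tensor square. -/
def comulHom (M N : ℕ) (θ₀ : ℤˣ) : U M N θ₀ →ₐ[ℂ] Sq M N θ₀ :=
  lift (comulMatrix M N θ₀) isRTT_comulMatrix fun i j => by
    rw [coeff_comulMatrix]
    simp only [Finset.HasAntidiagonal.antidiagonal_zero, Finset.sum_singleton, gen_zero]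
    rw [Finset.sum_eq_single i]
    · by_cases h : i = j
      · simp only [h, if_true]; rfl
      · simp [h]
    · intro k _ hk; simp [Ne.symm hk]
    · simp

/-- The coproduct. -/
def comulU (M N : ℕ) (θ₀ : ℤˣ) : U M N θ₀ →ₗ[ℂ] U M N θ₀ ⊗[ℂ] U M N θ₀ :=
  (toSq M N θ₀).symm.toLinearMap ∘ₗ (comulHom M N θ₀).toLinearMap

lemma toSq_comulU (x : U M N θ₀) : toSq M N θ₀ (comulU M N θ₀ x) = comulHom M N θ₀ x :=
  (toSq M N θ₀).apply_symm_apply _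

lemma comulHom_gen (i j : Idx M N) (n : ℕ) :
    comulHom M N θ₀ (gen θ₀ i j n) = PowerSeries.coeff n (comulMatrix M N θ₀ i j) :=
  lift_gen _ _ _ i j n

lemma comulU_gen (i j : Idx M N) (n : ℕ) :
    comulU M N θ₀ (gen θ₀ i j n) =
      ∑ k : Idx M N, ∑ m ∈ Finset.HasAntidiagonal.antidiagonal n,
        gen θ₀ i k m.1 ⊗ₜ[ℂ] gen θ₀ k j m.2 := by
  apply (toSq M N θ₀).injective
  rw [toSq_comulU, comulHom_gen, coeff_comulMatrix]

lemma comulU_one : comulU M N θ₀ 1 = 1 ⊗ₜ 1 := by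
  apply (toSq M N θ₀).injective
  rw [toSq_comulU, map_one]; rfl

lemma comulU_mul (a b : U M N θ₀) :
    toSq M N θ₀ (comulU M N θ₀ (a * b)) =
      toSq M N θ₀ (comulU M N θ₀ a) * toSq M N θ₀ (comulU M N θ₀ b) := by
  rw [toSq_comulU, toSq_comulU, toSq_comulU, map_mul]

/-- The operator of left multiplication by `x`, twisted by a power of the parity. -/
abbrev opU (x : U M N θ₀) (e : ZMod 2) : U M N θ₀ →ₗ[ℂ] U M N θ₀ := (parityU M N θ₀).mulPow x e

/-- Multiplication by Δ(T) becomes an operator on Δ(x) for arbitrary, not necessarily homogeneous x: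
the Koszul sign is absorbed into a parity power. This is the induction step for the axioms below. -/
lemma comulU_gen_mul (i j : Idx M N) (n : ℕ) (x : U M N θ₀) :
    comulU M N θ₀ (gen θ₀ i j n * x) =
      ∑ k : Idx M N, ∑ m ∈ Finset.HasAntidiagonal.antidiagonal n,
        TensorProduct.map (opU (gen θ₀ i k m.1) (par θ₀ k + par θ₀ j))
          (LinearMap.mulLeft ℂ (gen θ₀ k j m.2)) (comulU M N θ₀ x) := by
  apply (toSq M N θ₀).injective
  rw [comulU_mul, comulU_gen, map_sum, map_sum, Finset.sum_mul]
  refine Finset.sum_congr rfl fun k _ => ?_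
  rw [map_sum, map_sum, Finset.sum_mul]
  exact Finset.sum_congr rfl fun m _ =>
    (parityU M N θ₀).of_tmul_mul_of _ (parityHom_gen k j m.2) _

lemma opU_comp_parityPow (x : U M N θ₀) (d e : ZMod 2) (c : U M N θ₀) :
    opU x d (parityPow (parityHom M N θ₀) e c) = opU x (d + e) c := by
  rw [Parity.mulPow_apply, Parity.mulPow_apply, parityU_hom,
    parityPow_parityPow (g := parityHom M N θ₀) (parityU M N θ₀).hom_hom]

lemma parityPow_parityHom (e : ZMod 2) (x : U M N θ₀) :
    parityPow (parityHom M N θ₀) e (parityHom M N θ₀ x) =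
      parityHom M N θ₀ (parityPow (parityHom M N θ₀) e x) := by
  unfold parityPow; split_ifs <;> rfl

lemma comulU_parityHom (x : U M N θ₀) :
    comulU M N θ₀ (parityHom M N θ₀ x) =
      TensorProduct.map (parityHom M N θ₀).toLinearMap (parityHom M N θ₀).toLinearMap
        (comulU M N θ₀ x) := by
  refine gen_induction (p := fun x => comulU M N θ₀ (parityHom M N θ₀ x) =
      TensorProduct.map (parityHom M N θ₀).toLinearMap (parityHom M N θ₀).toLinearMap
        (comulU M N θ₀ x)) ?_ ?_ ?_ ?_ x
  · simp [comulU_one]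
  · intro x y hx hy; simp only [map_add, hx, hy]
  · intro r x hx; simp only [map_smul, hx]
  · intro i j n x hx
    rw [map_mul, parityHom_gen, smul_mul_assoc, map_smul, comulU_gen_mul, comulU_gen_mul, hx,
      map_sum, Finset.smul_sum]
    refine Finset.sum_congr rfl fun k _ => ?_
    rw [map_sum, Finset.smul_sum]
    refine Finset.sum_congr rfl fun m _ => ?_
    induction comulU M N θ₀ x with
    | zero => simp
    | add a b ha hb => simp only [map_add, smul_add, ha, hb]
    | tmul a b =>
      simp only [TensorProduct.map_tmul, AlgHom.toLinearMap_apply, LinearMap.mulLeft_apply, map_mul,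
        parityHom_gen, Parity.mulPow_apply, parityU_hom, smul_mul_assoc]
      rw [TensorProduct.smul_tmul_smul, ← sgn_add]
      rw [parityPow_parityHom]
      congr 2
      generalize par θ₀ i = a, par θ₀ j = b, par θ₀ k = c
      revert a b c; decide

lemma comulU_parityPow (e : ZMod 2) (x : U M N θ₀) :
    comulU M N θ₀ (parityPow (parityHom M N θ₀) e x) =
      TensorProduct.map (parityPow (parityHom M N θ₀) e).toLinearMap
        (parityPow (parityHom M N θ₀) e).toLinearMap (comulU M N θ₀ x) := by
  have h : ∀ z : ZMod 2, z = 0 ∨ z = 1 := by decide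
  rcases h e with rfl | rfl
  · simp only [parityPow, if_true, AlgHom.id_apply]
    exact (congrFun (congrArg DFunLike.coe TensorProduct.map_id) _).symm
  · simpa [parityPow] using comulU_parityHom x

lemma sum_antidiagonal_assoc {G : Type*} [AddCommMonoid G] (F : ℕ → ℕ → ℕ → G) (n : ℕ) :
    ∑ p ∈ Finset.HasAntidiagonal.antidiagonal n, ∑ q ∈ Finset.HasAntidiagonal.antidiagonal p.1,
      F q.1 q.2 p.2 =
    ∑ p ∈ Finset.HasAntidiagonal.antidiagonal n, ∑ q ∈ Finset.HasAntidiagonal.antidiagonal p.2,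
      F p.1 q.1 q.2 := by
  rw [Finset.sum_sigma', Finset.sum_sigma']
  refine Finset.sum_nbij'
    (fun t => ⟨(t.2.1, t.2.2 + t.1.2), (t.2.2, t.1.2)⟩)
    (fun t => ⟨(t.1.1 + t.2.1, t.2.2), (t.1.1, t.2.1)⟩) ?_ ?_ ?_ ?_ ?_
  · rintro ⟨⟨a, b⟩, ⟨c, d⟩⟩ h
    simp only [Finset.mem_sigma, Finset.HasAntidiagonal.mem_antidiagonal] at h ⊢
    obtain ⟨rfl, rfl⟩ := h
    exact ⟨by ac_rfl, trivial⟩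
  · rintro ⟨⟨a, b⟩, ⟨c, d⟩⟩ h
    simp only [Finset.mem_sigma, Finset.HasAntidiagonal.mem_antidiagonal] at h ⊢
    obtain ⟨rfl, rfl⟩ := h
    exact ⟨by ac_rfl, trivial⟩
  · rintro ⟨⟨a, b⟩, ⟨c, d⟩⟩ h
    simp only [Finset.mem_sigma, Finset.HasAntidiagonal.mem_antidiagonal] at h ⊢
    obtain ⟨rfl, rfl⟩ := h
    rfl
  · rintro ⟨⟨a, b⟩, ⟨c, d⟩⟩ h
    simp only [Finset.mem_sigma, Finset.HasAntidiagonal.mem_antidiagonal] at h ⊢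
    obtain ⟨rfl, rfl⟩ := h
    rfl
  · rintro ⟨⟨a, b⟩, ⟨c, d⟩⟩ h
    rfl

lemma rTensor_comulU_map (i k j : Idx M N) (r s : ℕ) (t : U M N θ₀ ⊗[ℂ] U M N θ₀) :
    TensorProduct.assoc ℂ _ _ _ ((comulU M N θ₀).rTensor _
      (TensorProduct.map (opU (gen θ₀ i k r) (par θ₀ k + par θ₀ j))
        (LinearMap.mulLeft ℂ (gen θ₀ k j s)) t)) =
    ∑ l, ∑ m ∈ Finset.HasAntidiagonal.antidiagonal r,
      TensorProduct.map (opU (gen θ₀ i l m.1) (par θ₀ l + par θ₀ j))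
        (TensorProduct.map (opU (gen θ₀ l k m.2) (par θ₀ k + par θ₀ j))
          (LinearMap.mulLeft ℂ (gen θ₀ k j s)))
        (TensorProduct.assoc ℂ _ _ _ ((comulU M N θ₀).rTensor _ t)) := by
  induction t with
  | zero => simp
  | add a b ha hb => simp only [map_add, ha, hb, Finset.sum_add_distrib]
  | tmul a b =>
    rw [TensorProduct.map_tmul, LinearMap.rTensor_tmul, LinearMap.rTensor_tmul,
      Parity.mulPow_apply, comulU_gen_mul, parityU_hom, comulU_parityPow]
    rw [TensorProduct.sum_tmul, map_sum]
    refine Finset.sum_congr rfl fun l _ => ?_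
    rw [TensorProduct.sum_tmul, map_sum]
    refine Finset.sum_congr rfl fun m _ => ?_
    induction comulU M N θ₀ a with
    | zero => simp
    | add x y hx hy => simp only [map_add, TensorProduct.add_tmul, hx, hy]
    | tmul x y =>
      simp only [TensorProduct.map_tmul, AlgHom.toLinearMap_apply, opU_comp_parityPow,
        TensorProduct.assoc_tmul, LinearMap.mulLeft_apply]
      -- The two parity powers acting on the first factor compose, and the intermediate index k
      -- drops out. This produces the operators of `lTensor_comulU_map`.
      have : par θ₀ l + par θ₀ k + (par θ₀ k + par θ₀ j) = par θ₀ l + par θ₀ j := by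
        generalize par θ₀ l = a, par θ₀ j = b, par θ₀ k = c
        revert a b c; decide
      rw [this]
      rfl

lemma lTensor_comulU_map (i k j : Idx M N) (r s : ℕ) (t : U M N θ₀ ⊗[ℂ] U M N θ₀) :
    (comulU M N θ₀).lTensor _
      (TensorProduct.map (opU (gen θ₀ i k r) (par θ₀ k + par θ₀ j))
        (LinearMap.mulLeft ℂ (gen θ₀ k j s)) t) =
    ∑ l, ∑ m ∈ Finset.HasAntidiagonal.antidiagonal s,
      TensorProduct.map (opU (gen θ₀ i k r) (par θ₀ k + par θ₀ j))
        (TensorProduct.map (opU (gen θ₀ k l m.1) (par θ₀ l + par θ₀ j))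
          (LinearMap.mulLeft ℂ (gen θ₀ l j m.2)))
        ((comulU M N θ₀).lTensor _ t) := by
  induction t with
  | zero => simp
  | add a b ha hb => simp only [map_add, ha, hb, Finset.sum_add_distrib]
  | tmul a b =>
    rw [TensorProduct.map_tmul, LinearMap.lTensor_tmul, LinearMap.lTensor_tmul,
      LinearMap.mulLeft_apply, comulU_gen_mul, TensorProduct.tmul_sum]
    refine Finset.sum_congr rfl fun l _ => ?_
    rw [TensorProduct.tmul_sum]
    rfl

lemma comulU_coassoc (x : U M N θ₀) :
    TensorProduct.assoc ℂ _ _ _ ((comulU M N θ₀).rTensor _ (comulU M N θ₀ x)) =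
      (comulU M N θ₀).lTensor _ (comulU M N θ₀ x) := by
  refine gen_induction (p := fun x => TensorProduct.assoc ℂ _ _ _
    ((comulU M N θ₀).rTensor _ (comulU M N θ₀ x)) =
      (comulU M N θ₀).lTensor _ (comulU M N θ₀ x)) ?_ ?_ ?_ ?_ x
  · simp [comulU_one]
  · intro x y hx hy; simp only [map_add, hx, hy]
  · intro r x hx; simp only [map_smul, hx]
  · intro i j n x hx
    simp only [comulU_gen_mul, map_sum, rTensor_comulU_map, lTensor_comulU_map, hx]
    generalize (comulU M N θ₀).lTensor _ (comulU M N θ₀ x) = t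
    -- Both sides are sums over two inner indices and three orders of total n; they differ only in
    -- bracketing and in the names of the indices.
    simp only [Finset.sum_comm (s := Finset.HasAntidiagonal.antidiagonal n) (t := Finset.univ)]
    rw [Finset.sum_comm]
    refine Finset.sum_congr rfl fun k _ => Finset.sum_congr rfl fun l _ => ?_
    exact sum_antidiagonal_assoc (fun a b c =>
      TensorProduct.map (opU (gen θ₀ i k a) (par θ₀ k + par θ₀ j))
        (TensorProduct.map (opU (gen θ₀ k l b) (par θ₀ l + par θ₀ j))
          (LinearMap.mulLeft ℂ (gen θ₀ l j c))) t) n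

end Coproduct

/-! ### The counit. -/

section Counit

variable {M N : ℕ} {θ₀ : ℤˣ}

lemma isRTT_one {A : Type*} [Ring A] [Algebra ℂ A] :
    IsRTT θ₀ (1 : Matrix (Idx M N) (Idx M N) (PowerSeries A)) := by
  unfold IsRTT RTTRel
  rw [Matrix.map_one _ (map_zero _) (map_one _), Matrix.map_one _ (map_zero _) (map_one _),
    leg₁_one, leg₂_one]
  simp

/-- The counit. -/
def counitU (M N : ℕ) (θ₀ : ℤˣ) : U M N θ₀ →ₐ[ℂ] ℂ :=
  lift 1 isRTT_one fun i j => by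
    rw [Matrix.one_apply]; split_ifs <;> simp

lemma counitU_gen (i j : Idx M N) (n : ℕ) :
    counitU M N θ₀ (gen θ₀ i j n) = if n = 0 then if i = j then 1 else 0 else 0 := by
  rw [counitU, lift_gen, Matrix.one_apply]
  by_cases h : i = j <;> simp [h, PowerSeries.coeff_one]

lemma counitU_parityHom (x : U M N θ₀) :
    counitU M N θ₀ (parityHom M N θ₀ x) = counitU M N θ₀ x :=
  algHom_ext (f := (counitU M N θ₀).comp (parityHom M N θ₀)) (fun i j n => by
    rw [AlgHom.comp_apply, parityHom_gen, map_smul, counitU_gen]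
    by_cases h : i = j
    · subst h; simp [CharTwo.add_self_eq_zero]
    · simp [h]) x

lemma counitU_parityPow (e : ZMod 2) (x : U M N θ₀) :
    counitU M N θ₀ (parityPow (parityHom M N θ₀) e x) = counitU M N θ₀ x := by
  rw [parityPow]; split_ifs
  · rfl
  · exact counitU_parityHom x

lemma rTensor_counitU_comulU (x : U M N θ₀) :
    (counitU M N θ₀).toLinearMap.rTensor _ (comulU M N θ₀ x) = 1 ⊗ₜ x := by
  refine gen_induction (p := fun x =>
    (counitU M N θ₀).toLinearMap.rTensor _ (comulU M N θ₀ x) = 1 ⊗ₜ x) ?_ ?_ ?_ ?_ x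
  · simp [comulU_one]
  · intro x y hx hy; simp only [map_add, hx, hy, TensorProduct.tmul_add]
  · intro r x hx; simp only [map_smul, hx, TensorProduct.tmul_smul]
  · intro i j n x hx
    have key : ∀ (k : Idx M N) (m : ℕ × ℕ) (t : U M N θ₀ ⊗[ℂ] U M N θ₀),
        (counitU M N θ₀).toLinearMap.rTensor _ (TensorProduct.map
          (opU (gen θ₀ i k m.1) (par θ₀ k + par θ₀ j))
          (LinearMap.mulLeft ℂ (gen θ₀ k j m.2)) t) =
        counitU M N θ₀ (gen θ₀ i k m.1) • (LinearMap.mulLeft ℂ (gen θ₀ k j m.2)).lTensor _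
          ((counitU M N θ₀).toLinearMap.rTensor _ t) := by
      intro k m t
      induction t with
      | zero => simp
      | add a b ha hb => simp only [map_add, ha, hb, smul_add]
      | tmul a b =>
        simp only [TensorProduct.map_tmul, LinearMap.rTensor_tmul, LinearMap.lTensor_tmul,
          AlgHom.toLinearMap_apply, Parity.mulPow_apply, map_mul, parityU_hom, counitU_parityPow,
          TensorProduct.smul_tmul', smul_eq_mul]
    rw [comulU_gen_mul, map_sum]
    simp only [map_sum, key, hx, LinearMap.lTensor_tmul, LinearMap.mulLeft_apply, counitU_gen]
    rw [Finset.sum_eq_single i, Finset.sum_eq_single (0, n)]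
    · simp
    · rintro ⟨a, b⟩ h h2
      have : a ≠ 0 := by
        rintro rfl
        exact h2 (by simpa using h)
      simp [this]
    · simp
    · intro k _ hk; simp [Ne.symm hk]
    · simp

lemma lTensor_counitU_comulU (x : U M N θ₀) :
    (counitU M N θ₀).toLinearMap.lTensor _ (comulU M N θ₀ x) = x ⊗ₜ 1 := by
  refine gen_induction (p := fun x =>
    (counitU M N θ₀).toLinearMap.lTensor _ (comulU M N θ₀ x) = x ⊗ₜ 1) ?_ ?_ ?_ ?_ x
  · simp [comulU_one]
  · intro x y hx hy; simp only [map_add, hx, hy, TensorProduct.add_tmul]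
  · intro r x hx; simp only [map_smul, hx, TensorProduct.smul_tmul']
  · intro i j n x hx
    have key : ∀ (k : Idx M N) (m : ℕ × ℕ) (t : U M N θ₀ ⊗[ℂ] U M N θ₀),
        (counitU M N θ₀).toLinearMap.lTensor _ (TensorProduct.map
          (opU (gen θ₀ i k m.1) (par θ₀ k + par θ₀ j))
          (LinearMap.mulLeft ℂ (gen θ₀ k j m.2)) t) =
        counitU M N θ₀ (gen θ₀ k j m.2) • (opU (gen θ₀ i k m.1) (par θ₀ k + par θ₀ j)).rTensor _
          ((counitU M N θ₀).toLinearMap.lTensor _ t) := by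
      intro k m t
      induction t with
      | zero => simp
      | add a b ha hb => simp only [map_add, ha, hb, smul_add]
      | tmul a b =>
        simp only [TensorProduct.map_tmul, LinearMap.rTensor_tmul, LinearMap.lTensor_tmul,
          AlgHom.toLinearMap_apply, LinearMap.mulLeft_apply, map_mul, ← TensorProduct.tmul_smul,
          smul_eq_mul]
    rw [comulU_gen_mul, map_sum]
    simp only [map_sum, key, hx, LinearMap.rTensor_tmul, Parity.mulPow_apply, counitU_gen]
    rw [Finset.sum_eq_single j, Finset.sum_eq_single (n, 0)]
    -- In the surviving term k = j, so the parity exponent [k] + [j] is zero and no twist remains.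
    · simp [CharTwo.add_self_eq_zero, parityPow]
    · rintro ⟨a, b⟩ h h2
      have : b ≠ 0 := by
        rintro rfl
        exact h2 (by simpa using h)
      simp [this]
    · simp
    · intro k _ hk; simp [hk]
    · simp

end Counit

/-! ### Quotients of Hopf superalgebras -/

namespace Parity

variable {A B : Type*} [Ring A] [Algebra ℂ A] [Ring B] [Algebra ℂ B]

section Map

variable {p : Parity A} {q : Parity B} {f : A →ₐ[ℂ] B}

lemma map_parityPow (hf : ∀ a, q.hom (f a) = f (p.hom a)) (e : ZMod 2) (a : A) :
    f (parityPow p.hom e a) = parityPow q.hom e (f a) := by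
  unfold parityPow; split_ifs
  · rfl
  · exact (hf a).symm

/-- The map of graded tensor squares induced by an even homomorphism. -/
def mapSq (p : Parity A) (q : Parity B) (f : A →ₐ[ℂ] B) :
    GradedTensorProduct ℂ p.grading p.grading →ₗ[ℂ] GradedTensorProduct ℂ q.grading q.grading :=
  (GradedTensorProduct.of ℂ q.grading q.grading).toLinearMap ∘ₗ
    TensorProduct.map f.toLinearMap f.toLinearMap ∘ₗ
      (GradedTensorProduct.of ℂ p.grading p.grading).symm.toLinearMap

lemma mapSq_of (t : A ⊗[ℂ] A) :
    mapSq p q f (GradedTensorProduct.of ℂ p.grading p.grading t) =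
      GradedTensorProduct.of ℂ q.grading q.grading
        (TensorProduct.map f.toLinearMap f.toLinearMap t) := by
  simp [mapSq]

/-- An even homomorphism preserves Koszul signs. The left factor is split into homogeneous parts to
apply the explicit product formula. -/
lemma mapSq_mul (hf : ∀ a, q.hom (f a) = f (p.hom a))
    (s t : GradedTensorProduct ℂ p.grading p.grading) :
    mapSq p q f (s * t) = mapSq p q f s * mapSq p q f t := by
  obtain ⟨s, rfl⟩ := (GradedTensorProduct.of ℂ p.grading p.grading).surjective s
  obtain ⟨t, rfl⟩ := (GradedTensorProduct.of ℂ p.grading p.grading).surjective t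
  induction s with
  | zero => simp
  | add x y hx hy => rw [map_add, add_mul, map_add, hx, hy, map_add, add_mul]
  | tmul a b =>
    have key : ∀ (e : ZMod 2) (b : A), p.hom b = sgn e • b →
        mapSq p q f (GradedTensorProduct.of ℂ p.grading p.grading (a ⊗ₜ b) *
          GradedTensorProduct.of ℂ p.grading p.grading t) =
        mapSq p q f (GradedTensorProduct.of ℂ p.grading p.grading (a ⊗ₜ b)) *
          mapSq p q f (GradedTensorProduct.of ℂ p.grading p.grading t) := by
      intro e b hb
      have hb' : q.hom (f b) = sgn e • f b := by rw [hf, hb, map_smul]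
      rw [p.of_tmul_mul_of a hb, mapSq_of, mapSq_of, mapSq_of, TensorProduct.map_tmul]
      refine Eq.trans ?_ (q.of_tmul_mul_of (f a) hb' _).symm
      congr 1
      induction t with
      | zero => simp
      | add x y hx hy => simp only [map_add, hx, hy]
      | tmul c d => simp [map_parityPow hf]
    rw [← p.proj_zero_add_proj_one b, TensorProduct.tmul_add, map_add, add_mul, map_add,
      key 0 _ (p.proj_mem 0 b), key 1 _ (p.proj_mem 1 b), map_add, add_mul]

end Map

lemma exists_descent {V W X : Type*} [AddCommGroup V] [Module ℂ V] [AddCommGroup W] [Module ℂ W]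
    [AddCommGroup X] [Module ℂ X] {π : V →ₗ[ℂ] W} (hπ : Function.Surjective π) (f : V →ₗ[ℂ] X)
    (hf : ∀ v, π v = 0 → f v = 0) : ∃ f' : W →ₗ[ℂ] X, ∀ v, f' (π v) = f v := by
  refine ⟨(LinearMap.ker π).liftQ f hf ∘ₗ (π.quotKerEquivOfSurjective hπ).symm.toLinearMap,
    fun v => ?_⟩
  have h : (π.quotKerEquivOfSurjective hπ).symm (π v) = Submodule.Quotient.mk v := by
    rw [LinearEquiv.symm_apply_eq]; rfl
  change (LinearMap.ker π).liftQ f hf ((π.quotKerEquivOfSurjective hπ).symm (π v)) = f v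
  rw [h]; rfl

lemma exists_descent_algHom {X : Type*} [Ring X] [Algebra ℂ X] {π : A →ₐ[ℂ] B}
    (hπ : Function.Surjective π) (f : A →ₐ[ℂ] X) (hf : ∀ v, π v = 0 → f v = 0) :
    ∃ f' : B →ₐ[ℂ] X, ∀ v, f' (π v) = f v := by
  obtain ⟨f', h⟩ := exists_descent (π := π.toLinearMap) hπ f.toLinearMap hf
  replace h : ∀ v, f' (π v) = f v := h
  refine ⟨AlgHom.ofLinearMap f' (by rw [← map_one π, h, map_one]) fun x y => ?_, h⟩
  obtain ⟨x, rfl⟩ := hπ x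
  obtain ⟨y, rfl⟩ := hπ y
  rw [← map_mul, h, h, h, map_mul]

/-- A Hopf superalgebra structure descends along a surjection whose kernel is a Hopf ideal. -/
theorem HopfData.exists_quotient {p : Parity A} (H : p.HopfData) {π : A →ₐ[ℂ] B}
    (hπ : Function.Surjective π) (hhom : ∀ a, π a = 0 → π (p.hom a) = 0)
    (hcomul : ∀ a, π a = 0 → TensorProduct.map π.toLinearMap π.toLinearMap (H.comul a) = 0)
    (hcounit : ∀ a, π a = 0 → H.counit a = 0) (hantipode : ∀ a, π a = 0 → π (H.antipode a) = 0) :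
    ∃ H' : HopfSuperalgebra ℂ B, H.hopf.IsHom H' π := by
  obtain ⟨g, hg⟩ := exists_descent_algHom hπ (π.comp p.hom) hhom
  obtain ⟨Δ, hΔ⟩ := exists_descent (π := π.toLinearMap) hπ
    (TensorProduct.map π.toLinearMap π.toLinearMap ∘ₗ H.comul) hcomul
  obtain ⟨ε, hε⟩ := exists_descent_algHom hπ H.counit hcounit
  obtain ⟨S, hS⟩ := exists_descent (π := π.toLinearMap) hπ (π.toLinearMap ∘ₗ H.antipode) hantipode
  simp only [AlgHom.comp_apply, LinearMap.comp_apply, AlgHom.toLinearMap_apply] at hg hΔ hS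
  let q : Parity B := ⟨g, fun x => by
    obtain ⟨x, rfl⟩ := hπ x
    rw [hg, hg, p.hom_hom]⟩
  have hq : ∀ a, q.hom (π a) = π (p.hom a) := hg
  -- The following identities express that π intertwines the structure maps on tensors. As π is
  -- surjective, each axiom below is then the image of the corresponding axiom above.
  have hl : ∀ t : A ⊗[ℂ] A, Δ.lTensor B (TensorProduct.map π.toLinearMap π.toLinearMap t) =
      TensorProduct.map π.toLinearMap (TensorProduct.map π.toLinearMap π.toLinearMap)
        (H.comul.lTensor A t) := by
    intro t
    induction t with
    | zero => simp
    | add x y hx hy => simp only [map_add, hx, hy]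
    | tmul a b => simp [hΔ]
  have hr : ∀ t : A ⊗[ℂ] A, TensorProduct.assoc ℂ B B B
      (Δ.rTensor B (TensorProduct.map π.toLinearMap π.toLinearMap t)) =
      TensorProduct.map π.toLinearMap (TensorProduct.map π.toLinearMap π.toLinearMap)
        (TensorProduct.assoc ℂ A A A (H.comul.rTensor A t)) := by
    intro t
    induction t with
    | zero => simp
    | add x y hx hy => simp only [map_add, hx, hy]
    | tmul a b =>
      simp only [TensorProduct.map_tmul, AlgHom.toLinearMap_apply, LinearMap.rTensor_tmul, hΔ]
      induction H.comul a with
      | zero => simp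
      | add x y hx hy => simp only [map_add, TensorProduct.add_tmul, hx, hy]
      | tmul x y => simp
  have hSl : ∀ t : A ⊗[ℂ] A, LinearMap.mul' ℂ B
      (S.rTensor B (TensorProduct.map π.toLinearMap π.toLinearMap t)) =
      π (LinearMap.mul' ℂ A (H.antipode.rTensor A t)) := by
    intro t
    induction t with
    | zero => simp
    | add x y hx hy => simp only [map_add, hx, hy]
    | tmul a b => simp [hS]
  have hSr : ∀ t : A ⊗[ℂ] A, LinearMap.mul' ℂ B
      (S.lTensor B (TensorProduct.map π.toLinearMap π.toLinearMap t)) =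
      π (LinearMap.mul' ℂ A (H.antipode.lTensor A t)) := by
    intro t
    induction t with
    | zero => simp
    | add x y hx hy => simp only [map_add, hx, hy]
    | tmul a b => simp [hS]
  have hεl : ∀ t : A ⊗[ℂ] A, ε.toLinearMap.rTensor B
      (TensorProduct.map π.toLinearMap π.toLinearMap t) =
      π.toLinearMap.lTensor ℂ (H.counit.toLinearMap.rTensor A t) := by
    intro t
    induction t with
    | zero => simp
    | add x y hx hy => simp only [map_add, hx, hy]
    | tmul a b => simp [hε]
  have hεr : ∀ t : A ⊗[ℂ] A, ε.toLinearMap.lTensor B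
      (TensorProduct.map π.toLinearMap π.toLinearMap t) =
      π.toLinearMap.rTensor ℂ (H.counit.toLinearMap.lTensor A t) := by
    intro t
    induction t with
    | zero => simp
    | add x y hx hy => simp only [map_add, hx, hy]
    | tmul a b => simp [hε]
  have hgg : ∀ t : A ⊗[ℂ] A, TensorProduct.map g.toLinearMap g.toLinearMap
      (TensorProduct.map π.toLinearMap π.toLinearMap t) =
      TensorProduct.map π.toLinearMap π.toLinearMap
        (TensorProduct.map p.hom.toLinearMap p.hom.toLinearMap t) := by
    intro t
    induction t with
    | zero => simp
    | add x y hx hy => simp only [map_add, hx, hy]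
    | tmul a b => simp [hg]
  let H' : q.HopfData :=
    { comul := Δ
      counit := ε
      antipode := S
      coassoc := fun b => by
        obtain ⟨a, rfl⟩ := hπ b
        rw [hΔ, hr, hl, H.coassoc]
      counit_left := fun b => by
        obtain ⟨a, rfl⟩ := hπ b
        rw [hΔ, hεl, H.counit_left, LinearMap.lTensor_tmul]; rfl
      counit_right := fun b => by
        obtain ⟨a, rfl⟩ := hπ b
        rw [hΔ, hεr, H.counit_right, LinearMap.rTensor_tmul]; rfl
      comul_one := by
        rw [← map_one π, hΔ, H.comul_one]; rfl
      comul_mul := fun a b => by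
        obtain ⟨a, rfl⟩ := hπ a
        obtain ⟨b, rfl⟩ := hπ b
        rw [← map_mul, hΔ, hΔ, hΔ, ← mapSq_of (p := p), H.comul_mul, mapSq_mul hq, mapSq_of,
          mapSq_of]
      comul_hom := fun b => by
        obtain ⟨a, rfl⟩ := hπ b
        rw [hq, hΔ, hΔ, hgg, H.comul_hom]
      counit_hom := fun b => by
        obtain ⟨a, rfl⟩ := hπ b
        rw [hq, hε, hε, H.counit_hom]
      antipode_hom := fun b => by
        obtain ⟨a, rfl⟩ := hπ b
        rw [hq, hS, hS, hq, H.antipode_hom]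
      antipode_left := fun b => by
        obtain ⟨a, rfl⟩ := hπ b
        rw [hΔ, hSl, H.antipode_left, hε, AlgHom.commutes]
      antipode_right := fun b => by
        obtain ⟨a, rfl⟩ := hπ b
        rw [hΔ, hSr, H.antipode_right, hε, AlgHom.commutes] }
  refine ⟨H'.hopf, fun d a ha => ?_, hΔ, hε, hS⟩
  change q.hom (π a) = sgn d • π a
  rw [hq, mem_grading.mp ha, map_smul]

end Parity

/-! ### The antipode of `U(R)` -/

section Antipode

variable {M N : ℕ} {θ₀ : ℤˣ} (hN : Even N)

/-- The antipode, in the form of the action `x ↦ (v ↦ ± v S(x))` of `U(R)` on itself. -/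
def antipodeHom (θ₀ : ℤˣ) : U M N θ₀ →ₐ[ℂ] Module.End ℂ (U M N θ₀) :=
  lift (antipodeMatrix θ₀ (parityHom M N θ₀) (Tinv hN θ₀))
    (isRTT_T.isRTT_antipodeMatrix (T_mul_Tinv hN) (Tinv_mul_T hN) (parityU M N θ₀).hom_hom
      (parityHom_Tinv hN)) fun i j => by
    rw [coeff_antipodeMatrix, coeff_zero_Tinv]
    by_cases h : i = j
    · subst h
      ext v
      simp [CharTwo.add_self_eq_zero, parityPow]
    · simp [h]

lemma antipodeHom_gen (i j : Idx M N) (n : ℕ) (v : U M N θ₀) :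
    antipodeHom hN θ₀ (gen θ₀ i j n) v =
      parityPow (parityHom M N θ₀) (par θ₀ i + par θ₀ j) v *
        PowerSeries.coeff n (Tinv hN θ₀ i j) := by
  rw [antipodeHom, lift_gen, coeff_antipodeMatrix, rightMul_apply]

/-- The antipode. -/
def antipodeU (θ₀ : ℤˣ) : U M N θ₀ →ₗ[ℂ] U M N θ₀ :=
  LinearMap.applyₗ (1 : U M N θ₀) ∘ₗ (antipodeHom hN θ₀).toLinearMap

lemma antipodeU_apply (x : U M N θ₀) : antipodeU hN θ₀ x = antipodeHom hN θ₀ x 1 := rfl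

lemma antipodeU_one : antipodeU hN θ₀ (1 : U M N θ₀) = 1 := by simp [antipodeU_apply]

/-- Graded antimultiplicativity, S(tx) = ± S(x) S(t), in the case where t is a generator. -/
lemma antipodeU_gen_mul (i j : Idx M N) (n : ℕ) (x : U M N θ₀) :
    antipodeU hN θ₀ (gen θ₀ i j n * x) =
      parityPow (parityHom M N θ₀) (par θ₀ i + par θ₀ j) (antipodeU hN θ₀ x) *
        PowerSeries.coeff n (Tinv hN θ₀ i j) := by
  rw [antipodeU_apply, map_mul, Module.End.mul_apply, antipodeHom_gen, antipodeU_apply]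

lemma antipodeU_gen (i j : Idx M N) (n : ℕ) :
    antipodeU hN θ₀ (gen θ₀ i j n) = PowerSeries.coeff n (Tinv hN θ₀ i j) := by
  rw [← mul_one (gen θ₀ i j n), antipodeU_gen_mul, antipodeU_one, map_one, one_mul]

lemma antipodeU_parityHom (x : U M N θ₀) :
    antipodeU hN θ₀ (parityHom M N θ₀ x) = parityHom M N θ₀ (antipodeU hN θ₀ x) := by
  refine gen_induction (p := fun x =>
    antipodeU hN θ₀ (parityHom M N θ₀ x) = parityHom M N θ₀ (antipodeU hN θ₀ x)) ?_ ?_ ?_ ?_ x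
  · simp [antipodeU_one]
  · intro x y hx hy; simp only [map_add, hx, hy]
  · intro r x hx; simp only [map_smul, hx]
  · intro i j n x hx
    rw [map_mul, parityHom_gen, smul_mul_assoc, map_smul, antipodeU_gen_mul, antipodeU_gen_mul,
      map_mul, hx, parityHom_Tinv, mul_smul_comm, parityPow_parityHom]

lemma antipodeU_parityPow (e : ZMod 2) (x : U M N θ₀) :
    antipodeU hN θ₀ (parityPow (parityHom M N θ₀) e x) =
      parityPow (parityHom M N θ₀) e (antipodeU hN θ₀ x) := by
  unfold parityPow; split_ifs
  · rfl
  · exact antipodeU_parityHom hN x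

lemma mul_rTensor_antipodeU (x : U M N θ₀) :
    LinearMap.mul' ℂ _ ((antipodeU hN θ₀).rTensor _ (comulU M N θ₀ x)) =
      algebraMap ℂ _ (counitU M N θ₀ x) := by
  refine gen_induction (p := fun x =>
    LinearMap.mul' ℂ _ ((antipodeU hN θ₀).rTensor _ (comulU M N θ₀ x)) =
      algebraMap ℂ _ (counitU M N θ₀ x)) ?_ ?_ ?_ ?_ x
  · simp [comulU_one, antipodeU_one]
  · intro x y hx hy; simp only [map_add, hx, hy]
  · intro r x hx; rw [map_smul, map_smul, map_smul, hx, map_smul, smul_eq_mul, map_mul, Algebra.smul_def]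
  · intro i j n x hx
    rw [comulU_gen_mul, map_mul, counitU_gen]
    suffices h : ∀ t : U M N θ₀ ⊗[ℂ] U M N θ₀,
        LinearMap.mul' ℂ _ ((antipodeU hN θ₀).rTensor _
          (∑ k : Idx M N, ∑ m ∈ Finset.HasAntidiagonal.antidiagonal n,
            TensorProduct.map (opU (gen θ₀ i k m.1) (par θ₀ k + par θ₀ j))
              (LinearMap.mulLeft ℂ (gen θ₀ k j m.2)) t)) =
        (if n = 0 then if i = j then (1 : ℂ) else 0 else 0) •
          LinearMap.mul' ℂ _ ((antipodeU hN θ₀).rTensor _ t) by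
      rw [h, hx, Algebra.smul_def, ← map_mul]
    -- The claim is linear in the tensor and is needed for all tensors: in S(T) ⋯ T the factor S(x')
    -- stands outside, so T⁻¹ and T are adjacent and cancel before the induction hypothesis is used.
    intro t
    induction t with
    | zero => simp
    | add a b ha hb => simp only [map_add, Finset.sum_add_distrib, ha, hb, smul_add]
    | tmul a b =>
      simp only [map_sum, TensorProduct.map_tmul, LinearMap.rTensor_tmul, Parity.mulPow_apply,
        antipodeU_gen_mul, parityU_hom, antipodeU_parityPow, LinearMap.mul'_apply,
        LinearMap.mulLeft_apply, parityPow_parityPow (g := parityHom M N θ₀) (parityU M N θ₀).hom_hom]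
      have e : ∀ k : Idx M N, par θ₀ i + par θ₀ k + (par θ₀ k + par θ₀ j) = par θ₀ i + par θ₀ j := by
        intro k
        generalize par θ₀ i = a, par θ₀ j = b, par θ₀ k = c
        revert a b c; decide
      have h2 := congrArg (fun z => parityPow (parityHom M N θ₀) (par θ₀ i + par θ₀ j)
        (antipodeU hN θ₀ a) * z * b) (sum_Tinv_mul_gen (θ₀ := θ₀) hN i j n)
      simp only [Finset.mul_sum, Finset.sum_mul] at h2
      simp only [e]
      simp only [mul_assoc] at h2 ⊢
      rw [h2]
      by_cases hn : n = 0
      · by_cases hij : i = j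
        · subst hij; simp [hn, CharTwo.add_self_eq_zero, parityPow]
        · simp [hij]
      · simp [hn]

lemma mul_lTensor_antipodeU (x : U M N θ₀) :
    LinearMap.mul' ℂ _ ((antipodeU hN θ₀).lTensor _ (comulU M N θ₀ x)) =
      algebraMap ℂ _ (counitU M N θ₀ x) := by
  refine gen_induction (p := fun x =>
    LinearMap.mul' ℂ _ ((antipodeU hN θ₀).lTensor _ (comulU M N θ₀ x)) =
      algebraMap ℂ _ (counitU M N θ₀ x)) ?_ ?_ ?_ ?_ x
  · simp [comulU_one, antipodeU_one]
  · intro x y hx hy; simp only [map_add, hx, hy]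
  · intro r x hx; rw [map_smul, map_smul, map_smul, hx, map_smul, smul_eq_mul, map_mul, Algebra.smul_def]
  · intro i j n x hx
    rw [comulU_gen_mul, map_mul, counitU_gen]
    -- On this side T and T⁻¹ enclose the contribution of x, so the induction hypothesis must first
    -- reduce that contribution to a scalar.
    have key : ∀ (k : Idx M N) (m : ℕ × ℕ) (t : U M N θ₀ ⊗[ℂ] U M N θ₀),
        LinearMap.mul' ℂ _ ((antipodeU hN θ₀).lTensor _
          (TensorProduct.map (opU (gen θ₀ i k m.1) (par θ₀ k + par θ₀ j))
              (LinearMap.mulLeft ℂ (gen θ₀ k j m.2)) t)) =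
        gen θ₀ i k m.1 * parityPow (parityHom M N θ₀) (par θ₀ k + par θ₀ j)
          (LinearMap.mul' ℂ _ ((antipodeU hN θ₀).lTensor _ t)) *
            PowerSeries.coeff m.2 (Tinv hN θ₀ k j) := by
      intro k m t
      induction t with
      | zero => simp
      | add a b ha hb => simp only [map_add, ha, hb, mul_add, add_mul]
      | tmul a b =>
        simp only [TensorProduct.map_tmul, LinearMap.lTensor_tmul, Parity.mulPow_apply,
          antipodeU_gen_mul, parityU_hom, LinearMap.mul'_apply, LinearMap.mulLeft_apply, map_mul,
          mul_assoc]
    simp only [map_sum, key, hx, AlgHom.commutes]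
    simp only [← Algebra.commutes, mul_assoc]
    simp only [← Finset.mul_sum]
    rw [sum_gen_mul_Tinv]
    by_cases hn : n = 0 <;> by_cases hij : i = j <;> simp [hn, hij]

/-- The Hopf superalgebra structure of `U(R)`. -/
def hopfData (θ₀ : ℤˣ) : (parityU M N θ₀).HopfData where
  comul := comulU M N θ₀
  counit := counitU M N θ₀
  antipode := antipodeU hN θ₀
  coassoc := comulU_coassoc
  counit_left := rTensor_counitU_comulU
  counit_right := lTensor_counitU_comulU
  comul_one := comulU_one
  comul_mul := comulU_mul
  comul_hom := comulU_parityHom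
  counit_hom := counitU_parityHom
  antipode_hom := antipodeU_parityHom hN
  antipode_left := mul_rTensor_antipodeU hN
  antipode_right := mul_lTensor_antipodeU hN

lemma isStandard_hopf : IsStandard (hopfData (M := M) hN θ₀).hopf := by
  have h : (T M N θ₀).map (mapCoeff (hopfData (M := M) hN θ₀).hopf.antipode) = Tinv hN θ₀ := by
    ext i j n
    simp only [Matrix.map_apply, mapCoeff, PowerSeries.coeff_mk, coeff_T]
    exact antipodeU_gen hN i j n
  refine ⟨parityHom_gen, comulU_gen, ?_, by rw [h, Tinv_mul_T], by rw [h, T_mul_Tinv]⟩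
  ext i j n
  simp only [Matrix.map_apply, mapCoeff, PowerSeries.coeff_mk, coeff_T]
  refine (counitU_gen i j n).trans ?_
  rw [Matrix.one_apply]
  by_cases hij : i = j <;> simp [hij, PowerSeries.coeff_one]

end Antipode

/-! ### The central series and the quotient -/

section Central

variable {M N : ℕ} {θ₀ : ℤˣ} {c : PowerSeries (U M N θ₀)}

lemma comulU_coeff_of_nonempty [Nonempty (Idx M N)]
    (hc : C M N θ₀ = Matrix.diagonal (fun _ => c))
    (heven : ∀ n, parityHom M N θ₀ (PowerSeries.coeff n c) = PowerSeries.coeff n c) (n : ℕ) :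
    comulU M N θ₀ (PowerSeries.coeff n c) =
      ∑ m ∈ Finset.HasAntidiagonal.antidiagonal n,
        PowerSeries.coeff m.1 c ⊗ₜ[ℂ] PowerSeries.coeff m.2 c := by
  obtain ⟨i₀⟩ := ‹Nonempty (Idx M N)›
  set X := (T M N θ₀).map (PowerSeries.mapAlgHom (inl M N θ₀)) with hX
  set Y := (T M N θ₀).map (PowerSeries.mapAlgHom (inr M N θ₀)) with hY
  set c₁ := PowerSeries.mapAlgHom (inl M N θ₀) c with hc₁
  set c₂ := PowerSeries.mapAlgHom (inr M N θ₀) c with hc₂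
  have hmap : ∀ {A : Type} [Ring A] [Algebra ℂ A] (f : U M N θ₀ →ₐ[ℂ] A),
      contraction θ₀ ((T M N θ₀).map (PowerSeries.mapAlgHom f)) =
        Matrix.diagonal fun _ => PowerSeries.mapAlgHom f c := fun f => by
    rw [← contraction_map, contraction_T, hc, Matrix.diagonal_map (map_zero _)]
  have hc₁X : contraction θ₀ X = Matrix.diagonal fun _ => c₁ := hmap _
  have hc₂Y : contraction θ₀ Y = Matrix.diagonal fun _ => c₂ := hmap _
  have hcXY : contraction θ₀ (X * Y) =
      Matrix.diagonal fun _ => PowerSeries.mapAlgHom (comulHom M N θ₀) c := by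
    rw [← hmap, T_map_eq comulHom_gen, comulMatrix]
  have heven0 : ∀ n, parityHom M N θ₀ (PowerSeries.coeff n c) =
      sgn 0 • PowerSeries.coeff n c := fun n => by rw [heven, sgn_zero, one_smul]
  -- Coefficients of c are even, so c ⊗ 1 commutes with 1 ⊗ T without sign.
  have hcY : ∀ i j, c₁ * Y i j = Y i j * c₁ := by
    intro i j
    refine (series_superCommute (ε := 1) fun m n => ?_).trans (one_smul ℂ _)
    rw [one_smul, hY, hc₁, Matrix.map_apply]
    simp only [PowerSeries.mapAlgHom_apply, PowerSeries.coeff_map, coeff_T, RingHom.coe_coe]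
    rw [inr_mul_inl (heven0 m) (parityHom_gen i j n), zero_mul, sgn_zero, one_smul]
  -- YᵗXᵗXY = Yᵗ c₁ Y = YᵗY c₁ = c₂ c₁, the transposes being shifted by κ.
  have h1 : contraction θ₀ (X * Y) = Matrix.diagonal fun _ => c₂ * c₁ := by
    rw [contraction, transp_mul fun i j k l => series_superCommute fun m n =>
      superCommute_inl_inr i j k l m n]
    have h2 : (transp θ₀ Y * transp θ₀ X).map (shift (kappa M N θ₀)) =
        (transp θ₀ Y).map (shift (kappa M N θ₀)) * (transp θ₀ X).map (shift (kappa M N θ₀)) :=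
      Matrix.map_mul (f := shiftHom (Sq M N θ₀) (kappa M N θ₀))
    have h3 : (Matrix.diagonal fun _ : Idx M N => c₁) * Y =
        Y * Matrix.diagonal fun _ => c₁ := by
      ext1 i j
      rw [Matrix.diagonal_mul, Matrix.mul_diagonal, hcY]
    rw [h2, mul_assoc, ← mul_assoc _ X Y]
    rw [show (transp θ₀ X).map (shift (kappa M N θ₀)) * X = contraction θ₀ X from rfl, hc₁X, h3,
      ← mul_assoc, show (transp θ₀ Y).map (shift (kappa M N θ₀)) * Y = contraction θ₀ Y from rfl,
      hc₂Y, Matrix.diagonal_mul_diagonal]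
  rw [hcXY] at h1
  have h2 := congrFun (congrFun h1 i₀) i₀
  rw [Matrix.diagonal_apply_eq, Matrix.diagonal_apply_eq] at h2
  have h3 := congrArg (PowerSeries.coeff n) h2
  apply (toSq M N θ₀).injective
  rw [PowerSeries.mapAlgHom_apply, PowerSeries.coeff_map, PowerSeries.coeff_mul,
    ← Finset.Nat.sum_antidiagonal_swap] at h3
  rw [toSq_comulU, map_sum]
  refine h3.trans (Finset.sum_congr rfl fun m _ => ?_)
  rw [hc₁, hc₂]
  simp only [PowerSeries.mapAlgHom_apply, PowerSeries.coeff_map, RingHom.coe_coe, Prod.fst_swap,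
    Prod.snd_swap]
  rw [inr_mul_inl (heven0 m.1) (heven0 m.2), zero_mul, sgn_zero, one_smul, inl_mul_inr]

/-- The central series is grouplike. -/
lemma comulU_coeff (hc : C M N θ₀ = Matrix.diagonal (fun _ => c))
    (hE : IsEmpty (Idx M N) → c = 1) (n : ℕ) :
    comulU M N θ₀ (PowerSeries.coeff n c) =
      ∑ m ∈ Finset.HasAntidiagonal.antidiagonal n,
        PowerSeries.coeff m.1 c ⊗ₜ[ℂ] PowerSeries.coeff m.2 c := by
  rcases isEmpty_or_nonempty (Idx M N) with h | h
  · rw [hE h]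
    simp only [PowerSeries.coeff_one]
    by_cases hn : n = 0
    · simp [hn, comulU_one]
    · rw [if_neg hn, map_zero, Finset.sum_eq_zero]
      rintro ⟨a, b⟩ hab
      rw [Finset.HasAntidiagonal.mem_antidiagonal] at hab
      by_cases ha : a = 0
      · have hb : b ≠ 0 := by rintro rfl; exact hn (by simpa [ha] using hab.symm)
        simp [hb]
      · simp [ha]
  · exact comulU_coeff_of_nonempty hc (parityHom_coeff hc hE) n

lemma sum_antidiagonal_coeff_one {A G : Type*} [Ring A] [AddCommMonoid G] (F : ℕ → A → G)
    (hF : ∀ m, F m 0 = 0) (n : ℕ) :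
    ∑ m ∈ Finset.HasAntidiagonal.antidiagonal n,
      F m.1 (PowerSeries.coeff m.2 (1 : PowerSeries A)) = F n 1 := by
  rw [Finset.sum_eq_single (n, 0)]
  · simp
  · rintro ⟨a, b⟩ hab h
    rw [Finset.HasAntidiagonal.mem_antidiagonal] at hab
    have hb : b ≠ 0 := by rintro rfl; exact h (by simpa using hab)
    simp [PowerSeries.coeff_one, hb, hF]
  · simp

/-- Induction on the ideal generated by the coefficients of `c(u) - 1`. -/
lemma idealC_induction (hc : C M N θ₀ = Matrix.diagonal (fun _ => c)) {p : U M N θ₀ → Prop}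
    (coeff : ∀ n, p (PowerSeries.coeff n c - PowerSeries.coeff n 1)) (zero : p 0)
    (add : ∀ x y, p x → p y → p (x + y)) (neg : ∀ x, p x → p (-x))
    (left : ∀ a x, p x → p (a * x)) (right : ∀ a x, p x → p (x * a)) {x : U M N θ₀}
    (hx : x ∈ idealC M N θ₀) : p x := by
  rw [idealC, TwoSidedIdeal.mem_asIdeal] at hx
  induction hx using TwoSidedIdeal.span_induction with
  | mem x h =>
    obtain ⟨i, j, n, rfl⟩ := h
    rw [hc, Matrix.sub_apply, map_sub, Matrix.one_apply]
    by_cases hij : i = j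
    · subst hij
      rw [Matrix.diagonal_apply_eq, if_pos rfl]
      exact coeff n
    · rw [Matrix.diagonal_apply_ne _ hij, if_neg hij, map_zero, sub_zero]
      exact zero
  | zero => exact zero
  | add x y _ _ hx hy => exact add x y hx hy
  | neg x _ hx => exact neg x hx
  | left_absorb a x _ hx => exact left a x hx
  | right_absorb a x _ hx => exact right a x hx

/-- The projection to the quotient by the ideal generated by `c(u) - 1`. -/
abbrev quotC (M N : ℕ) (θ₀ : ℤˣ) : U M N θ₀ →ₐ[ℂ] U M N θ₀ ⧸ idealC M N θ₀ :=
  Ideal.Quotient.mkₐ ℂ (idealC M N θ₀)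

lemma quotC_eq_zero {x : U M N θ₀} : quotC M N θ₀ x = 0 ↔ x ∈ idealC M N θ₀ :=
  Ideal.Quotient.eq_zero_iff_mem

lemma quotC_coeff (hc : C M N θ₀ = Matrix.diagonal (fun _ => c))
    (hE : IsEmpty (Idx M N) → c = 1) (n : ℕ) :
    quotC M N θ₀ (PowerSeries.coeff n c) = PowerSeries.coeff n 1 := by
  have h1 : (PowerSeries.coeff n 1 : U M N θ₀ ⧸ idealC M N θ₀) =
      quotC M N θ₀ (PowerSeries.coeff n 1) := by
    rw [PowerSeries.coeff_one, PowerSeries.coeff_one]; split_ifs <;> simp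
  rw [h1, ← sub_eq_zero, ← map_sub, quotC_eq_zero]
  rcases isEmpty_or_nonempty (Idx M N) with h | ⟨⟨i⟩⟩
  · rw [hE h, sub_self]; exact zero_mem _
  · rw [idealC, TwoSidedIdeal.mem_asIdeal]
    refine TwoSidedIdeal.subset_span ⟨i, i, n, ?_⟩
    rw [hc, Matrix.sub_apply, map_sub, Matrix.one_apply_eq, Matrix.diagonal_apply_eq]

lemma algHom_eq_zero_of_mem_idealC {A : Type*} [Ring A] [Algebra ℂ A]
    (hc : C M N θ₀ = Matrix.diagonal (fun _ => c)) {f : U M N θ₀ →ₐ[ℂ] A}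
    (hf : ∀ n, f (PowerSeries.coeff n c) = PowerSeries.coeff n 1) {x : U M N θ₀}
    (hx : x ∈ idealC M N θ₀) : f x = 0 := by
  refine idealC_induction hc (p := fun x => f x = 0) (fun n => ?_) (map_zero f)
    (fun x y hx hy => by rw [map_add, hx, hy, add_zero]) (fun x hx => by rw [map_neg, hx, neg_zero])
    (fun a x hx => by rw [map_mul, hx, mul_zero]) (fun a x hx => by rw [map_mul, hx, zero_mul]) hx
  rw [map_sub, hf, PowerSeries.coeff_one, PowerSeries.coeff_one]
  split_ifs <;> simp

lemma quotC_parityHom (hc : C M N θ₀ = Matrix.diagonal (fun _ => c)) (hE : IsEmpty (Idx M N) → c = 1)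
    {x : U M N θ₀} (hx : quotC M N θ₀ x = 0) :
    quotC M N θ₀ (parityHom M N θ₀ x) = 0 :=
  algHom_eq_zero_of_mem_idealC hc (f := (quotC M N θ₀).comp (parityHom M N θ₀))
    (fun n => by rw [AlgHom.comp_apply, parityHom_coeff hc hE, quotC_coeff hc hE])
    (quotC_eq_zero.mp hx)

lemma counitU_coeff (hc : C M N θ₀ = Matrix.diagonal (fun _ => c)) (hE : IsEmpty (Idx M N) → c = 1)
    (n : ℕ) : counitU M N θ₀ (PowerSeries.coeff n c) = PowerSeries.coeff n 1 := by
  rcases isEmpty_or_nonempty (Idx M N) with h | ⟨⟨i⟩⟩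
  · rw [hE h, PowerSeries.coeff_one, PowerSeries.coeff_one]; split_ifs <;> simp
  · have h1 : (T M N θ₀).map (PowerSeries.mapAlgHom (counitU M N θ₀)) = 1 :=
      T_map_eq fun i j n => lift_gen _ _ _ i j n
    have h2 : transp θ₀ (1 : Matrix (Idx M N) (Idx M N) (PowerSeries ℂ)) = 1 := by
      ext1 i j
      rw [transp, Matrix.of_apply]
      by_cases hij : i = j
      · subst hij
        have : par θ₀ i * par θ₀ i + par θ₀ i = 0 := by
          generalize par θ₀ i = b; revert b; decide
        simp [par_bar, this, theta_mul_self]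
      · rw [Matrix.one_apply_ne hij, Matrix.one_apply_ne fun h => hij (bar_injective h).symm,
          smul_zero]
    have h3 := congrArg (fun Z => Z.map (PowerSeries.mapAlgHom (counitU M N θ₀))) hc
    simp only [← contraction_T, contraction_map, h1] at h3
    rw [contraction, h2, mul_one, Matrix.diagonal_map (map_zero _)] at h3
    have h4 := congrArg (PowerSeries.coeff n) (congrFun (congrFun h3 i) i)
    rw [Matrix.diagonal_apply_eq, Matrix.map_apply, Matrix.one_apply_eq, ← shiftHom_apply, map_one,
      PowerSeries.mapAlgHom_apply, PowerSeries.coeff_map] at h4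
    exact h4.symm

lemma counitU_eq_zero (hc : C M N θ₀ = Matrix.diagonal (fun _ => c)) (hE : IsEmpty (Idx M N) → c = 1)
    {x : U M N θ₀} (hx : quotC M N θ₀ x = 0) : counitU M N θ₀ x = 0 :=
  algHom_eq_zero_of_mem_idealC hc (counitU_coeff hc hE) (quotC_eq_zero.mp hx)

end Central

/-! ### The antipode preserves the ideal. -/

section AntipodeCentral

variable {M N : ℕ} {θ₀ : ℤˣ} {c : PowerSeries (U M N θ₀)} (hN : Even N)

/-- On elements of degree e the action is v ↦ g^e(v) S(x), where g is the parity. The combination x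
+ (-1)^e g(x) is the generic element of degree e; stating the result for it, for all e at once,
allows induction over arbitrary x. -/
lemma antipodeHom_add_parityHom (x : U M N θ₀) (e : ZMod 2) (v : U M N θ₀) :
    antipodeHom hN θ₀ (x + sgn e • parityHom M N θ₀ x) v =
      parityPow (parityHom M N θ₀) e v *
        antipodeU hN θ₀ (x + sgn e • parityHom M N θ₀ x) := by
  revert e v
  refine gen_induction (p := fun x => ∀ (e : ZMod 2) (v : U M N θ₀),
    antipodeHom hN θ₀ (x + sgn e • parityHom M N θ₀ x) v =
      parityPow (parityHom M N θ₀) e v *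
        antipodeU hN θ₀ (x + sgn e • parityHom M N θ₀ x)) ?_ ?_ ?_ ?_ x
  · intro e v
    have h : ∀ z : ZMod 2, z = 0 ∨ z = 1 := by decide
    rcases h e with rfl | rfl
    · simp [sgn_zero, parityPow, antipodeU_one, mul_add]
    · have h0 : (1 : U M N θ₀) + sgn 1 • parityHom M N θ₀ 1 = 0 := by
        rw [Parity.sgn_one, map_one]; module
      rw [h0, map_zero, map_zero, mul_zero, LinearMap.zero_apply]
  · intro x y hx hy e v
    have h : x + y + sgn e • parityHom M N θ₀ (x + y) =
        (x + sgn e • parityHom M N θ₀ x) + (y + sgn e • parityHom M N θ₀ y) := by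
      rw [map_add, smul_add]; abel
    rw [h, map_add, LinearMap.add_apply, hx, hy, map_add (antipodeU hN θ₀) (_ + _), mul_add]
  · intro r x hx e v
    have h : r • x + sgn e • parityHom M N θ₀ (r • x) =
        r • (x + sgn e • parityHom M N θ₀ x) := by
      rw [map_smul, smul_add, smul_comm]
    rw [h, map_smul, LinearMap.smul_apply, hx, map_smul, mul_smul_comm]
  · intro i j n x hx e v
    have h : gen θ₀ i j n * x + sgn e • parityHom M N θ₀ (gen θ₀ i j n * x) =
        gen θ₀ i j n *
          (x + sgn (par θ₀ i + par θ₀ j + e) • parityHom M N θ₀ x) := by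
      rw [map_mul, parityHom_gen, mul_add, smul_mul_assoc, smul_smul, mul_smul_comm, ← sgn_add,
        add_comm e]
    rw [h, map_mul, Module.End.mul_apply, hx, antipodeHom_gen, antipodeU_gen_mul, map_mul,
      parityPow_parityPow (g := parityHom M N θ₀) (parityU M N θ₀).hom_hom, mul_assoc]
    congr 2
    rw [← add_assoc, CharTwo.add_self_eq_zero, zero_add]

lemma antipodeHom_of_even {x : U M N θ₀} (hx : parityHom M N θ₀ x = x) (v : U M N θ₀) :
    antipodeHom hN θ₀ x v = v * antipodeU hN θ₀ x := by
  have h := antipodeHom_add_parityHom hN x 0 v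
  rw [hx, sgn_zero, one_smul, ← two_smul ℂ x, map_smul, map_smul, LinearMap.smul_apply,
    mul_smul_comm] at h
  simpa [parityPow] using h

/-- The action is built from parity powers and right multiplications, and a parity-stable two-sided
ideal is closed under both. -/
lemma quotC_antipodeHom (hc : C M N θ₀ = Matrix.diagonal (fun _ => c)) (hE : IsEmpty (Idx M N) → c = 1)
    (x v : U M N θ₀) (hv : quotC M N θ₀ v = 0) :
    quotC M N θ₀ (antipodeHom hN θ₀ x v) = 0 := by
  revert v
  refine gen_induction (p := fun x => ∀ v, quotC M N θ₀ v = 0 →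
    quotC M N θ₀ (antipodeHom hN θ₀ x v) = 0) ?_ ?_ ?_ ?_ x
  · intro v hv; rwa [map_one, Module.End.one_apply]
  · intro x y hx hy v hv
    rw [map_add, LinearMap.add_apply, map_add, hx v hv, hy v hv, add_zero]
  · intro r x hx v hv
    rw [map_smul, LinearMap.smul_apply, map_smul, hx v hv, smul_zero]
  · intro i j n x hx v hv
    have h : ∀ e w, quotC M N θ₀ w = 0 →
        quotC M N θ₀ (parityPow (parityHom M N θ₀) e w) = 0 := by
      intro e w hw
      unfold parityPow; split_ifs
      exacts [hw, quotC_parityHom hc hE hw]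
    rw [map_mul, Module.End.mul_apply, antipodeHom_gen, map_mul, h _ _ (hx v hv), zero_mul]

/-- Since c is grouplike, the antipode axiom reads S(c) c = ε(c) = 1; modulo the ideal the factor c
is 1. -/
lemma quotC_antipodeU_coeff (hc : C M N θ₀ = Matrix.diagonal (fun _ => c)) (hE : IsEmpty (Idx M N) → c = 1)
    (n : ℕ) :
    quotC M N θ₀ (antipodeU hN θ₀ (PowerSeries.coeff n c)) = PowerSeries.coeff n 1 := by
  have h := congrArg (quotC M N θ₀) (mul_rTensor_antipodeU hN (PowerSeries.coeff n c))
  rw [comulU_coeff hc hE, counitU_coeff hc hE, map_sum, map_sum, map_sum, AlgHom.commutes] at h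
  simp only [LinearMap.rTensor_tmul, LinearMap.mul'_apply, map_mul, quotC_coeff hc hE] at h
  rw [sum_antidiagonal_coeff_one (fun m y => quotC M N θ₀ (antipodeU hN θ₀
    (PowerSeries.coeff m c)) * y) (fun m => mul_zero _), mul_one] at h
  rw [h, PowerSeries.coeff_one, PowerSeries.coeff_one]
  split_ifs <;> simp

lemma quotC_antipodeU (hc : C M N θ₀ = Matrix.diagonal (fun _ => c)) (hE : IsEmpty (Idx M N) → c = 1)
    {x : U M N θ₀} (hx : quotC M N θ₀ x = 0) :
    quotC M N θ₀ (antipodeU hN θ₀ x) = 0 := by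
  -- The statement is strengthened to the action on every v. Multiples of x then compose two
  -- operators, so antimultiplicativity of S for general elements is not needed. The desired case is
  -- v = 1.
  refine idealC_induction hc (p := fun x => ∀ v, quotC M N θ₀ (antipodeHom hN θ₀ x v) = 0)
    ?_ ?_ ?_ ?_ ?_ ?_ (quotC_eq_zero.mp hx) 1
  · intro n v
    have h1 : parityHom M N θ₀ (PowerSeries.coeff n (1 : PowerSeries (U M N θ₀))) =
        PowerSeries.coeff n 1 := by
      rw [PowerSeries.coeff_one]; split_ifs <;> simp
    have h2 : quotC M N θ₀ (antipodeU hN θ₀ (PowerSeries.coeff n 1)) =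
        PowerSeries.coeff n 1 := by
      rw [PowerSeries.coeff_one, PowerSeries.coeff_one]
      split_ifs <;> simp [antipodeU_one]
    rw [map_sub, LinearMap.sub_apply, antipodeHom_of_even hN (parityHom_coeff hc hE n),
      antipodeHom_of_even hN h1, map_sub, map_mul, map_mul, quotC_antipodeU_coeff hN hc hE, h2,
      sub_self]
  · intro v; simp
  · intro x y hx hy v; rw [map_add, LinearMap.add_apply, map_add, hx, hy, add_zero]
  · intro x hx v; rw [map_neg, LinearMap.neg_apply, map_neg, hx, neg_zero]
  · intro a x hx v
    rw [map_mul, Module.End.mul_apply]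
    exact quotC_antipodeHom hN hc hE a _ (hx v)
  · intro a x hx v
    rw [map_mul, Module.End.mul_apply, hx]

end AntipodeCentral

/-! ### The coideal property. -/

section Main

variable {M N : ℕ} {θ₀ : ℤˣ} {c : PowerSeries (U M N θ₀)}

/-- The coideal property, checked in the tensor square of the quotient. -/
lemma isCoideal_of_map_eq_zero {A : Type*} [Ring A] [Algebra ℂ A] (H : HopfSuperalgebra ℂ A)
    (I : Ideal A) [I.IsTwoSided] (hcounit : ∀ x ∈ I, H.counit x = 0)
    (hcomul : ∀ x ∈ I, TensorProduct.map (Ideal.Quotient.mkₐ ℂ I).toLinearMap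
      (Ideal.Quotient.mkₐ ℂ I).toLinearMap (H.comul x) = 0) : H.IsCoideal I := by
  refine ⟨hcounit, fun x hx => ?_⟩
  have hex : Function.Exact (I.restrictScalars ℂ).subtype
      (Ideal.Quotient.mkₐ ℂ I).toLinearMap := fun y => by
    rw [AlgHom.toLinearMap_apply, Ideal.Quotient.mkₐ_eq_mk, Ideal.Quotient.eq_zero_iff_mem]
    simp
  have hsurj : Function.Surjective (Ideal.Quotient.mkₐ ℂ I).toLinearMap :=
    Ideal.Quotient.mkₐ_surjective ℂ I
  -- By right exactness of the tensor product, the kernel of π ⊗ π is I ⊗ A + A ⊗ I.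
  have h := TensorProduct.map_ker hex hsurj hex hsurj
  rw [sup_comm, ← h]
  exact hcomul x hx

/-- The composite (π ⊗ π) ∘ Δ is an algebra homomorphism into the graded square of the quotient. It
sends c = c(u) to π(c) ⊗ π(c) = 1, so it annihilates the whole two-sided ideal. -/
lemma map_quotC_comulU (hc : C M N θ₀ = Matrix.diagonal (fun _ => c))
    (hE : IsEmpty (Idx M N) → c = 1) {x : U M N θ₀} (hx : quotC M N θ₀ x = 0) :
    TensorProduct.map (quotC M N θ₀).toLinearMap (quotC M N θ₀).toLinearMap
      (comulU M N θ₀ x) = 0 := by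
  -- The parity descends to the quotient; without it the graded product on the square of the
  -- quotient would not be defined.
  obtain ⟨g, hg⟩ := Parity.exists_descent_algHom (Ideal.Quotient.mkₐ_surjective ℂ (idealC M N θ₀))
    ((quotC M N θ₀).comp (parityHom M N θ₀)) fun _ h => quotC_parityHom hc hE h
  let q : Parity (U M N θ₀ ⧸ idealC M N θ₀) := ⟨g, fun x => by
    obtain ⟨x, rfl⟩ := Ideal.Quotient.mkₐ_surjective ℂ (idealC M N θ₀) x
    rw [hg, AlgHom.comp_apply, hg, AlgHom.comp_apply]
    exact congrArg _ ((parityU M N θ₀).hom_hom x)⟩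
  let ψ := Parity.mapSq (parityU M N θ₀) q (quotC M N θ₀)
  have hψ : ∀ x, ψ (comulHom M N θ₀ x) = GradedTensorProduct.of ℂ q.grading q.grading
      (TensorProduct.map (quotC M N θ₀).toLinearMap (quotC M N θ₀).toLinearMap
        (comulU M N θ₀ x)) := fun x => by
    rw [← toSq_comulU]
    exact Parity.mapSq_of _
  let f : U M N θ₀ →ₐ[ℂ] GradedTensorProduct ℂ q.grading q.grading :=
    AlgHom.ofLinearMap (ψ ∘ₗ (comulHom M N θ₀).toLinearMap)
      (by
        rw [LinearMap.comp_apply, AlgHom.toLinearMap_apply, hψ, comulU_one, TensorProduct.map_tmul,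
          AlgHom.toLinearMap_apply, map_one]
        rfl)
      (fun x y => by
        simp only [LinearMap.comp_apply, AlgHom.toLinearMap_apply, map_mul]
        exact Parity.mapSq_mul hg _ _)
  have h := algHom_eq_zero_of_mem_idealC hc (f := f) (fun n => by
    refine (hψ _).trans ?_
    rw [comulU_coeff hc hE, map_sum]
    simp only [TensorProduct.map_tmul, AlgHom.toLinearMap_apply, quotC_coeff hc hE]
    rw [sum_antidiagonal_coeff_one (fun m y => PowerSeries.coeff m
      (1 : PowerSeries (U M N θ₀ ⧸ idealC M N θ₀)) ⊗ₜ[ℂ] y) (fun m => TensorProduct.tmul_zero _ _),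
      PowerSeries.coeff_one, PowerSeries.coeff_one]
    split_ifs
    · rfl
    · rw [TensorProduct.zero_tmul, map_zero]) (quotC_eq_zero.mp hx)
  exact (GradedTensorProduct.of ℂ q.grading q.grading).map_eq_zero_iff.mp ((hψ x).symm.trans h)

end Main

end RTT

end

theorem mainTheorem2 (M N : ℕ) (hN : Even N) (θ₀ : ℤˣ) :
    ∃ c : PowerSeries (RTT.U M N θ₀),
      RTT.C M N θ₀ = Matrix.diagonal (fun _ => c) ∧
      (∀ n : ℕ, PowerSeries.coeff n c ∈ Subalgebra.center ℂ (RTT.U M N θ₀)) ∧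
      ∃ H : HopfSuperalgebra ℂ (RTT.U M N θ₀),
        RTT.IsStandard H ∧
        (∀ n : ℕ, H.comul (PowerSeries.coeff n c) =
          ∑ m ∈ Finset.HasAntidiagonal.antidiagonal n,
            PowerSeries.coeff m.1 c ⊗ₜ[ℂ] PowerSeries.coeff m.2 c) ∧
        H.IsCoideal (RTT.idealC M N θ₀) ∧
        ∃ H' : HopfSuperalgebra ℂ (RTT.U M N θ₀ ⧸ RTT.idealC M N θ₀),
          H.IsHom H' (Ideal.Quotient.mkₐ ℂ (RTT.idealC M N θ₀)) := by
  obtain ⟨c, hc, -, hcomm, -, hE⟩ := RTT.exists_central (M := M) (θ₀ := θ₀) hN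
  refine ⟨c, hc, fun n => Subalgebra.mem_center_iff.mpr fun x => (hcomm n x).symm.eq,
    (RTT.hopfData hN θ₀).hopf, RTT.isStandard_hopf hN, RTT.comulU_coeff hc hE, ?_, ?_⟩
  · exact RTT.isCoideal_of_map_eq_zero _ _
      (fun x hx => RTT.counitU_eq_zero hc hE (RTT.quotC_eq_zero.mpr hx))
      (fun x hx => RTT.map_quotC_comulU hc hE (RTT.quotC_eq_zero.mpr hx))
  · exact (RTT.hopfData hN θ₀).exists_quotient
      (Ideal.Quotient.mkₐ_surjective ℂ (RTT.idealC M N θ₀))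
      (fun _ h => RTT.quotC_parityHom hc hE h) (fun _ h => RTT.map_quotC_comulU hc hE h)
      (fun _ h => RTT.counitU_eq_zero hc hE h) (fun _ h => RTT.quotC_antipodeU hN hc hE h)
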